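/- **Conventions.** A predicate of arity $n\ge 1$ is a set $A\subseteq\omega^n$ together with its arity, and a function symbol of arity $n\ge 0$ is a total function $\omega^n\to\omega$. A *structure* is a set of predicates and function symbols containing $A=\{=,<,S,+,\cdot\}$ (with the usual interpretation). $M+X$ denotes $M\cup\{X\}$, where $X\subseteq\omega$ or $X\subseteq\omega^2$ is regarded as a unary or binary predicate. Definable means first-order definable over $\omega$ with the symbols of the structure, and $M\sim M'$ means that the same subsets of $\omega$ are definable in $M$ and $M'$. A structure is *$L$-finite* if it is finite. For $G\subseteq\omega^2$ put $G(n,\cdot)=\{x: G(n,x)\}$. $G$ is a *universal* predicate for $M$ if every subset of $\omega$ definable in $M$ is some $G(n,\cdot)$. It is a *proper universal* predicate if, in addition, every $G(n,\cdot)$ is definable in $M$. A (proper) universal predicate $P_0$ for $M$ is *canonic* if $P_0$ is definable in $M+P$ for every (proper) universal predicate $P$ for $M$. For a structure $N$ and an ordinal $\xi$ consider the sequences of structures $(M_\alpha)_{\alpha\le\xi}$ such that (1) $M_0=N$; (2) for every $\alpha<\xi$, $M_{\alpha+1}=M_\alpha+P_\alpha$ for some canonic universal predicate $P_\alpha$ for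 $M_\alpha$; (3) $M_\delta=\bigcup_{\alpha<\delta}M_\alpha$ for every limit $\delta\le\xi$. $\lambda(N)$ is the largest $\xi$ for which such a sequence exists, and a *Tarski hierarchy* over $N$ is such a sequence of length $\xi=\lambda(N)$. Replacing "canonic universal" by "canonic proper universal" one obtains the *proper Tarski hierarchy* and $\lambda^p(N)$. A *representation* of an ordinal $\alpha$ is a (non-strict) linear ordering $R\subseteq\omega^2$ of its range $\mathrm{Rng}(R)$ whose strict part $\prec_R$ is a well-ordering of type $\alpha$. For $\gamma<\alpha$, $R_\gamma$ denotes the $\gamma$-th element of $R$. The ordinal $\alpha$ is *definable in $N$* if it has a representation that is definable in $N$. A *coding* for $M$ is an injection $c:M\to\omega$. It is *compatible* with $R$ if $\mathrm{Rng}(c)\cap\mathrm{Rng}(R)=\emptyset$. Fix a Gödel numbering $[\ ]$ of finite sequences of natural numbers. An $n$-ary predicate $X\in M$ gets the number $2[c(X),n,0]$, an $n$-ary function symbol $X\in M$ gets $2[c(X),n,1]$, the symbols $\land,\lor,\lnot,\Rightarrow,\equiv,\forall,\exists,(,)$ get $1,3,5,\dots,17$, and the variable $x_i$ gets $2i+19$.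 The Gödel number of a formula is the code of the sequence of the numbers of its symbols, and $Tr_{M,c}\subseteq\omega$ is the set of Gödel numbers of the true sentences of $M$. If $R$ is a well-ordering compatible with $c$, then $Tr_{M,c,R}\subseteq\omega^2$ is the unique $U$ such that $U(n,\cdot)=\emptyset$ for $n\notin\mathrm{Rng}(R)$ and, for $n\in\mathrm{Rng}(R)$, $U(n,\cdot)=Tr_{M_{<n},c_n}$, where $M_{<n}=M+\{U(m,\cdot): m\prec_R n\}$ and $c_n$ extends $c$ by giving each predicate $U(m,\cdot)$, $m\prec_R n$, the code $m$. (For the $R$-first element $R_0$ this says $U(R_0,\cdot)=Tr_{M,c}$.) **Theorem.** Let $N$ be an $L$-finite structure and let $\beta$ be an ordinal definable in $N$. 1. $\beta<\lambda(N)$. 2. Let $(M_\alpha)_{\alpha\le\xi}$ be a sequence satisfying (1)–(3) with $\xi\ge\beta$, for instance a Tarski hierarchy over $N$. Let $c$ be a coding for $N$, let $R$ be a representation of $\beta+1$ that is compatible with $c$ and definable in $N$, and let $P_\beta$ be a canonic universal predicate for $M_\beta$. Then $$A+P_\beta\ \sim\ A+Tr_{N,c,R}(R_\beta,\cdot).$$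 The same holds for the proper notions: $\beta<\lambda^p(N)$, and the equivalence in 2 holds for sequences built with canonic proper universal predicates and for every canonic proper universal predicate $P_\beta$ for $M_\beta$. -/

import Mathlib

namespace UniversalPredicates

/-! ### Symbols, structures, syntax and semantics

Symbols are inherently interpreted over the natural numbers: a predicate is its arity together with
its extension, a function symbol is its arity together with its graph. -/

inductive Symb : Type
  | pred (n : ℕ) (hn : 0 < n) (A : Set (Fin n → ℕ)) : Symb
  | func (n : ℕ) (f : (Fin n → ℕ) → ℕ) : Symb

/-- The unary predicate with extension `X`. -/
def pred₁ (X : Set ℕ) : Symb := Symb.pred 1 Nat.one_pos {v | v 0 ∈ X}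

/-- The binary predicate with extension `P`. -/
def pred₂ (P : ℕ → ℕ → Prop) : Symb := Symb.pred 2 Nat.two_pos {v | P (v 0) (v 1)}

/-- Arithmetic: the symbols `=, <, S, +, ·` with their usual interpretation. Equality is one of the
predicates of the language; it is not a logical symbol. -/
def arith : Set Symb :=
  {pred₂ (fun x y => x = y), pred₂ (fun x y => x < y),
    Symb.func 1 (fun v => v 0 + 1), Symb.func 2 (fun v => v 0 + v 1),
    Symb.func 2 (fun v => v 0 * v 1)}

/-- A structure is a set of interpreted symbols that contains arithmetic. -/
def IsStructure (M : Set Symb) : Prop := arith ⊆ M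

/-- First-order terms; `var i` is the variable `x_i`. -/
inductive Tm : Type
  | var (i : ℕ) : Tm
  | app (n : ℕ) (f : (Fin n → ℕ) → ℕ) (ts : Fin n → Tm) : Tm

/-- First-order formulas. -/
inductive Fml : Type
  | atom (n : ℕ) (hn : 0 < n) (A : Set (Fin n → ℕ)) (ts : Fin n → Tm) : Fml
  | neg (φ : Fml) : Fml
  | and (φ ψ : Fml) : Fml
  | or (φ ψ : Fml) : Fml
  | imp (φ ψ : Fml) : Fml
  | iff (φ ψ : Fml) : Fml
  | all (i : ℕ) (φ : Fml) : Fml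
  | ex (i : ℕ) (φ : Fml) : Fml

/-- All symbols of the term belong to `M`. -/
def Tm.In (M : Set Symb) : Tm → Prop
  | .var _ => True
  | .app n f ts => Symb.func n f ∈ M ∧ ∀ k, (ts k).In M

/-- All symbols of the formula belong to `M`. -/
def Fml.In (M : Set Symb) : Fml → Prop
  | .atom n hn A ts => Symb.pred n hn A ∈ M ∧ ∀ k, (ts k).In M
  | .neg φ => φ.In M
  | .and φ ψ => φ.In M ∧ ψ.In M
  | .or φ ψ => φ.In M ∧ ψ.In M
  | .imp φ ψ => φ.In M ∧ ψ.In M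
  | .iff φ ψ => φ.In M ∧ ψ.In M
  | .all _ φ => φ.In M
  | .ex _ φ => φ.In M

def Tm.vars : Tm → Set ℕ
  | .var i => {i}
  | .app _ _ ts => ⋃ k, (ts k).vars

/-- The free variables of a formula. -/
def Fml.free : Fml → Set ℕ
  | .atom _ _ _ ts => ⋃ k, (ts k).vars
  | .neg φ => φ.free
  | .and φ ψ => φ.free ∪ ψ.free
  | .or φ ψ => φ.free ∪ ψ.free
  | .imp φ ψ => φ.free ∪ ψ.free
  | .iff φ ψ => φ.free ∪ ψ.free
  | .all i φ => φ.free \ {i}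
  | .ex i φ => φ.free \ {i}

def Tm.val (s : ℕ → ℕ) : Tm → ℕ
  | .var i => s i
  | .app _ f ts => f (fun k => (ts k).val s)

/-- Satisfaction of a formula by an assignment of natural numbers to the variables. -/
def Fml.Sat : Fml → (ℕ → ℕ) → Prop
  | .atom _ _ A ts, s => (fun k => (ts k).val s) ∈ A
  | .neg φ, s => ¬ φ.Sat s
  | .and φ ψ, s => φ.Sat s ∧ ψ.Sat s
  | .or φ ψ, s => φ.Sat s ∨ ψ.Sat s
  | .imp φ ψ, s => φ.Sat s → ψ.Sat s
  | .iff φ ψ, s => φ.Sat s ↔ ψ.Sat s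
  | .all i φ, s => ∀ a : ℕ, φ.Sat (Function.update s i a)
  | .ex i φ, s => ∃ a : ℕ, φ.Sat (Function.update s i a)

/-- `X ⊆ ω^k` is first-order definable in `M` (without parameters) by a formula in the variables
`x_0, …, x_{k-1}`. -/
def DefinableIn (M : Set Symb) (k : ℕ) (X : Set (Fin k → ℕ)) : Prop :=
  ∃ φ : Fml, φ.In M ∧ φ.free ⊆ {i | i < k} ∧
    ∀ s : ℕ → ℕ, φ.Sat s ↔ (fun i : Fin k => s i) ∈ X

/-- A set of natural numbers is definable in `M`. -/
def Definable₁ (M : Set Symb) (X : Set ℕ) : Prop := DefinableIn M 1 {v | v 0 ∈ X}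

/-- A binary relation on the natural numbers is definable in `M`. -/
def Definable₂ (M : Set Symb) (P : ℕ → ℕ → Prop) : Prop := DefinableIn M 2 {v | P (v 0) (v 1)}

/-- `M ∼ N`: the same sets of natural numbers are definable in `M` and in `N`. -/
def DefEquiv (M N : Set Symb) : Prop := ∀ X : Set ℕ, Definable₁ M X ↔ Definable₁ N X

/-! ### Universal predicates -/

/-- `G` is a universal predicate for `M`. -/
def IsUniversal (M : Set Symb) (G : ℕ → ℕ → Prop) : Prop :=
  ∀ X : Set ℕ, Definable₁ M X → ∃ n, X = {x | G n x}

/-- `P` is a proper universal predicate for `M`. -/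
def IsProperUniversal (M : Set Symb) (P : ℕ → ℕ → Prop) : Prop :=
  IsUniversal M P ∧ ∀ n, Definable₁ M {x | P n x}

/-- `P₀` is a canonic universal predicate (`univ := IsUniversal`), respectively a canonic proper
universal predicate (`univ := IsProperUniversal`), for `M`. -/
def IsCanonic (univ : Set Symb → (ℕ → ℕ → Prop) → Prop) (M : Set Symb) (P₀ : ℕ → ℕ → Prop) : Prop :=
  univ M P₀ ∧ ∀ P, univ M P → Definable₂ (M ∪ {pred₂ P}) P₀

/-! ### The Tarski hierarchies -/

/-- The sequence `(M α)_{α ≤ ξ}` is obtained from `N` by adding a canonic (proper) universal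
predicate at every step `α < ξ` and by taking unions at limits. The values of `M` above `ξ` are
irrelevant. -/
def IsTarskiSeq (univ : Set Symb → (ℕ → ℕ → Prop) → Prop) (N : Set Symb) (ξ : Ordinal.{0})
    (M : Ordinal.{0} → Set Symb) : Prop :=
  M 0 = N ∧
  (∀ α, α < ξ → ∃ P, IsCanonic univ (M α) P ∧ M (Order.succ α) = M α ∪ {pred₂ P}) ∧
  ∀ β, Order.IsSuccLimit β → β ≤ ξ → M β = ⋃ α ∈ Set.Iio β, M α

/-- The length of the (proper) Tarski hierarchy over `N`: the largest ordinal `ξ` for which there is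
a sequence as in `IsTarskiSeq`. A (proper) Tarski hierarchy over `N` is such a sequence of this
length. -/
noncomputable def tarskiLength (univ : Set Symb → (ℕ → ℕ → Prop) → Prop) (N : Set Symb) :
    Ordinal.{0} :=
  sSup {ξ | ∃ M, IsTarskiSeq univ N ξ M}

/-! ### Gödel numbers and truth predicates -/

/-- The code of a finite sequence of natural numbers, given by
`[ ] = 0` and `[a₀, a₁, …] = ⟨a₀, [a₁, …]⟩ + 1` with a pairing function `⟨·,·⟩`. -/
def seqCode (l : List ℕ) : ℕ := Encodable.encode l

/-- The letters of which the strings of the language consist. -/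
inductive Letter : Type
  | symb (s : Symb) : Letter
  | var (i : ℕ) : Letter
  | and | or | not | imp | iff | all | ex | lpar | rpar

/-- `c` is a coding for `M`. Only the values of `c` on `M` matter. -/
def IsCoding (M : Set Symb) (c : Symb → ℕ) : Prop := Set.InjOn c M

/-- The code of a letter under the coding `c`. -/
def Letter.code (c : Symb → ℕ) : Letter → ℕ
  | .symb (.pred n hn A) => 2 * seqCode [c (.pred n hn A), n, 0]
  | .symb (.func n f) => 2 * seqCode [c (.func n f), n, 1]
  | .and => 1
  | .or => 3
  | .not => 5
  | .imp => 7
  | .iff => 9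
  | .all => 11
  | .ex => 13
  | .lpar => 15
  | .rpar => 17
  | .var i => 2 * i + 19

/-- A term as a string: `x_i`, or `F ( t₁ … tₙ )`. -/
def Tm.str : Tm → List Letter
  | .var i => [.var i]
  | .app n f ts =>
    [.symb (.func n f), .lpar] ++ (List.ofFn fun k => (ts k).str).flatten ++ [.rpar]

/-- A formula as a string: `P ( t₁ … tₙ )`, `¬ ( φ )`, `( φ ) ∧ ( ψ )`, …, `∀ x_i ( φ )`,
`∃ x_i ( φ )`. -/
def Fml.str : Fml → List Letter
  | .atom n hn A ts =>
    [.symb (.pred n hn A), .lpar] ++ (List.ofFn fun k => (ts k).str).flatten ++ [.rpar]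
  | .neg φ => [.not, .lpar] ++ φ.str ++ [.rpar]
  | .and φ ψ => [.lpar] ++ φ.str ++ [.rpar, .and, .lpar] ++ ψ.str ++ [.rpar]
  | .or φ ψ => [.lpar] ++ φ.str ++ [.rpar, .or, .lpar] ++ ψ.str ++ [.rpar]
  | .imp φ ψ => [.lpar] ++ φ.str ++ [.rpar, .imp, .lpar] ++ ψ.str ++ [.rpar]
  | .iff φ ψ => [.lpar] ++ φ.str ++ [.rpar, .iff, .lpar] ++ ψ.str ++ [.rpar]
  | .all i φ => [.all, .var i, .lpar] ++ φ.str ++ [.rpar]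
  | .ex i φ => [.ex, .var i, .lpar] ++ φ.str ++ [.rpar]

/-- The `c`-Gödel number of a formula. -/
def Fml.godel (c : Symb → ℕ) (φ : Fml) : ℕ := seqCode (φ.str.map (Letter.code c))

/-- The truth predicate for `M` under `c`: the Gödel numbers of the true sentences of `M`. -/
def truthSet (M : Set Symb) (c : Symb → ℕ) : Set ℕ :=
  {a | ∃ φ : Fml, φ.In M ∧ φ.free = ∅ ∧ (∀ s, φ.Sat s) ∧ a = φ.godel c}

/-! ### Linear orderings on sets of natural numbers, representations of ordinals -/

def rng (R : ℕ → ℕ → Prop) : Set ℕ := {y | ∃ x, R x y}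

/-- `x ≺_R y`. -/
def Below (R : ℕ → ℕ → Prop) (x y : ℕ) : Prop := R x y ∧ x ≠ y

/-- `R` is a (non-strict) linear ordering on `rng R`. -/
structure IsLinearOrdering (R : ℕ → ℕ → Prop) : Prop where
  dom : ∀ x y, R x y → x ∈ rng R
  refl : ∀ x ∈ rng R, R x x
  trans : ∀ x y z, R x y → R y z → R x z
  antisymm : ∀ x y, R x y → R y x → x = y
  total : ∀ x ∈ rng R, ∀ y ∈ rng R, R x y ∨ R y x

/-- `R` is a representation of the ordinal `α`: a linear ordering whose strict part is a
well-ordering of order type `α`. -/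
def IsRepresentation (R : ℕ → ℕ → Prop) (α : Ordinal.{0}) : Prop :=
  IsLinearOrdering R ∧
  ∃ _ : IsWellOrder (rng R) (fun x y => Below R x y),
    Ordinal.type (fun x y : rng R => Below R x y) = α

/-- The ordinal `α` is definable in `M`. -/
def OrdinalDefinable (M : Set Symb) (α : Ordinal.{0}) : Prop :=
  ∃ R, IsRepresentation R α ∧ Definable₂ M R

/-- The `R`-smallest member of `X` (for a linear ordering `R`, if there is one). -/
noncomputable def smallest (R : ℕ → ℕ → Prop) (X : Set ℕ) : ℕ :=
  sInf {a | a ∈ X ∧ ∀ b ∈ X, R a b}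

/-- `R_β`, the `R`-smallest member of `rng R` that is different from all `R_γ` with `γ < β`. -/
noncomputable def ordElem (R : ℕ → ℕ → Prop) (β : Ordinal.{0}) : ℕ :=
  smallest R (rng R \ {x | ∃ γ, ∃ _ : γ < β, ordElem R γ = x})
termination_by β

/-! ### The iterated truth predicate -/

/-- `R` and the coding `c` for `M` are compatible. -/
def Compatible (M : Set Symb) (c : Symb → ℕ) (R : ℕ → ℕ → Prop) : Prop :=
  Disjoint (c '' M) (rng R)

/-- The structure `M + {U(m,·) ; m ≺_R n}`. -/
def stage (M : Set Symb) (R U : ℕ → ℕ → Prop) (n : ℕ) : Set Symb :=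
  M ∪ {s | ∃ m, Below R m n ∧ s = pred₁ {x | U m x}}

open Classical in
/-- The coding induced on `stage M R U n` by `c` and `U`: a symbol of `M` keeps its code, and the
predicate `U(m,·)` gets the code `m`. -/
noncomputable def inducedCoding (M : Set Symb) (c : Symb → ℕ) (R U : ℕ → ℕ → Prop) (n : ℕ)
    (s : Symb) : ℕ :=
  if s ∈ M then c s else sInf {m | Below R m n ∧ s = pred₁ {x | U m x}}

/-- The set of all `U` that iterate the truth predicate along the well-ordering `R`, starting from
`M` and `c`. If `n` is the `R`-first element then the stage at `n` is `M`, with the coding `c`, so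
that `U(n,·)` is the truth predicate for `M` under `c`. -/
def iteratedTruth (M : Set Symb) (c : Symb → ℕ) (R : ℕ → ℕ → Prop) : Set (ℕ → ℕ → Prop) :=
  {U | (∀ n, n ∉ rng R → {x | U n x} = ∅) ∧
    ∀ n ∈ rng R, {x | U n x} = truthSet (stage M R U n) (inducedCoding M c R U n)}

end UniversalPredicates

open UniversalPredicates

namespace UniversalPredicates

open Encodable

/-! ### Definable conditions on assignments -/

/-! The truth set of a structure and a universal predicate for it compute one another. In one
direction, substitution of numerals turns the truth set into a proper universal predicate
(`isProperUniversal_truthEnum`). In the other, let `G` be universal and `φ` a sentence. Satisfaction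
restricted to the finitely many subformulas of `φ` is definable, hence is some `G(e,·)`; and any set
that obeys the Tarski clauses on these subformulas assigns `φ` its correct truth value, definable or
not. So `φ` is true iff some `G(e,·)` obeys the clauses and accepts `φ` (`truthFrom_iff`). This is a
first-order condition on `G` once the letters and meanings of the symbols are uniformly definable,
as they are for a finite structure.

The stages of the iterated truth predicate `U` may have infinitely many symbols, so the part of `U`
below `n` must itself be recovered uniformly from `G`. This is `Iteration.main`, proved by induction
along `R`. For `m ≺ n`, the part of `U` up to `m` is definable in the stage at `n`: apply the
induction hypothesis at `m` to the universal predicate enumerated from `U(m,·)`, which is a symbol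
of that stage. Hence this part is some `G(e,·)`, and the correct `e` are recognised by the recursion
equations of `U`. Diagonalisation shows that `U(n,·)` is not definable in its own stage, so that the
added symbols are new and distinct and the induced codings are injective.

A transfinite induction shows that `M_α` and the stage at `R_α` define the same sets
(`IsTarskiSeq.interp_stage`): at a successor, canonicity defines `P_α` from truth, and
`Iteration.main` defines truth from `P_α`. Over bare arithmetic each of `P_β` and `U(R_β,·)` already
recovers all sets definable in the stage, which gives the equivalence (`defEquiv_of_isCanonic`).
Adding the enumerations of the `U(R_α,·)` one by one gives a sequence of length `β+1`
(`exists_isTarskiSeq`). Every step makes a new set of numbers definable, so the lengths are bounded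
and `β` is below their supremum. Both notions of universality enter only through the properties
collected in `Admissible`. -/

theorem Tm.val_congr {t : Tm} {s s' : ℕ → ℕ} (h : ∀ i ∈ t.vars, s i = s' i) :
    t.val s = t.val s' := by
  induction t with
  | var i => exact h i rfl
  | app n f ts ih =>
    simp only [Tm.val]
    congr 1
    ext k
    exact ih k fun i hi => h i (Set.mem_iUnion.2 ⟨k, hi⟩)

theorem Fml.sat_congr {φ : Fml} : ∀ {s s' : ℕ → ℕ}, (∀ i ∈ φ.free, s i = s' i) →
    (φ.Sat s ↔ φ.Sat s') := by
  induction φ with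
  | atom n hn A ts =>
    intro s s' h
    simp only [Fml.Sat]
    have : (fun k => (ts k).val s) = fun k => (ts k).val s' := by
      ext k
      exact Tm.val_congr fun i hi => h i (Set.mem_iUnion.2 ⟨k, hi⟩)
    rw [this]
  | neg φ ih => intro s s' h; exact not_congr (ih h)
  | and φ ψ ih ih' =>
    intro s s' h
    exact and_congr (ih fun i hi => h i (Or.inl hi)) (ih' fun i hi => h i (Or.inr hi))
  | or φ ψ ih ih' =>
    intro s s' h
    exact or_congr (ih fun i hi => h i (Or.inl hi)) (ih' fun i hi => h i (Or.inr hi))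
  | imp φ ψ ih ih' =>
    intro s s' h
    exact imp_congr (ih fun i hi => h i (Or.inl hi)) (ih' fun i hi => h i (Or.inr hi))
  | iff φ ψ ih ih' =>
    intro s s' h
    exact iff_congr (ih fun i hi => h i (Or.inl hi)) (ih' fun i hi => h i (Or.inr hi))
  | all i φ ih =>
    intro s s' h
    refine forall_congr' fun a => ih fun j hj => ?_
    by_cases hji : j = i
    · subst hji; simp
    · simpa [hji] using h j ⟨hj, hji⟩
  | ex i φ ih =>
    intro s s' h
    refine exists_congr fun a => ih fun j hj => ?_
    by_cases hji : j = i
    · subst hji; simp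
    · simpa [hji] using h j ⟨hj, hji⟩

theorem Tm.finite_vars (t : Tm) : t.vars.Finite := by
  induction t with
  | var i => exact Set.finite_singleton i
  | app n f ts ih => exact Set.finite_iUnion ih

theorem Fml.finite_free (φ : Fml) : φ.free.Finite := by
  induction φ with
  | atom n hn A ts => exact Set.finite_iUnion fun k => (ts k).finite_vars
  | neg φ ih => exact ih
  | and φ ψ ih ih' | or φ ψ ih ih' | imp φ ψ ih ih' | iff φ ψ ih ih' => exact ih.union ih'
  | all i φ ih | ex i φ ih => exact ih.subset Set.sdiff_subset

/-- The condition `P` on assignments is expressed by a formula of `M`. -/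
def DefS (M : Set Symb) (P : (ℕ → ℕ) → Prop) : Prop :=
  ∃ φ : Fml, φ.In M ∧ ∀ s, φ.Sat s ↔ P s

/-- The function `f` of assignments is expressed by a term of `M`. -/
def TermS (M : Set Symb) (f : (ℕ → ℕ) → ℕ) : Prop :=
  ∃ t : Tm, t.In M ∧ ∀ s, t.val s = f s

section
variable {M : Set Symb} {P Q : (ℕ → ℕ) → Prop} {f g : (ℕ → ℕ) → ℕ}

theorem TermS.var (i : ℕ) : TermS M (fun s => s i) := ⟨.var i, trivial, fun _ => rfl⟩

theorem TermS.succ (hM : arith ⊆ M) (hf : TermS M f) : TermS M (fun s => f s + 1) := by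
  obtain ⟨t, ht, hf⟩ := hf
  exact ⟨.app 1 (fun v => v 0 + 1) fun _ => t, ⟨hM (by simp [arith]), fun _ => ht⟩,
    fun s => by simp [Tm.val, hf]⟩

theorem TermS.add (hM : arith ⊆ M) (hf : TermS M f) (hg : TermS M g) :
    TermS M (fun s => f s + g s) := by
  obtain ⟨t, ht, hf⟩ := hf
  obtain ⟨u, hu, hg⟩ := hg
  exact ⟨.app 2 (fun v => v 0 + v 1) ![t, u],
    ⟨hM (by simp [arith]), fun k => by fin_cases k <;> assumption⟩,
    fun s => by simp [Tm.val, hf, hg]⟩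

theorem TermS.mul (hM : arith ⊆ M) (hf : TermS M f) (hg : TermS M g) :
    TermS M (fun s => f s * g s) := by
  obtain ⟨t, ht, hf⟩ := hf
  obtain ⟨u, hu, hg⟩ := hg
  exact ⟨.app 2 (fun v => v 0 * v 1) ![t, u],
    ⟨hM (by simp [arith]), fun k => by fin_cases k <;> assumption⟩,
    fun s => by simp [Tm.val, hf, hg]⟩

theorem DefS.congr (h : DefS M P) (hPQ : ∀ s, P s ↔ Q s) : DefS M Q := by
  obtain ⟨φ, hφ, h⟩ := h
  exact ⟨φ, hφ, fun s => (h s).trans (hPQ s)⟩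

theorem DefS.eq (hM : arith ⊆ M) (hf : TermS M f) (hg : TermS M g) :
    DefS M (fun s => f s = g s) := by
  obtain ⟨t, ht, hf⟩ := hf
  obtain ⟨u, hu, hg⟩ := hg
  exact ⟨.atom 2 Nat.two_pos {v | v 0 = v 1} ![t, u],
    ⟨hM (by simp [arith, pred₂]), fun k => by fin_cases k <;> assumption⟩,
    fun s => by simp [Fml.Sat, hf, hg]⟩

theorem DefS.lt (hM : arith ⊆ M) (hf : TermS M f) (hg : TermS M g) :
    DefS M (fun s => f s < g s) := by
  obtain ⟨t, ht, hf⟩ := hf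
  obtain ⟨u, hu, hg⟩ := hg
  exact ⟨.atom 2 Nat.two_pos {v | v 0 < v 1} ![t, u],
    ⟨hM (by simp [arith, pred₂]), fun k => by fin_cases k <;> assumption⟩,
    fun s => by simp [Fml.Sat, hf, hg]⟩

theorem DefS.not (h : DefS M P) : DefS M (fun s => ¬ P s) := by
  obtain ⟨φ, hφ, h⟩ := h
  exact ⟨.neg φ, hφ, fun s => not_congr (h s)⟩

theorem DefS.and (h : DefS M P) (h' : DefS M Q) : DefS M (fun s => P s ∧ Q s) := by
  obtain ⟨φ, hφ, h⟩ := h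
  obtain ⟨ψ, hψ, h'⟩ := h'
  exact ⟨.and φ ψ, ⟨hφ, hψ⟩, fun s => and_congr (h s) (h' s)⟩

theorem DefS.or (h : DefS M P) (h' : DefS M Q) : DefS M (fun s => P s ∨ Q s) := by
  obtain ⟨φ, hφ, h⟩ := h
  obtain ⟨ψ, hψ, h'⟩ := h'
  exact ⟨.or φ ψ, ⟨hφ, hψ⟩, fun s => or_congr (h s) (h' s)⟩

theorem DefS.imp (h : DefS M P) (h' : DefS M Q) : DefS M (fun s => P s → Q s) := by
  obtain ⟨φ, hφ, h⟩ := h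
  obtain ⟨ψ, hψ, h'⟩ := h'
  exact ⟨.imp φ ψ, ⟨hφ, hψ⟩, fun s => imp_congr (h s) (h' s)⟩

/-- The variable `i` is reserved for the quantified value; `hi` says that `P` does not otherwise
depend on it, so overwriting it is harmless. -/
theorem DefS.ex {P : (ℕ → ℕ) → ℕ → Prop} (i : ℕ) (h : DefS M (fun s => P s (s i)))
    (hi : ∀ s a b, P (Function.update s i a) b ↔ P s b) : DefS M (fun s => ∃ a, P s a) := by
  obtain ⟨φ, hφ, h⟩ := h
  refine ⟨.ex i φ, hφ, fun s => exists_congr fun a => ?_⟩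
  rw [h]
  simp only [Function.update_self, hi]

theorem DefS.all {P : (ℕ → ℕ) → ℕ → Prop} (i : ℕ) (h : DefS M (fun s => P s (s i)))
    (hi : ∀ s a b, P (Function.update s i a) b ↔ P s b) : DefS M (fun s => ∀ a, P s a) := by
  obtain ⟨φ, hφ, h⟩ := h
  refine ⟨.all i φ, hφ, fun s => forall_congr' fun a => ?_⟩
  rw [h]
  simp only [Function.update_self, hi]

theorem Tm.exists_rename (ρ : ℕ → ℕ) (t : Tm) (ht : t.In M) :
    ∃ t' : Tm, t'.In M ∧ ∀ s, t'.val s = t.val fun i => s (ρ i) := by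
  induction t with
  | var i => exact ⟨.var (ρ i), trivial, fun _ => rfl⟩
  | app n f ts ih =>
    choose ts' h h' using fun k => ih k (ht.2 k)
    exact ⟨.app n f ts', ⟨ht.1, h⟩, fun s => by simp [Tm.val, h']⟩

/-- Capture is the only obstacle: under a quantifier the bound variable is sent to a variable
outside the image of the finitely many free ones. -/
theorem Fml.exists_rename (φ : Fml) (hφ : φ.In M) :
    ∀ ρ : ℕ → ℕ, DefS M fun s => φ.Sat fun i => s (ρ i) := by
  have fresh : ∀ (φ : Fml) (ρ : ℕ → ℕ), ∃ j, ∀ k ∈ φ.free, ρ k ≠ j := fun φ ρ => by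
    obtain ⟨j, hj⟩ := (φ.finite_free.image ρ).exists_notMem
    exact ⟨j, fun k hk h => hj ⟨k, hk, h⟩⟩
  have key : ∀ (φ : Fml) (ρ : ℕ → ℕ) (i j : ℕ), (∀ k ∈ φ.free, ρ k ≠ j) →
      ∀ (s : ℕ → ℕ) (a : ℕ),
      φ.Sat (Function.update (fun k => s (ρ k)) i a) ↔
      φ.Sat (fun k => Function.update s j a (Function.update ρ i j k)) := by
    intro φ ρ i j hj s a
    refine Fml.sat_congr fun k hk => ?_
    by_cases hki : k = i
    · subst hki; simp
    · simp [hki, hj k hk]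
  induction φ with
  | atom n hn A ts =>
    intro ρ
    choose ts' h h' using fun k => Tm.exists_rename ρ (ts k) (hφ.2 k)
    exact ⟨.atom n hn A ts', ⟨hφ.1, h⟩, fun s => by simp [Fml.Sat, h']⟩
  | neg φ ih => exact fun ρ => (ih hφ ρ).not
  | and φ ψ ih ih' => exact fun ρ => (ih hφ.1 ρ).and (ih' hφ.2 ρ)
  | or φ ψ ih ih' => exact fun ρ => (ih hφ.1 ρ).or (ih' hφ.2 ρ)
  | imp φ ψ ih ih' => exact fun ρ => (ih hφ.1 ρ).imp (ih' hφ.2 ρ)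
  | iff φ ψ ih ih' =>
    exact fun ρ => (((ih hφ.1 ρ).imp (ih' hφ.2 ρ)).and ((ih' hφ.2 ρ).imp (ih hφ.1 ρ))).congr
      fun s => iff_iff_implies_and_implies.symm
  | all i φ ih =>
    intro ρ
    obtain ⟨j, hj⟩ := fresh φ ρ
    obtain ⟨φ', h, h'⟩ := ih hφ (Function.update ρ i j)
    refine ⟨.all j φ', h, fun s => forall_congr' fun a => ?_⟩
    rw [h', key φ ρ i j hj]
  | ex i φ ih =>
    intro ρ
    obtain ⟨j, hj⟩ := fresh φ ρ
    obtain ⟨φ', h, h'⟩ := ih hφ (Function.update ρ i j)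
    refine ⟨.ex j φ', h, fun s => exists_congr fun a => ?_⟩
    rw [h', key φ ρ i j hj]

theorem DefS.rename (ρ : ℕ → ℕ) (h : DefS M P) : DefS M (fun s => P fun i => s (ρ i)) := by
  obtain ⟨φ, hφ, h⟩ := h
  exact (φ.exists_rename hφ ρ).congr fun s => h _

theorem DefS.rename₂ {P : ℕ → ℕ → Prop} (h : DefS M fun s => P (s 0) (s 1)) (i j : ℕ) :
    DefS M fun s => P (s i) (s j) :=
  h.rename fun k => if k = 0 then i else j

theorem DefS.rename₁ {P : ℕ → Prop} (h : DefS M fun s => P (s 0)) (i : ℕ) :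
    DefS M fun s => P (s i) :=
  h.rename fun _ => i

/-- The truth of the formula does not depend on the variables from `k` on; the finitely many of
these that occur free are removed by vacuous universal quantifiers, one at a time. -/
theorem DefinableIn.iff_defS {k : ℕ} {X : Set (Fin k → ℕ)} :
    DefinableIn M k X ↔ DefS M fun s => (fun i : Fin k => s i) ∈ X := by
  constructor
  · rintro ⟨φ, hφ, -, h⟩
    exact ⟨φ, hφ, h⟩
  · rintro ⟨φ, hφ, h⟩
    suffices H : ∀ S : Finset ℕ, ∃ ψ : Fml, ψ.In M ∧ ψ.free ⊆ φ.free \ {i | i ∈ S ∧ k ≤ i} ∧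
        ∀ s, ψ.Sat s ↔ (fun i : Fin k => s i) ∈ X by
      obtain ⟨ψ, h1, h2, h3⟩ := H φ.finite_free.toFinset
      refine ⟨ψ, h1, fun i hi => ?_, h3⟩
      have := h2 hi
      simp only [Set.Finite.mem_toFinset, Set.mem_sdiff, Set.mem_ofPred_eq, not_and, not_le] at this
      exact this.2 this.1
    intro S
    induction S using Finset.induction_on with
    | empty => exact ⟨φ, hφ, by simp, h⟩
    | insert j S hj ih =>
      obtain ⟨ψ, h1, h2, h3⟩ := ih
      by_cases hjk : k ≤ j
      · refine ⟨.all j ψ, h1, fun i hi => ?_, fun s => ?_⟩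
        · have h4 := h2 hi.1
          refine ⟨h4.1, fun h5 => ?_⟩
          rcases Finset.mem_insert.1 h5.1 with h6 | h6
          · exact hi.2 h6
          · exact h4.2 ⟨h6, h5.2⟩
        · simp only [Fml.Sat, h3]
          have : ∀ a, (fun i : Fin k => Function.update s j a i) = fun i : Fin k => s i := by
            intro a
            ext i
            rw [Function.update_of_ne]
            have := i.2
            omega
          simp [this]
      · refine ⟨ψ, h1, fun i hi => ?_, h3⟩
        have h4 := h2 hi
        refine ⟨h4.1, fun h5 => ?_⟩
        rcases Finset.mem_insert.1 h5.1 with h6 | h6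
        · exact hjk (h6 ▸ h5.2)
        · exact h4.2 ⟨h6, h5.2⟩

theorem definable₁_iff_defS {X : Set ℕ} : Definable₁ M X ↔ DefS M fun s => s 0 ∈ X :=
  DefinableIn.iff_defS

theorem definable₂_iff_defS {P : ℕ → ℕ → Prop} : Definable₂ M P ↔ DefS M fun s => P (s 0) (s 1) :=
  DefinableIn.iff_defS

/-! ### Primitive recursive functions are arithmetically definable -/

theorem DefS.pair (hM : arith ⊆ M) (i j k : ℕ) : DefS M fun s => s k = Nat.pair (s i) (s j) := by
  refine DefS.congr (((DefS.lt hM (.var i) (.var j)).and (DefS.eq hM (.var k)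
    (((TermS.var j).mul hM (.var j)).add hM (.var i)))).or
    ((DefS.lt hM (.var i) (.var j)).not.and (DefS.eq hM (.var k)
    ((((TermS.var i).mul hM (.var i)).add hM (.var i)).add hM (.var j))))) fun s => ?_
  unfold Nat.pair
  split_ifs with h <;> simp [h]

/-- Division with remainder unfolds Gödel's β function into polynomial arithmetic. -/
theorem Nat.eq_beta_iff (w c i : ℕ) : w = c.beta i ↔ ∃ a b q, c = Nat.pair a b ∧
    w < (i + 1) * b + 1 ∧ a = q * ((i + 1) * b + 1) + w := by
  constructor
  · rintro rfl
    refine ⟨c.unpair.1, c.unpair.2, c.unpair.1 / ((i + 1) * c.unpair.2 + 1), by simp,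
      Nat.mod_lt _ (Nat.succ_pos _), ?_⟩
    rw [Nat.beta, mul_comm, Nat.div_add_mod]
  · rintro ⟨a, b, q, rfl, h, rfl⟩
    rw [Nat.beta, Nat.unpair_pair]
    simp only
    rw [mul_comm q, Nat.mul_add_mod, Nat.mod_eq_of_lt h]

theorem DefS.beta (hM : arith ⊆ M) : DefS M fun s => s 2 = (s 0).beta (s 1) := by
  have one : DefS M fun s => ∃ a b q, s 0 = Nat.pair a b ∧
      s 2 < (s 1 + 1) * b + 1 ∧ a = q * ((s 1 + 1) * b + 1) + s 2 := by
    refine DefS.ex 3 (DefS.ex 4 (DefS.ex 5 ?_ ?_) ?_) ?_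
    · have hm : TermS M fun s => (s 1 + 1) * s 4 + 1 :=
        (((TermS.var 1).succ hM).mul hM (.var 4)).succ hM
      exact (DefS.pair hM 3 4 0).and ((DefS.lt hM (.var 2) hm).and
        (DefS.eq hM (.var 3) (((TermS.var 5).mul hM hm).add hM (.var 2))))
    all_goals simp [Function.update]
  exact one.congr fun s => (Nat.eq_beta_iff _ _ _).symm

/-- The course of values of a recursion is a finite sequence, so the β function codes it by one
number and recursion becomes an existential quantifier. -/
theorem Nat.rec_eq_iff {α : Type*} (f : α → ℕ) (g : α → ℕ → ℕ → ℕ) (z : α) (n y : ℕ) :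
    y = Nat.rec (f z) (fun y IH => g z y IH) n ↔ ∃ c : ℕ, c.beta 0 = f z ∧
      (∀ i, i < n → c.beta (i + 1) = g z i (c.beta i)) ∧ y = c.beta n := by
  constructor
  · intro hy
    let F : ℕ → ℕ := fun n => Nat.rec (f z) (fun y IH => g z y IH) n
    have hF : ∀ i ≤ n, (Nat.unbeta ((List.range (n + 1)).map F)).beta i = F i := by
      intro i hi
      have hl : i < ((List.range (n + 1)).map F).length := by simp; omega
      have := Nat.beta_unbeta_coe ((List.range (n + 1)).map F) ⟨i, hl⟩
      simpa using this
    refine ⟨Nat.unbeta ((List.range (n + 1)).map F), hF 0 (Nat.zero_le n), ?_, ?_⟩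
    · intro i hi
      rw [hF _ hi, hF _ hi.le]
    · rw [hF _ le_rfl]; exact hy
  · rintro ⟨c, h0, hs, rfl⟩
    have : ∀ i, i ≤ n → c.beta i = Nat.rec (f z) (fun y IH => g z y IH) i := by
      intro i
      induction i with
      | zero => intro _; exact h0
      | succ i ih => intro hi; rw [hs i hi, ih (by omega)]
    exact this n le_rfl

theorem DefS.natPrimrec (hM : arith ⊆ M) {f : ℕ → ℕ} (hf : Nat.Primrec f) :
    DefS M fun s => s 1 = f (s 0) := by
  induction hf with
  | zero =>
    refine (DefS.all (P := fun s a => ¬ a < s 1) 2 (DefS.lt hM (.var 2) (.var 1)).not ?_).congr ?_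
    · simp [Function.update]
    · intro s
      constructor
      · intro h; simpa using h 0
      · intro h; simp [h]
  | succ => exact DefS.eq hM (.var 1) ((TermS.var 0).succ hM)
  | left =>
    refine (DefS.ex (P := fun s a => s 0 = Nat.pair (s 1) a) 2 (DefS.pair hM 1 2 0) ?_).congr ?_
    · simp [Function.update]
    · intro s
      constructor
      · rintro ⟨a, h⟩; simp [h]
      · intro h; exact ⟨(s 0).unpair.2, by simp [h]⟩
  | right =>
    refine (DefS.ex (P := fun s a => s 0 = Nat.pair a (s 1)) 2 (DefS.pair hM 2 1 0) ?_).congr ?_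
    · simp [Function.update]
    · intro s
      constructor
      · rintro ⟨a, h⟩; simp [h]
      · intro h; exact ⟨(s 0).unpair.1, by simp [h]⟩
  | @pair f g _ _ hf hg =>
    have : DefS M fun s => ∃ a b, a = f (s 0) ∧ b = g (s 0) ∧ s 1 = Nat.pair a b := by
      refine DefS.ex 2 (DefS.ex 3 ((hf.rename₂ (P := fun x y => y = f x) 0 2).and
        ((hg.rename₂ (P := fun x y => y = g x) 0 3).and (DefS.pair hM 2 3 1))) ?_) ?_
      all_goals simp [Function.update]
    exact this.congr fun s => by simp
  | @comp f g _ _ hf hg =>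
    have : DefS M fun s => ∃ a, a = g (s 0) ∧ s 1 = f a := by
      refine DefS.ex 2 ((hg.rename₂ (P := fun x y => y = g x) 0 2).and
        (hf.rename₂ (P := fun x y => y = f x) 2 1)) ?_
      simp [Function.update]
    exact this.congr fun s => by simp
  | @prec f g _ _ hf hg =>
    have hb : ∀ i j k, DefS M fun s => s k = (s i).beta (s j) := fun i j k =>
      (DefS.beta hM).rename fun m => if m = 0 then i else if m = 1 then j else k
    have hz : DefS M fun s => s 0 = 0 := by
      refine (DefS.all (P := fun s a => ¬ a < s 0) 1 (DefS.lt hM (.var 1) (.var 0)).not ?_).congr ?_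
      · simp [Function.update]
      · intro s
        constructor
        · intro h; simpa using h 0
        · intro h; simp [h]
    -- Variables `2`, `3` and `4` hold the parameter, the number of recursion steps and the code of
    -- the course of values; those from `5` on are auxiliary.
    have hz' : DefS M fun s => ∃ o w, o = 0 ∧ w = (s 4).beta o ∧ w = f (s 2) := by
      refine DefS.ex 5 (DefS.ex 6 ((hz.rename₁ (P := fun x => x = 0) 5).and ((hb 4 5 6).and
        (hf.rename₂ (P := fun x y => y = f x) 2 6))) ?_) ?_
      all_goals simp [Function.update]
    have hs : DefS M fun s => ∃ j v w p q, j = s 5 + 1 ∧ v = (s 4).beta (s 5) ∧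
        w = (s 4).beta j ∧ p = Nat.pair (s 5) v ∧ q = Nat.pair (s 2) p ∧ w = g q := by
      refine DefS.ex 6 (DefS.ex 7 (DefS.ex 8 (DefS.ex 9 (DefS.ex 10
        ((DefS.eq hM (.var 6) ((TermS.var 5).succ hM)).and ((hb 4 5 7).and ((hb 4 6 8).and
        ((DefS.pair hM 5 7 9).and ((DefS.pair hM 2 9 10).and
        (hg.rename₂ (P := fun x y => y = g x) 10 8)))))) ?_) ?_) ?_) ?_) ?_
      all_goals simp [Function.update]
    have hs' : DefS M fun s => ∀ i, i < s 3 →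
        (s 4).beta (i + 1) = g (Nat.pair (s 2) (Nat.pair i ((s 4).beta i))) := by
      refine DefS.all 5 ((DefS.lt hM (.var 5) (.var 3)).imp (hs.congr fun s => ?_)) ?_
      · simp
      · simp [Function.update]
    have : DefS M fun s => ∃ z n c : ℕ, s 0 = Nat.pair z n ∧ (c.beta 0 = f z) ∧
        (∀ i, i < n → c.beta (i + 1) = g (Nat.pair z (Nat.pair i (c.beta i)))) ∧
        s 1 = c.beta n := by
      refine DefS.ex 2 (DefS.ex 3 (DefS.ex 4 ((DefS.pair hM 2 3 0).and
        ((hz'.congr fun s => ?_).and (hs'.and (hb 4 3 1)))) ?_) ?_) ?_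
      · simp
      all_goals simp [Function.update]
    refine this.congr fun s => ?_
    have h := fun z n y => Nat.rec_eq_iff f (fun z y IH => g (Nat.pair z (Nat.pair y IH))) z n y
    constructor
    · rintro ⟨z, n, c, h1, h2⟩
      rw [h1, Nat.unpaired, Nat.unpair_pair]
      exact (h z n _).2 ⟨c, h2⟩
    · intro h1
      obtain ⟨c, hc⟩ := (h (s 0).unpair.1 (s 0).unpair.2 _).1 h1
      exact ⟨_, _, c, (Nat.pair_unpair _).symm, hc⟩

end

/-! ### Definable predicates on `Primcodable` types -/

/-- The predicate `P` is definable in `M` when its argument is represented by its code. -/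
def Dfn (M : Set Symb) {α : Type*} [Primcodable α] (P : α → Prop) : Prop :=
  DefS M fun s => ∃ a ∈ (decode (s 0) : Option α), P a

section
variable {M : Set Symb} {α β γ : Type*} [Primcodable α] [Primcodable β] [Primcodable γ]

theorem Dfn.nat_iff {P : ℕ → Prop} : Dfn M P ↔ DefS M fun s => P (s 0) := by
  simp [Dfn]

theorem definable₁_iff_dfn {X : Set ℕ} : Definable₁ M X ↔ Dfn M fun x => x ∈ X := by
  rw [definable₁_iff_defS, Dfn.nat_iff]

theorem Dfn.congr {P Q : α → Prop} (h : Dfn M P) (hPQ : ∀ a, P a ↔ Q a) : Dfn M Q :=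
  DefS.congr h fun s => by simp [hPQ]

theorem Dfn.and {P Q : α → Prop} (hP : Dfn M P) (hQ : Dfn M Q) : Dfn M fun a => P a ∧ Q a :=
  DefS.congr (DefS.and hP hQ) fun s => by
    rcases (decode (s 0) : Option α) with _ | a <;> simp

theorem Dfn.or {P Q : α → Prop} (hP : Dfn M P) (hQ : Dfn M Q) : Dfn M fun a => P a ∨ Q a :=
  DefS.congr (DefS.or hP hQ) fun s => by
    rcases (decode (s 0) : Option α) with _ | a <;> simp

variable [hM : Fact (arith ⊆ M)]

theorem Dfn.comp {P : β → Prop} {f : α → β} (hP : Dfn M P) (hf : Primrec f) :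
    Dfn M fun a => P (f a) := by
  have hn := DefS.natPrimrec hM.out hf
  -- The graph of `f` on codes returns `0` where decoding fails and the code of the value plus one
  -- elsewhere; `y = m + 1` selects the genuine inputs.
  have : DefS M fun s => ∃ y m, y = encode ((decode (s 0) : Option α).map f) ∧
      y = m + 1 ∧ ∃ b ∈ (decode m : Option β), P b := by
    refine DefS.ex 1 (DefS.ex 2 (hn.and ((DefS.eq hM.out (.var 1) ((TermS.var 2).succ hM.out)).and
      (DefS.rename₁ (P := fun m => ∃ b ∈ (decode m : Option β), P b) hP 2))) ?_) ?_
    all_goals simp [Function.update]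
  refine this.congr fun s => ?_
  constructor
  · rintro ⟨y, m, h1, h2, b, h3, h4⟩
    subst h2
    rcases h5 : (decode (s 0) : Option α) with _ | a
    · simp [h5] at h1
    · simp only [h5, Option.map_some, encode_some, Nat.succ_eq_add_one, add_left_inj] at h1
      subst h1
      rw [encodek, Option.mem_some_iff] at h3
      subst h3
      exact ⟨a, rfl, h4⟩
  · rintro ⟨a, h1, h2⟩
    rw [Option.mem_def] at h1
    exact ⟨_, encode (f a), rfl, by simp [h1], f a, by simp, h2⟩

theorem Dfn.of_primrecPred {P : α → Prop} (hP : PrimrecPred P) : Dfn M P := by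
  classical
  have h0 : Dfn M fun n : ℕ => 0 < n := by
    rw [Dfn.nat_iff]
    refine (DefS.ex (P := fun s a => a < s 0) 1 (DefS.lt hM.out (.var 1) (.var 0)) ?_).congr ?_
    · simp [Function.update]
    · exact fun s => ⟨fun ⟨a, h⟩ => Nat.zero_lt_of_lt h, fun h => ⟨0, h⟩⟩
  refine (h0.comp (Primrec.ite hP (Primrec.const 1) (Primrec.const 0))).congr fun a => ?_
  split_ifs with h <;> simp [h]

theorem Dfn.true : Dfn M fun _ : α => True :=
  .of_primrecPred ((Primrec.eq (α := ℕ)).comp (Primrec.const 0) (Primrec.const 0) |>.of_eq (by simp))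

theorem Dfn.not {P : α → Prop} (hP : Dfn M P) : Dfn M fun a => ¬ P a :=
  DefS.congr (DefS.and (Dfn.true (α := α)) (DefS.not hP)) fun s => by
    rcases (decode (s 0) : Option α) with _ | a <;> simp

theorem Dfn.const (p : Prop) : Dfn M fun _ : α => p := by
  by_cases h : p
  · simpa [h] using Dfn.true
  · simpa [h] using Dfn.true.not

theorem Dfn.imp {P Q : α → Prop} (hP : Dfn M P) (hQ : Dfn M Q) : Dfn M fun a => P a → Q a :=
  (hP.not.or hQ).congr fun _ => imp_iff_not_or.symm

theorem Dfn.iff {P Q : α → Prop} (hP : Dfn M P) (hQ : Dfn M Q) : Dfn M fun a => P a ↔ Q a :=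
  ((hP.imp hQ).and (hQ.imp hP)).congr fun _ => iff_iff_implies_and_implies.symm

theorem Dfn.ex {P : α → β → Prop} (hP : Dfn M fun p : α × β => P p.1 p.2) :
    Dfn M fun a => ∃ b, P a b := by
  have hP' : DefS M fun s => ∃ m n, m = Nat.pair (s 0) n ∧
      ∃ a ∈ (decode m : Option (α × β)), P a.1 a.2 := by
    refine DefS.ex 1 (DefS.ex 2 ((DefS.pair hM.out 0 2 1).and
      (DefS.rename₁ (P := fun m => ∃ a ∈ (decode m : Option (α × β)), P a.1 a.2) hP 1)) ?_) ?_
    all_goals simp [Function.update]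
  refine hP'.congr fun s => ?_
  constructor
  · rintro ⟨_, n, rfl, ⟨a, b⟩, h1, h2⟩
    simp only [decode_prod_val, Nat.unpair_pair, Option.mem_def, Option.bind_eq_some_iff,
      Option.map_eq_some_iff, Prod.mk.injEq] at h1
    obtain ⟨a, h3, b, h4, rfl, rfl⟩ := h1
    exact ⟨a, h3, b, h2⟩
  · rintro ⟨a, h1, b, h2⟩
    rw [Option.mem_def] at h1
    exact ⟨_, encode b, rfl, (a, b), by simp [h1], h2⟩

theorem Dfn.all {P : α → β → Prop} (hP : Dfn M fun p : α × β => P p.1 p.2) :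
    Dfn M fun a => ∀ b, P a b :=
  (Dfn.ex (P := fun a b => ¬ P a b) hP.not).not.congr fun _ => by simp

theorem Dfn.eq {f g : α → β} (hf : Primrec f) (hg : Primrec g) : Dfn M fun a => f a = g a :=
  .of_primrecPred (Primrec.eq.comp hf hg)

theorem Dfn.ne {f g : α → β} (hf : Primrec f) (hg : Primrec g) : Dfn M fun a => f a ≠ g a :=
  (Dfn.eq hf hg).not

theorem definable₂_iff_dfn {P : ℕ → ℕ → Prop} :
    Definable₂ M P ↔ Dfn M fun p : ℕ × ℕ => P p.1 p.2 := by
  rw [definable₂_iff_defS]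
  constructor
  · intro h
    have : DefS M fun s => ∃ a b, s 0 = Nat.pair a b ∧ P a b := by
      refine DefS.ex 1 (DefS.ex 2 ((DefS.pair hM.out 1 2 0).and (h.rename₂ 1 2)) ?_) ?_
      all_goals simp [Function.update]
    refine this.congr fun s => ?_
    constructor
    · rintro ⟨a, b, h1, h2⟩
      exact ⟨(a, b), by simp [h1], h2⟩
    · rintro ⟨⟨a, b⟩, h1, h2⟩
      simp only [decode_prod_val, decode_nat, Option.bind_some, Option.map_some, Option.mem_def,
        Option.some.injEq, Prod.mk.injEq] at h1
      obtain ⟨rfl, rfl⟩ := h1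
      exact ⟨_, _, (Nat.pair_unpair _).symm, h2⟩
  · intro h
    have : DefS M fun s => ∃ m, m = Nat.pair (s 0) (s 1) ∧
        ∃ a ∈ (decode m : Option (ℕ × ℕ)), P a.1 a.2 := by
      refine DefS.ex 2 ((DefS.pair hM.out 0 1 2).and
        (DefS.rename₁ (P := fun m => ∃ a ∈ (decode m : Option (ℕ × ℕ)), P a.1 a.2) h 2)) ?_
      simp [Function.update]
    exact this.congr fun s => by simp

theorem Dfn.exists_fintype {ι : Type*} [Finite ι] {P : ι → α → Prop} (h : ∀ i, Dfn M (P i)) :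
    Dfn M fun a => ∃ i, P i a := by
  have := Fintype.ofFinite ι
  suffices H : ∀ S : Finset ι, Dfn M fun a => ∃ i ∈ S, P i a by simpa using H Finset.univ
  classical
  intro S
  induction S using Finset.induction_on with
  | empty => simpa using Dfn.const False
  | insert i S _ ih => simpa using (h i).or ih

theorem Dfn.forall_fintype {ι : Type*} [Finite ι] {P : ι → α → Prop} (h : ∀ i, Dfn M (P i)) :
    Dfn M fun a => ∀ i, P i a :=
  (Dfn.exists_fintype fun i => (h i).not).not.congr fun _ => by simp

end

/-! ### Composition rules through which `fun_prop` proves primitive recursiveness and definability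
-/

section
variable {α β γ : Type*} [Primcodable α] [Primcodable β] [Primcodable γ]

theorem Primrec.pair_comp {f : α → β} {g : α → γ} (hf : Primrec f) (hg : Primrec g) :
    Primrec fun a => (f a, g a) := hf.pair hg

theorem Primrec.fst_comp {f : α → β × γ} (hf : Primrec f) : Primrec fun a => (f a).1 :=
  Primrec.fst.comp hf

theorem Primrec.snd_comp {f : α → β × γ} (hf : Primrec f) : Primrec fun a => (f a).2 :=
  Primrec.snd.comp hf

theorem Primrec.add_comp {f g : α → ℕ} (hf : Primrec f) (hg : Primrec g) :
    Primrec fun a => f a + g a := Primrec.nat_add.comp hf hg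

theorem Primrec.mul_comp {f g : α → ℕ} (hf : Primrec f) (hg : Primrec g) :
    Primrec fun a => f a * g a := Primrec.nat_mul.comp hf hg

theorem Primrec.max_comp {f g : α → ℕ} (hf : Primrec f) (hg : Primrec g) :
    Primrec fun a => max (f a) (g a) := Primrec.nat_max.comp hf hg

theorem Primrec.encode_comp {f : α → β} (hf : Primrec f) : Primrec fun a => encode (f a) :=
  Primrec.encode.comp hf

theorem Primrec.seqCode_comp {f : α → List ℕ} (hf : Primrec f) : Primrec fun a => seqCode (f a) :=
  Primrec.encode.comp hf

theorem Primrec.some_comp {f : α → β} (hf : Primrec f) : Primrec fun a => some (f a) :=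
  Primrec.option_some.comp hf

theorem Primrec.cons_comp {f : α → β} {g : α → List β} (hf : Primrec f) (hg : Primrec g) :
    Primrec fun a => f a :: g a := Primrec.list_cons.comp hf hg

theorem Primrec.append_comp {f g : α → List β} (hf : Primrec f) (hg : Primrec g) :
    Primrec fun a => f a ++ g a := Primrec.list_append.comp hf hg

theorem Primrec.length_comp {f : α → List β} (hf : Primrec f) : Primrec fun a => (f a).length :=
  Primrec.list_length.comp hf

theorem Primrec.flatten_comp {f : α → List (List β)} (hf : Primrec f) :
    Primrec fun a => (f a).flatten := Primrec.list_flatten.comp hf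

theorem Primrec.drop_comp {f : α → ℕ} {g : α → List β} (hf : Primrec f) (hg : Primrec g) :
    Primrec fun a => (g a).drop (f a) := Primrec.list_drop.comp hf hg

theorem Primrec.getElem?_comp {f : α → List β} {g : α → ℕ} (hf : Primrec f) (hg : Primrec g) :
    Primrec fun a => (f a)[g a]? := Primrec.list_getElem?.comp hf hg

theorem Primrec.getD_comp {f : α → List β} {g : α → ℕ} (d : β) (hf : Primrec f)
    (hg : Primrec g) : Primrec fun a => (f a).getD (g a) d := (Primrec.list_getD d).comp hf hg

end

attribute [fun_prop] Primrec Primrec.id Primrec.const Primrec.comp Primrec.pair_comp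
  Primrec.fst_comp Primrec.snd_comp Primrec.add_comp Primrec.mul_comp Primrec.max_comp
  Primrec.encode_comp Primrec.seqCode_comp Primrec.some_comp
  Primrec.cons_comp Primrec.append_comp Primrec.length_comp Primrec.flatten_comp
  Primrec.drop_comp Primrec.getElem?_comp Primrec.getD_comp

attribute [fun_prop] Dfn Dfn.comp Dfn.and Dfn.or Dfn.not Dfn.const Dfn.imp Dfn.iff Dfn.ex Dfn.all
  Dfn.eq Dfn.ne

section
variable {M : Set Symb} [hM : Fact (arith ⊆ M)] {α β : Type*} [Primcodable α] [Primcodable β]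

@[fun_prop]
theorem Dfn.mem_list {f : α → β} {g : α → List β} (hf : Primrec f) (hg : Primrec g) :
    Dfn M fun a => f a ∈ g a := by
  have : Dfn M fun a => ∃ i : ℕ, (g a)[i]? = some (f a) := by fun_prop
  exact this.congr fun a => List.mem_iff_getElem?.symm

/-! ### Finite derivations -/

/-- `x` has a finite derivation with the rules `Step x l`: "`x` follows from the members of `l`". -/
inductive Derivable {α : Type*} (Step : α → List α → Prop) : α → Prop
  | mk (x : α) (l : List α) : (∀ y ∈ l, Derivable Step y) → Step x l → Derivable Step x

/-- A derivation is written as a list in which the premises of each entry occur later; concatenating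
such lists preserves the condition. An inductive predicate thus becomes a quantifier over codes of
lists. -/
theorem derivable_iff_exists_list {α : Type*} {Step : α → List α → Prop} {x : α} :
    Derivable Step x ↔ ∃ L : List α, x ∈ L ∧ ∀ i z, L[i]? = some z →
      ∃ l, (∀ y, y ∈ l → y ∈ L.drop (i + 1)) ∧ Step z l := by
  set Good : List α → Prop := fun L => ∀ i z, L[i]? = some z →
      ∃ l, (∀ y, y ∈ l → y ∈ L.drop (i + 1)) ∧ Step z l with hGood
  have happ : ∀ L L', Good L → Good L' → Good (L ++ L') := by
    intro L L' h h' i z hz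
    rcases lt_or_ge i L.length with hi | hi
    · rw [List.getElem?_append_left hi] at hz
      obtain ⟨l, h1, h2⟩ := h i z hz
      exact ⟨l, fun y hy => by
        rw [List.drop_append_of_le_length (by omega)]
        exact List.mem_append_left _ (h1 y hy), h2⟩
    · rw [List.getElem?_append_right hi] at hz
      obtain ⟨l, h1, h2⟩ := h' _ z hz
      refine ⟨l, fun y hy => ?_, h2⟩
      have : i + 1 = L.length + (i - L.length + 1) := by omega
      rw [this, ← List.drop_drop, List.drop_left]
      exact h1 y hy
  constructor
  · intro h
    induction h with
    | mk x l _ hs ih =>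
      have : ∀ l' : List α, (∀ y ∈ l', y ∈ l) → ∃ L, (∀ y ∈ l', y ∈ L) ∧ Good L := by
        intro l'
        induction l' with
        | nil => exact fun _ => ⟨[], by simp, fun i z hz => by simp at hz⟩
        | cons y l' ih' =>
          intro hl
          obtain ⟨L, h1, h2⟩ := ih' fun y hy => hl y (List.mem_cons_of_mem _ hy)
          obtain ⟨L', h3, h4⟩ := ih y (hl y (List.mem_cons_self))
          refine ⟨L' ++ L, fun w hw => ?_, happ _ _ h4 h2⟩
          rcases List.mem_cons.1 hw with rfl | hw
          · exact List.mem_append_left _ h3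
          · exact List.mem_append_right _ (h1 w hw)
      obtain ⟨L, h1, h2⟩ := this l fun _ h => h
      refine ⟨x :: L, List.mem_cons_self, fun i z hz => ?_⟩
      rcases i with _ | i
      · simp only [List.getElem?_cons_zero, Option.some.injEq] at hz
        subst hz
        exact ⟨l, by simpa using h1, hs⟩
      · simpa using h2 i z (by simpa using hz)
  · rintro ⟨L, hx, hL⟩
    induction L generalizing x with
    | nil => simp at hx
    | cons y L ih =>
      have hL' : Good L := fun i z hz => by simpa using hL (i + 1) z (by simpa using hz)
      rcases List.mem_cons.1 hx with rfl | hx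
      · obtain ⟨l, h1, h2⟩ := hL 0 x (by simp)
        exact ⟨_, l, fun y hy => ih (by simpa using h1 y hy) hL', h2⟩
      · exact ih hx hL'

theorem Dfn.derivable {Step : β → α → List α → Prop}
    (h : Dfn M fun p : β × α × List α => Step p.1 p.2.1 p.2.2) :
    Dfn M fun p : β × α => Derivable (Step p.1) p.2 := by
  have h' : ∀ {γ : Type _} [Primcodable γ] {f : γ → β} {g : γ → α} {k : γ → List α},
      Primrec f → Primrec g → Primrec k → Dfn M fun c => Step (f c) (g c) (k c) :=
    fun hf hg hk => h.comp (hf.pair (hg.pair hk))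
  have : Dfn M fun p : β × α => ∃ L : List α, p.2 ∈ L ∧ ∀ (i : ℕ) z, L[i]? = some z →
      ∃ l : List α, (∀ y, y ∈ l → y ∈ L.drop (i + 1)) ∧ Step p.1 z l := by
    refine .ex (.and (by fun_prop) (.all (.all (.imp (by fun_prop) (.ex (.and (by fun_prop)
      (h' ?_ ?_ ?_))))))) <;> fun_prop
  exact this.congr fun p => derivable_iff_exists_list.symm

end

/-! ### Assignments coded by lists -/

/-- The assignment coded by a list. -/
def asg (l : List ℕ) : ℕ → ℕ := fun i => l.getD i 0

/-- The list that codes the assignment of `l` with the value at `i` changed to `a`. -/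
def upd (l : List ℕ) (i a : ℕ) : List ℕ :=
  (List.range (max l.length (i + 1))).map fun j => if j = i then a else l.getD j 0

theorem asg_upd (l : List ℕ) (i a : ℕ) : asg (upd l i a) = Function.update (asg l) i a := by
  ext j
  simp only [asg, upd, List.getD_eq_getElem?_getD, List.getElem?_map]
  rcases lt_or_ge j (max l.length (i + 1)) with h | h
  · rw [List.getElem?_range h]
    by_cases hji : j = i
    · subst hji; simp
    · simp [hji, asg]
  · rw [List.getElem?_eq_none (by simpa using h)]
    have hji : j ≠ i := by omega
    have : l.length ≤ j := by omega
    simp [hji, asg, this]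

section
variable {α : Type*} [Primcodable α]

@[fun_prop]
theorem Primrec.upd_comp {f : α → List ℕ} {g h : α → ℕ} (hf : Primrec f) (hg : Primrec g)
    (hh : Primrec h) : Primrec fun a => upd (f a) (g a) (h a) := by
  unfold upd
  refine Primrec.list_map (Primrec.list_range.comp (by fun_prop)) ?_
  refine Primrec.ite (Primrec.eq.comp ?_ ?_) ?_ ?_ <;> fun_prop

@[fun_prop]
theorem Primrec.asg_comp {f : α → List ℕ} {g : α → ℕ} (hf : Primrec f) (hg : Primrec g) :
    Primrec fun a => asg (f a) (g a) := by
  unfold asg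
  fun_prop

end

section
variable {M M' : Set Symb} {α β : Type*} [Primcodable α] [Primcodable β]

theorem DefS.dfn_asg (hM : arith ⊆ M) {P : (ℕ → ℕ) → Prop} (h : DefS M P) :
    Dfn M fun l : List ℕ => P (asg l) := by
  have := Fact.mk hM
  let get : ℕ → ℕ → ℕ := fun i m => ((decode m : Option (List ℕ)).getD []).getD i 0
  have hget : ∀ i, Nat.Primrec (get i) := fun i => Primrec.nat_iff.1 <|
    (Primrec.list_getD 0).comp (Primrec.option_getD.comp Primrec.decode (Primrec.const []))
      (Primrec.const i)
  -- The variables are replaced one at a time by entries of the list coded by `s 0`; the remaining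
  -- ones are shifted by one to keep variable `0` free for that code. Finitely many replacements
  -- suffice, since only finitely many variables occur free.
  have step : ∀ n, DefS M fun s => P fun i => if i < n then get i (s 0) else s (i + 1) := by
    intro n
    induction n with
    | zero => exact h.rename fun i => i + 1
    | succ n ih =>
      have : DefS M fun s => ∃ a, a = get n (s 0) ∧
          P fun i => if i < n then get i (s 0) else if i = n then a else s (i + 1) := by
        refine DefS.ex (n + 1) (((DefS.natPrimrec hM (hget n)).rename₂
          (P := fun x y => y = get n x) 0 (n + 1)).and (ih.congr fun s => iff_of_eq ?_)) ?_
        · congr 1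
          ext i
          split_ifs with h1 h2 <;> simp_all
        · intro s a b
          have : (Function.update s (n + 1) a) 0 = s 0 := by simp
          rw [this]
          refine and_congr_right fun _ => iff_of_eq ?_
          congr 1
          ext i
          split_ifs with h1 h2 <;> simp_all
      refine this.congr fun s => ?_
      simp only [exists_eq_left]
      refine iff_of_eq ?_
      congr 1
      ext i
      rcases lt_trichotomy i n with h1 | h1 | h1
      · simp [h1, Nat.lt_succ_of_lt h1]
      · subst h1; simp
      · simp [h1.not_gt, h1.ne', show ¬ i < n + 1 by omega]
  obtain ⟨φ, hφ, hP⟩ := h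
  obtain ⟨n, hn⟩ := φ.finite_free.bddAbove
  have hlist : Dfn M fun _ : List ℕ => True := Dfn.true
  refine (DefS.and hlist (step (n + 1))).congr fun s => ?_
  have key : ∀ l : List ℕ, decode (s 0) = some l →
      (P (fun i => if i < n + 1 then get i (s 0) else s (i + 1)) ↔ P (asg l)) := by
    intro l hl
    rw [← hP, ← hP]
    refine Fml.sat_congr fun i hi => ?_
    have : i < n + 1 := Nat.lt_succ_of_le (hn hi)
    simp only [this, if_true, get, hl, Option.getD_some, asg]
  constructor
  · rintro ⟨⟨l, hl, -⟩, h⟩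
    exact ⟨l, hl, (key l hl).1 h⟩
  · rintro ⟨l, hl, h⟩
    exact ⟨⟨l, hl, trivial⟩, (key l hl).2 h⟩

/-! ### Interpretations between structures -/

/-- The meaning of a symbol is definable in `M`. -/
def SymbDfn (M : Set Symb) : Symb → Prop
  | .pred n _ A => Dfn M fun l : List ℕ => (fun k : Fin n => asg l k) ∈ A
  | .func n f => Dfn M fun l : List ℕ => asg l 0 = f fun k : Fin n => asg l (k + 1)

/-- The meanings of the symbols of `M` are definable in `M'`. -/
def Interp (M M' : Set Symb) : Prop := ∀ s ∈ M, SymbDfn M' s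

theorem SymbDfn.of_mem (hM : arith ⊆ M) {s : Symb} (hs : s ∈ M) : SymbDfn M s := by
  rcases s with ⟨n, hn, A⟩ | ⟨n, f⟩
  · exact DefS.dfn_asg hM (P := fun s => (fun k : Fin n => s k) ∈ A)
      ⟨.atom n hn A fun k => .var k, ⟨hs, fun _ => trivial⟩, fun s => Iff.rfl⟩
  · exact DefS.dfn_asg hM (P := fun s => s 0 = f fun k : Fin n => s (k + 1))
      (DefS.eq hM (.var 0) ⟨.app n f fun k => .var (k + 1), ⟨hs, fun _ => trivial⟩, fun s => rfl⟩)

theorem Interp.of_subset (hM : arith ⊆ M') (h : M ⊆ M') : Interp M M' :=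
  fun _ hs => .of_mem hM (h hs)

section
variable [hM' : Fact (arith ⊆ M')]

theorem Tm.dfn_val (h : Interp M M') (t : Tm) (ht : t.In M) :
    Dfn M' fun p : List ℕ × ℕ => p.2 = t.val (asg p.1) := by
  induction t with
  | var i => unfold Tm.val; fun_prop
  | app n f ts ih =>
    have hf : Dfn M' fun l : List ℕ => asg l 0 = f fun k : Fin n => asg l (k + 1) := h _ ht.1
    have hf' : Dfn M' fun q : (List ℕ × ℕ) × List ℕ =>
        asg (q.1.2 :: q.2) 0 = f fun k : Fin n => asg (q.1.2 :: q.2) (k + 1) :=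
      hf.comp (f := fun q : (List ℕ × ℕ) × List ℕ => q.1.2 :: q.2) (by fun_prop)
    have hts : Dfn M' fun q : (List ℕ × ℕ) × List ℕ =>
        ∀ k : Fin n, asg q.2 k = (ts k).val (asg q.1.1) :=
      Dfn.forall_fintype fun k => (ih k (ht.2 k)).comp
        (f := fun q : (List ℕ × ℕ) × List ℕ => (q.1.1, asg q.2 k)) (by fun_prop)
    refine (Dfn.ex (P := fun (p : List ℕ × ℕ) v => (∀ k : Fin n, asg v k = (ts k).val (asg p.1)) ∧
      asg (p.2 :: v) 0 = f fun k : Fin n => asg (p.2 :: v) (k + 1)) (hts.and hf')).congr ?_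
    rintro ⟨l, y⟩
    simp only [Tm.val]
    constructor
    · rintro ⟨v, h1, h2⟩
      simp only [← h1]
      simpa [asg] using h2
    · intro h1
      refine ⟨List.ofFn fun k => (ts k).val (asg l), fun k => by simp [asg], ?_⟩
      simpa [asg] using h1

theorem Fml.dfn_sat (h : Interp M M') (φ : Fml) (hφ : φ.In M) :
    Dfn M' fun l : List ℕ => φ.Sat (asg l) := by
  induction φ with
  | atom n hn A ts =>
    have hA : Dfn M' fun l : List ℕ => (fun k : Fin n => asg l k) ∈ A := h _ hφ.1
    have hA' : Dfn M' fun q : List ℕ × List ℕ => (fun k : Fin n => asg q.2 k) ∈ A :=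
      hA.comp (f := fun q : List ℕ × List ℕ => q.2) (by fun_prop)
    have hts : Dfn M' fun q : List ℕ × List ℕ => ∀ k : Fin n, asg q.2 k = (ts k).val (asg q.1) :=
      Dfn.forall_fintype fun k => ((ts k).dfn_val h (hφ.2 k)).comp
        (f := fun q : List ℕ × List ℕ => (q.1, asg q.2 k)) (by fun_prop)
    refine (Dfn.ex (P := fun l v => (∀ k : Fin n, asg v k = (ts k).val (asg l)) ∧
      (fun k : Fin n => asg v k) ∈ A) (hts.and hA')).congr fun l => ?_
    simp only [Fml.Sat]
    constructor
    · rintro ⟨v, h1, h2⟩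
      simpa only [← h1] using h2
    · intro h1
      refine ⟨List.ofFn fun k => (ts k).val (asg l), fun k => by simp [asg], ?_⟩
      simpa [asg] using h1
  | neg φ ih => exact (ih hφ).not
  | and φ ψ ih ih' => exact (ih hφ.1).and (ih' hφ.2)
  | or φ ψ ih ih' => exact (ih hφ.1).or (ih' hφ.2)
  | imp φ ψ ih ih' => exact (ih hφ.1).imp (ih' hφ.2)
  | iff φ ψ ih ih' => exact (ih hφ.1).iff (ih' hφ.2)
  | all i φ ih =>
    have := (ih hφ).comp (f := fun q : List ℕ × ℕ => upd q.1 i q.2) (by fun_prop)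
    exact (Dfn.all (P := fun l a => φ.Sat (asg (upd l i a))) this).congr fun l => by
      simp [Fml.Sat, asg_upd]
  | ex i φ ih =>
    have := (ih hφ).comp (f := fun q : List ℕ × ℕ => upd q.1 i q.2) (by fun_prop)
    exact (Dfn.ex (P := fun l a => φ.Sat (asg (upd l i a))) this).congr fun l => by
      simp [Fml.Sat, asg_upd]

theorem Dfn.trans (h : Interp M M') {P : α → Prop} (hP : Dfn M P) : Dfn M' P := by
  obtain ⟨φ, hφ, hP⟩ := hP
  have := (φ.dfn_sat h hφ).comp (f := fun n : ℕ => [n]) (by fun_prop)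
  exact (Dfn.nat_iff.1 this).congr fun s => hP _

theorem SymbDfn.trans (h : Interp M M') {s : Symb} (hs : SymbDfn M s) : SymbDfn M' s := by
  rcases s with ⟨n, hn, A⟩ | ⟨n, f⟩ <;> exact Dfn.trans h hs

theorem Interp.trans {M₀ : Set Symb} (h : Interp M₀ M) (h' : Interp M M') : Interp M₀ M' :=
  fun s hs => (h s hs).trans h'

theorem symbDfn_pred₁ {X : Set ℕ} : SymbDfn M' (pred₁ X) ↔ Dfn M' fun x => x ∈ X := by
  constructor
  · intro h
    exact Dfn.comp (P := fun l => (fun k : Fin 1 => asg l k) ∈ {v : Fin 1 → ℕ | v 0 ∈ X})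
      (f := fun n : ℕ => [n]) h (by fun_prop)
  · intro h
    exact h.comp (f := fun l => asg l 0) (by fun_prop)

theorem symbDfn_pred₂ {P : ℕ → ℕ → Prop} :
    SymbDfn M' (pred₂ P) ↔ Dfn M' fun p : ℕ × ℕ => P p.1 p.2 := by
  constructor
  · intro h
    exact Dfn.comp (P := fun l => (fun k : Fin 2 => asg l k) ∈ {v : Fin 2 → ℕ | P (v 0) (v 1)})
      (f := fun n : ℕ × ℕ => [n.1, n.2]) h (by fun_prop)
  · intro h
    exact h.comp (f := fun l => (asg l 0, asg l 1)) (by fun_prop)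

theorem Interp.definable₁ (h : Interp M M') {X : Set ℕ} (hX : Definable₁ M X) : Definable₁ M' X :=
  definable₁_iff_dfn.2 ((definable₁_iff_dfn.1 hX).trans h)

end

/-- The meaning of a symbol of any arity is a set of codes of lists, so agreement on definable sets
of numbers is enough. -/
theorem interp_of_definable₁ (hM : arith ⊆ M) (h : ∀ X, Definable₁ M X → Definable₁ M' X) :
    Interp M M' := by
  have key : ∀ P : List ℕ → Prop, Dfn M P → Dfn M' P := fun P hP => by
    have h1 : Definable₁ M {n | ∃ a ∈ (decode n : Option (List ℕ)), P a} :=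
      definable₁_iff_defS.2 hP
    exact definable₁_iff_defS.1 (h _ h1)
  intro s hs
  have := SymbDfn.of_mem hM hs
  rcases s with ⟨n, hn, A⟩ | ⟨n, f⟩ <;> exact key _ this

theorem Interp.union {M₀ : Set Symb} (h : Interp M M') (h' : Interp M₀ M') :
    Interp (M ∪ M₀) M' := fun s hs => hs.elim (h s) (h' s)

theorem interp_singleton {s : Symb} (h : SymbDfn M' s) : Interp {s} M' := by
  rintro _ rfl
  exact h

theorem defEquiv_iff_interp (hM : arith ⊆ M) (hM' : arith ⊆ M') :
    DefEquiv M M' ↔ Interp M M' ∧ Interp M' M := by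
  have := Fact.mk hM
  have := Fact.mk hM'
  constructor
  · intro h
    exact ⟨interp_of_definable₁ hM fun X => (h X).1, interp_of_definable₁ hM' fun X => (h X).2⟩
  · rintro ⟨h, h'⟩ X
    exact ⟨h.definable₁, h'.definable₁⟩

end

/-! ### Codes of terms and formulas, and unique readability -/

/-- The string of a term, as a list of codes of letters. -/
def Tm.code (c : Symb → ℕ) (t : Tm) : List ℕ := t.str.map (Letter.code c)

/-- The string of a formula, as a list of codes of letters. -/
def Fml.code (c : Symb → ℕ) (φ : Fml) : List ℕ := φ.str.map (Letter.code c)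

theorem Fml.godel_eq (c : Symb → ℕ) (φ : Fml) : φ.godel c = encode (φ.code c) := rfl

/-- The code of a predicate symbol of arity `n` that has the code `k`. -/
def predLetter (k n : ℕ) : ℕ := 2 * seqCode [k, n, 0]

/-- The code of a function symbol of arity `n` that has the code `k`. -/
def funcLetter (k n : ℕ) : ℕ := 2 * seqCode [k, n, 1]

section
variable (c : Symb → ℕ)

theorem Tm.code_var (i : ℕ) : (Tm.var i).code c = [2 * i + 19] := rfl

theorem Tm.code_app (n : ℕ) (f : (Fin n → ℕ) → ℕ) (ts : Fin n → Tm) : (Tm.app n f ts).code c =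
    funcLetter (c (.func n f)) n :: 15 :: ((List.ofFn fun k => (ts k).code c).flatten ++ [17]) := by
  simp [Tm.code, Tm.str, Letter.code, List.map_flatten, List.map_ofFn, Function.comp_def,
    funcLetter]

theorem Fml.code_atom (n : ℕ) (hn : 0 < n) (A : Set (Fin n → ℕ)) (ts : Fin n → Tm) :
    (Fml.atom n hn A ts).code c = predLetter (c (.pred n hn A)) n :: 15 ::
      ((List.ofFn fun k => (ts k).code c).flatten ++ [17]) := by
  simp [Tm.code, Fml.code, Fml.str, Letter.code, List.map_flatten, List.map_ofFn,
    Function.comp_def, predLetter]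

theorem Fml.code_neg (φ : Fml) : φ.neg.code c = 5 :: 15 :: (φ.code c ++ [17]) := by
  simp [Fml.code, Fml.str, Letter.code]

theorem Fml.code_and (φ ψ : Fml) :
    (φ.and ψ).code c = 15 :: (φ.code c ++ 17 :: 1 :: 15 :: (ψ.code c ++ [17])) := by
  simp [Fml.code, Fml.str, Letter.code]

theorem Fml.code_or (φ ψ : Fml) :
    (φ.or ψ).code c = 15 :: (φ.code c ++ 17 :: 3 :: 15 :: (ψ.code c ++ [17])) := by
  simp [Fml.code, Fml.str, Letter.code]

theorem Fml.code_imp (φ ψ : Fml) :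
    (φ.imp ψ).code c = 15 :: (φ.code c ++ 17 :: 7 :: 15 :: (ψ.code c ++ [17])) := by
  simp [Fml.code, Fml.str, Letter.code]

theorem Fml.code_iff (φ ψ : Fml) :
    (φ.iff ψ).code c = 15 :: (φ.code c ++ 17 :: 9 :: 15 :: (ψ.code c ++ [17])) := by
  simp [Fml.code, Fml.str, Letter.code]

theorem Fml.code_all (i : ℕ) (φ : Fml) :
    (Fml.all i φ).code c = 11 :: (2 * i + 19) :: 15 :: (φ.code c ++ [17]) := by
  simp [Fml.code, Fml.str, Letter.code]

theorem Fml.code_ex (i : ℕ) (φ : Fml) :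
    (Fml.ex i φ).code c = 13 :: (2 * i + 19) :: 15 :: (φ.code c ++ [17]) := by
  simp [Fml.code, Fml.str, Letter.code]

end

theorem seqCode_injective : Function.Injective seqCode := encode_injective

theorem predLetter_inj {k n k' n' : ℕ} :
    predLetter k n = predLetter k' n' ↔ k = k' ∧ n = n' := by
  simp [predLetter, seqCode_injective.eq_iff]

theorem funcLetter_inj {k n k' n' : ℕ} :
    funcLetter k n = funcLetter k' n' ↔ k = k' ∧ n = n' := by
  simp [funcLetter, seqCode_injective.eq_iff]

theorem even_predLetter (k n : ℕ) : Even (predLetter k n) := even_two_mul _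

theorem even_funcLetter (k n : ℕ) : Even (funcLetter k n) := even_two_mul _

theorem flatten_ofFn_append_inj {n : ℕ} {a b : Fin n → List ℕ} {p : Fin n → Prop}
    (h : ∀ k u v, a k ++ u = b k ++ v → p k ∧ u = v) {u v : List ℕ}
    (huv : (List.ofFn a).flatten ++ u = (List.ofFn b).flatten ++ v) : (∀ k, p k) ∧ u = v := by
  induction n with
  | zero => exact ⟨fun k => k.elim0, by simpa using huv⟩
  | succ n ih =>
    simp only [List.ofFn_succ, List.flatten_cons, List.append_assoc] at huv
    obtain ⟨h0, huv⟩ := h 0 _ _ huv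
    obtain ⟨h1, huv⟩ := ih (fun k => h k.succ) huv
    exact ⟨fun k => Fin.cases h0 h1 k, huv⟩

section
variable {S : Set Symb} {c : Symb → ℕ}

/-- The arbitrary continuations `u` and `v` are what the induction needs: they express that no code
is a proper initial segment of another. The parity of the first letter separates variables from
applications, and injectivity of `c` recovers the function symbol. -/
theorem Tm.code_append_inj (hc : S.InjOn c) {t t' : Tm} (ht : t.In S) (ht' : t'.In S)
    {u v : List ℕ} (h : t.code c ++ u = t'.code c ++ v) : t = t' ∧ u = v := by
  induction t generalizing t' u v with
  | var i =>
    rcases t' with j | ⟨n, f, ts⟩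
    · simp only [Tm.code_var, List.cons_append, List.nil_append, List.cons.injEq] at h
      exact ⟨by rw [show i = j by omega], h.2⟩
    · simp only [Tm.code_var, Tm.code_app, List.cons_append, List.cons.injEq] at h
      have := even_funcLetter (c (.func n f)) n
      grind
  | app n f ts ih =>
    rcases t' with j | ⟨n', f', ts'⟩
    · simp only [Tm.code_var, Tm.code_app, List.cons_append, List.cons.injEq] at h
      have := even_funcLetter (c (.func n f)) n
      grind
    · simp only [Tm.code_app, List.cons_append, List.cons.injEq, funcLetter_inj,
        List.append_assoc] at h
      obtain ⟨⟨h1, -⟩, -, h2⟩ := h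
      have h3 := hc ht.1 ht'.1 h1
      cases h3
      obtain ⟨h4, h5⟩ := flatten_ofFn_append_inj (p := fun k => ts k = ts' k)
        (fun k u v h => ih k (ht.2 k) (ht'.2 k) h) h2
      simp only [List.nil_append, List.cons.injEq, true_and] at h5
      exact ⟨by rw [funext h4], h5⟩

theorem Fml.code_append_inj (hc : S.InjOn c) {φ φ' : Fml} (hφ : φ.In S) (hφ' : φ'.In S)
    {u v : List ℕ} (h : φ.code c ++ u = φ'.code c ++ v) : φ = φ' ∧ u = v := by
  induction φ generalizing φ' u v with
  | atom n hn A ts =>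
    have h0 := even_predLetter (c (.pred n hn A)) n
    rcases φ' with ⟨n', hn', A', ts'⟩ | φ' | ⟨φ', ψ'⟩ | ⟨φ', ψ'⟩ | ⟨φ', ψ'⟩ | ⟨φ', ψ'⟩ | ⟨j, φ'⟩ | ⟨j, φ'⟩
    · simp only [Fml.code_atom, List.cons_append, List.cons.injEq, predLetter_inj,
        List.append_assoc] at h
      obtain ⟨⟨h1, -⟩, -, h2⟩ := h
      have h3 := hc hφ.1 hφ'.1 h1
      cases h3
      obtain ⟨h4, h5⟩ := flatten_ofFn_append_inj (p := fun k => ts k = ts' k)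
        (fun k u v h => Tm.code_append_inj hc (hφ.2 k) (hφ'.2 k) h) h2
      simp only [List.nil_append, List.cons.injEq, true_and] at h5
      exact ⟨by rw [funext h4], h5⟩
    all_goals
      simp only [Fml.code_atom, Fml.code_neg, Fml.code_and, Fml.code_or, Fml.code_imp,
        Fml.code_iff, Fml.code_all, Fml.code_ex, List.cons_append, List.cons.injEq] at h
      rw [h.1] at h0
      exact absurd h0 (by decide)
  | neg φ ih =>
    rcases φ' with ⟨n', hn', A', ts'⟩ | φ' | ⟨φ', ψ'⟩ | ⟨φ', ψ'⟩ | ⟨φ', ψ'⟩ | ⟨φ', ψ'⟩ | ⟨j, φ'⟩ | ⟨j, φ'⟩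
    case neg =>
      simp only [Fml.code_neg, List.cons_append, List.cons.injEq, true_and, List.append_assoc] at h
      obtain ⟨rfl, h⟩ := ih (φ' := φ') hφ hφ' h
      simpa using h
    case atom =>
      have h0 := even_predLetter (c (.pred n' hn' A')) n'
      simp only [Fml.code_atom, Fml.code_neg, List.cons_append, List.cons.injEq] at h
      rw [← h.1] at h0
      exact absurd h0 (by decide)
    all_goals
      simp [Fml.code_neg, Fml.code_and, Fml.code_or, Fml.code_imp, Fml.code_iff, Fml.code_all,
        Fml.code_ex] at h
  | and φ ψ ih ih' | or φ ψ ih ih' | imp φ ψ ih ih' | iff φ ψ ih ih' =>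
    rcases φ' with ⟨n', hn', A', ts'⟩ | φ' | ⟨φ', ψ'⟩ | ⟨φ', ψ'⟩ | ⟨φ', ψ'⟩ | ⟨φ', ψ'⟩ | ⟨j, φ'⟩ | ⟨j, φ'⟩
    case atom =>
      have h0 := even_predLetter (c (.pred n' hn' A')) n'
      simp only [Fml.code_atom, Fml.code_and, Fml.code_or, Fml.code_imp, Fml.code_iff,
        List.cons_append, List.cons.injEq] at h
      rw [← h.1] at h0
      exact absurd h0 (by decide)
    case neg | all | ex =>
      simp [Fml.code_neg, Fml.code_and, Fml.code_or, Fml.code_imp, Fml.code_iff, Fml.code_all,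
        Fml.code_ex] at h
    all_goals
      simp only [Fml.code_and, Fml.code_or, Fml.code_imp, Fml.code_iff, List.cons_append,
        List.cons.injEq, true_and, List.append_assoc] at h
      obtain ⟨rfl, h⟩ := ih hφ.1 hφ'.1 h
      -- The letter after the first closing parenthesis is the connective: distinct connectives are
      -- refuted here, and only the matching case survives.
      simp at h
      try
        obtain ⟨rfl, h⟩ := ih' hφ.2 hφ'.2 h
        simpa using h
  | all i φ ih | ex i φ ih =>
    rcases φ' with ⟨n', hn', A', ts'⟩ | φ' | ⟨φ', ψ'⟩ | ⟨φ', ψ'⟩ | ⟨φ', ψ'⟩ | ⟨φ', ψ'⟩ | ⟨j, φ'⟩ | ⟨j, φ'⟩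
    case atom =>
      have h0 := even_predLetter (c (.pred n' hn' A')) n'
      simp only [Fml.code_atom, Fml.code_all, Fml.code_ex, List.cons_append, List.cons.injEq] at h
      rw [← h.1] at h0
      exact absurd h0 (by decide)
    all_goals
      simp [Fml.code_neg, Fml.code_and, Fml.code_or, Fml.code_imp, Fml.code_iff, Fml.code_all,
        Fml.code_ex] at h
      try
        obtain ⟨rfl, h⟩ := h
        obtain ⟨rfl, h⟩ := ih (φ' := φ') hφ hφ' h
        simpa using h

theorem Tm.code_inj (hc : S.InjOn c) {t t' : Tm} (ht : t.In S) (ht' : t'.In S)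
    (h : t.code c = t'.code c) : t = t' :=
  (Tm.code_append_inj hc ht ht' (u := []) (v := []) (by simpa using h)).1

theorem Fml.code_inj (hc : S.InjOn c) {φ φ' : Fml} (hφ : φ.In S) (hφ' : φ'.In S)
    (h : φ.code c = φ'.code c) : φ = φ' :=
  (Fml.code_append_inj hc hφ hφ' (u := []) (v := []) (by simpa using h)).1

theorem Tm.var_mem_code {t : Tm} {i : ℕ} : 2 * i + 19 ∈ t.code c ↔ i ∈ t.vars := by
  induction t with
  | var j => simp [Tm.code_var, Tm.vars]
  | app n f ts ih =>
    have : 2 * i + 19 ≠ funcLetter (c (.func n f)) n := fun h => by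
      have := even_funcLetter (c (.func n f)) n
      grind
    simp [Tm.code_app, Tm.vars, this, List.mem_ofFn, ih]

theorem Fml.var_mem_code_atom {n : ℕ} {hn : 0 < n} {A : Set (Fin n → ℕ)} {ts : Fin n → Tm} {i : ℕ} :
    2 * i + 19 ∈ (Fml.atom n hn A ts).code c ↔ i ∈ (Fml.atom n hn A ts).free := by
  have : 2 * i + 19 ≠ predLetter (c (.pred n hn A)) n := fun h => by
    have := even_predLetter (c (.pred n hn A)) n
    grind
  simp [Fml.code_atom, Fml.free, this, List.mem_ofFn, Tm.var_mem_code]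

end

/-! ### Satisfaction in terms of codes -/

/-- `a` is the letter of a function symbol of `S` with value `v` at the arguments `vs`. -/
def FunTrue (c : Symb → ℕ) (S : Set Symb) (a : ℕ) (vs : List ℕ) (v : ℕ) : Prop :=
  ∃ n f, Symb.func n f ∈ S ∧ a = funcLetter (c (.func n f)) n ∧ vs.length = n ∧
    v = f fun k => asg vs k

/-- `a` is the letter of a predicate symbol of `S` that is true of the arguments `vs`. -/
def PredTrue (c : Symb → ℕ) (S : Set Symb) (a : ℕ) (vs : List ℕ) : Prop :=
  ∃ n hn A, Symb.pred n hn A ∈ S ∧ a = predLetter (c (.pred n hn A)) n ∧ vs.length = n ∧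
    (fun k : Fin n => asg vs k) ∈ A

/-- `a` is the letter of a predicate symbol of `S` of arity `n`. -/
def PredCode (c : Symb → ℕ) (S : Set Symb) (a n : ℕ) : Prop :=
  ∃ hn A, Symb.pred n hn A ∈ S ∧ a = predLetter (c (.pred n hn A)) n

/-- The rules that derive the pairs of a term and its value under the assignment `s`. -/
def ValStep (F : ℕ → List ℕ → ℕ → Prop) (s : List ℕ) (p : List ℕ × ℕ) (l : List (List ℕ × ℕ)) :
    Prop :=
  (∃ i, p.1 = [2 * i + 19] ∧ p.2 = asg s i) ∨
  ∃ a, p.1 = a :: 15 :: ((l.map Prod.fst).flatten ++ [17]) ∧ F a (l.map Prod.snd) p.2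

/-- The pair `p` consists of a term and its value under the assignment `s`. -/
def Val (F : ℕ → List ℕ → ℕ → Prop) (s : List ℕ) (p : List ℕ × ℕ) : Prop :=
  Derivable (ValStep F s) p

/-- The rules that derive the pairs `(σ, l)` of a formula `σ` for whose subformulas the relation `V`
satisfies the Tarski conditions, and a list `l` that contains its free variables. -/
def TarskiStep (pc : ℕ → ℕ → Prop) (pt : ℕ → List ℕ → Prop) (val : List ℕ → List ℕ × ℕ → Prop)
    (V : List ℕ → List ℕ → Prop) (p : List ℕ × List ℕ) (l : List (List ℕ × List ℕ)) : Prop :=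
  (∃ (a : ℕ) (ts : List (List ℕ)), p.1 = a :: 15 :: (ts.flatten ++ [17]) ∧ pc a ts.length ∧
    (∀ t, t ∈ ts → ∃ v, val [] (t, v)) ∧ (∀ i, 2 * i + 19 ∈ p.1 → i ∈ p.2) ∧
    ∀ s, V p.1 s ↔ ∃ tv : List (List ℕ × ℕ), tv.map Prod.fst = ts ∧
      (∀ q, q ∈ tv → val s q) ∧ pt a (tv.map Prod.snd)) ∨
  (∃ σ, l = [(σ, p.2)] ∧ p.1 = 5 :: 15 :: (σ ++ [17]) ∧ ∀ s, V p.1 s ↔ ¬ V σ s) ∨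
  (∃ (op : ℕ) (σ τ : List ℕ), l = [(σ, p.2), (τ, p.2)] ∧
    p.1 = 15 :: (σ ++ 17 :: op :: 15 :: (τ ++ [17])) ∧
    ((op = 1 ∧ ∀ s, V p.1 s ↔ (V σ s ∧ V τ s)) ∨ (op = 3 ∧ ∀ s, V p.1 s ↔ (V σ s ∨ V τ s)) ∨
      (op = 7 ∧ ∀ s, V p.1 s ↔ (V σ s → V τ s)) ∨ (op = 9 ∧ ∀ s, V p.1 s ↔ (V σ s ↔ V τ s)))) ∨
  ∃ (qu i : ℕ) (σ : List ℕ), l = [(σ, i :: p.2)] ∧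
    p.1 = qu :: (2 * i + 19) :: 15 :: (σ ++ [17]) ∧
    ((qu = 11 ∧ ∀ s, V p.1 s ↔ ∀ a, V σ (upd s i a)) ∨
      (qu = 13 ∧ ∀ s, V p.1 s ↔ ∃ a, V σ (upd s i a)))

/-- Truth of sentences, defined with the help of a predicate `G` that enumerates sets. -/
def TruthFrom (pc : ℕ → ℕ → Prop) (pt : ℕ → List ℕ → Prop) (val : List ℕ → List ℕ × ℕ → Prop)
    (G : ℕ → ℕ → Prop) (σ : List ℕ) : Prop :=
  ∃ e, Derivable (TarskiStep pc pt val fun τ s => G e (encode (τ, s))) (σ, []) ∧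
    G e (encode (σ, ([] : List ℕ)))

section
variable {S : Set Symb} {c : Symb → ℕ}

theorem val_iff {s : List ℕ} {p : List ℕ × ℕ} : Val (FunTrue c S) s p ↔
    ∃ t : Tm, t.In S ∧ p.1 = t.code c ∧ p.2 = t.val (asg s) := by
  constructor
  · intro h
    unfold Val at h
    induction h with
    | mk p l _ hs ih =>
      rcases hs with ⟨i, h1, h2⟩ | ⟨a, h1, n, f, hf, rfl, hn, hv⟩
      · exact ⟨.var i, trivial, h1, h2⟩
      · have hn' : l.length = n := by simpa using hn
        subst hn'
        choose ts h3 h4 h5 using fun k : Fin l.length => ih l[k] (List.getElem_mem _)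
        refine ⟨.app _ f ts, ⟨hf, h3⟩, ?_, ?_⟩
        · rw [h1, Tm.code_app]
          congr 4
          simp only [← h4]
          exact (List.ofFn_getElem_eq_map l Prod.fst).symm
        · rw [hv, Tm.val]
          congr 1
          ext k
          rw [← h5]
          simp [asg]
  · rintro ⟨t, ht, h⟩
    unfold Val
    induction t generalizing p with
    | var i => exact .mk p [] (by simp) (.inl ⟨i, h⟩)
    | app n f ts ih =>
      refine .mk p (List.ofFn fun k => ((ts k).code c, (ts k).val (asg s))) ?_
        (.inr ⟨_, ?_, n, f, ht.1, rfl, ?_, ?_⟩)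
      · intro y hy
        obtain ⟨k, rfl⟩ := (List.mem_ofFn' _ _).1 hy
        exact ih k (ht.2 k) ⟨rfl, rfl⟩
      · rw [h.1, Tm.code_app]
        simp [List.map_ofFn, Function.comp_def]
      · simp
      · rw [h.2, Tm.val]
        congr 1
        ext k
        simp [asg]

/-- By unique readability the list `tv` of terms and values is forced. -/
theorem exists_val_iff (hc : S.InjOn c) {n : ℕ} {ts : Fin n → Tm} (hts : ∀ k, (ts k).In S)
    {s : List ℕ} {Q : List ℕ → Prop} :
    (∃ tv : List (List ℕ × ℕ), tv.map Prod.fst = (List.ofFn fun k => (ts k).code c) ∧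
      (∀ q, q ∈ tv → Val (FunTrue c S) s q) ∧ Q (tv.map Prod.snd)) ↔
    Q (List.ofFn fun k => (ts k).val (asg s)) := by
  constructor
  · rintro ⟨tv, h1, h2, h3⟩
    convert h3 using 1
    have hl : tv.length = n := by simpa using congrArg List.length h1
    refine List.ext_getElem (by simp [hl]) fun i hi hi' => ?_
    have hi'' : i < tv.length := by simpa using hi'
    obtain ⟨t, ht, h4, h5⟩ := val_iff.1 (h2 tv[i] (List.getElem_mem _))
    have h6 : tv[i].1 = (ts ⟨i, hl ▸ hi''⟩).code c := by
      have := List.getElem_of_eq h1 (i := i) (by simpa using hi'')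
      simpa using this
    have h7 := Tm.code_inj hc (hts _) ht (h6.symm.trans h4)
    simp [h5, ← h7]
  · intro h
    refine ⟨List.ofFn fun k => ((ts k).code c, (ts k).val (asg s)), ?_, ?_, ?_⟩
    · simp [List.map_ofFn, Function.comp_def]
    · intro y hy
      obtain ⟨k, rfl⟩ := (List.mem_ofFn' _ _).1 hy
      exact val_iff.2 ⟨ts k, hts k, rfl, rfl⟩
    · simpa [List.map_ofFn, Function.comp_def] using h

theorem predTrue_iff (hc : S.InjOn c) {n : ℕ} {hn : 0 < n} {A : Set (Fin n → ℕ)}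
    (hA : Symb.pred n hn A ∈ S) {vs : List ℕ} :
    PredTrue c S (predLetter (c (.pred n hn A)) n) vs ↔
      vs.length = n ∧ (fun k : Fin n => asg vs k) ∈ A := by
  constructor
  · rintro ⟨n', hn', A', hA', h1, h2⟩
    have h3 := hc hA hA' (predLetter_inj.1 h1).1
    cases h3
    exact h2
  · exact fun h => ⟨n, hn, A, hA, rfl, h⟩

theorem atom_sat_iff (hc : S.InjOn c) {n : ℕ} {hn : 0 < n} {A : Set (Fin n → ℕ)} {ts : Fin n → Tm}
    (hφ : (Fml.atom n hn A ts).In S) {s : List ℕ} :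
    (∃ tv : List (List ℕ × ℕ), tv.map Prod.fst = (List.ofFn fun k => (ts k).code c) ∧
      (∀ q, q ∈ tv → Val (FunTrue c S) s q) ∧
      PredTrue c S (predLetter (c (.pred n hn A)) n) (tv.map Prod.snd)) ↔
    (Fml.atom n hn A ts).Sat (asg s) := by
  rw [exists_val_iff hc hφ.2 (Q := PredTrue c S (predLetter (c (.pred n hn A)) n)),
    predTrue_iff hc hφ.1]
  simp [Fml.Sat, asg]

theorem Fml.free_subset_cons {φ : Fml} {i : ℕ} {l : List ℕ} :
    φ.free \ {i} ⊆ {j | j ∈ l} ↔ φ.free ⊆ {j | j ∈ i :: l} := by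
  constructor
  · intro h j hj
    by_cases hji : j = i
    · simp [hji]
    · exact List.mem_cons_of_mem _ (h ⟨hj, hji⟩)
  · intro h j hj
    rcases List.mem_cons.1 (h hj.1) with h1 | h1
    · exact absurd h1 hj.2
    · exact h1

/-- Nothing is assumed about `V`. The derivation itself certifies that the string is a formula and
that `V` obeys the Tarski clauses at every subformula, and induction then forces `V` to be
satisfaction there. This is why universal predicates with undefinable sections cause no harm. -/
theorem derivable_tarskiStep_sound (hc : S.InjOn c) {V : List ℕ → List ℕ → Prop}
    {p : List ℕ × List ℕ}
    (h : Derivable (TarskiStep (PredCode c S) (PredTrue c S) (Val (FunTrue c S)) V) p) :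
    ∃ φ : Fml, φ.In S ∧ p.1 = φ.code c ∧ φ.free ⊆ {i | i ∈ p.2} ∧
      ∀ s, V p.1 s ↔ φ.Sat (asg s) := by
  induction h with
  | mk p l _ hs ih =>
    rcases p with ⟨ρ, fv⟩
    rcases hs with ⟨a, ts, h1, ⟨hn, A, hA, rfl⟩, h2, h3, h4⟩ | ⟨σ, rfl, h1, h2⟩ |
      ⟨op, σ, τ, rfl, h1, h2⟩ | ⟨qu, i, σ, rfl, h1, h2⟩
    · have h5 : ∀ k : Fin ts.length, ∃ t : Tm, t.In S ∧ ts[k] = t.code c := fun k => by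
        obtain ⟨v, hv⟩ := h2 ts[k] (List.getElem_mem _)
        obtain ⟨t, ht, h6, -⟩ := val_iff.1 hv
        exact ⟨t, ht, h6⟩
      choose tms h6 h7 using h5
      have h8 : ts = List.ofFn fun k => (tms k).code c := by
        simp only [← h7]
        exact List.ofFn_getElem.symm
      have h9 : ρ = (Fml.atom _ hn A tms).code c := by
        simp only at h1
        rw [h1, Fml.code_atom, ← h8]
      refine ⟨.atom _ hn A tms, ⟨hA, h6⟩, h9, fun i hi => h3 i ?_, fun s => (h4 s).trans ?_⟩
      · simp only
        rw [h9]
        exact Fml.var_mem_code_atom.2 hi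
      · rw [← atom_sat_iff hc ⟨hA, h6⟩, ← h8]
    · obtain ⟨φ, h3, h4, h5, h6⟩ := ih (σ, fv) (by simp)
      simp only at h4 h1 h6 h2
      subst h4
      exact ⟨φ.neg, h3, by rw [h1, Fml.code_neg], h5, fun s => (h2 s).trans (not_congr (h6 s))⟩
    · obtain ⟨φ, h3, h4, h5, h6⟩ := ih (σ, fv) (by simp)
      obtain ⟨ψ, h3', h4', h5', h6'⟩ := ih (τ, fv) (by simp)
      simp only at h4 h4' h1 h6 h6' h2
      subst h4
      subst h4'
      rcases h2 with ⟨rfl, h2⟩ | ⟨rfl, h2⟩ | ⟨rfl, h2⟩ | ⟨rfl, h2⟩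
      · exact ⟨φ.and ψ, ⟨h3, h3'⟩, by rw [h1, Fml.code_and], Set.union_subset h5 h5',
          fun s => (h2 s).trans (and_congr (h6 s) (h6' s))⟩
      · exact ⟨φ.or ψ, ⟨h3, h3'⟩, by rw [h1, Fml.code_or], Set.union_subset h5 h5',
          fun s => (h2 s).trans (or_congr (h6 s) (h6' s))⟩
      · exact ⟨φ.imp ψ, ⟨h3, h3'⟩, by rw [h1, Fml.code_imp], Set.union_subset h5 h5',
          fun s => (h2 s).trans (imp_congr (h6 s) (h6' s))⟩
      · exact ⟨φ.iff ψ, ⟨h3, h3'⟩, by rw [h1, Fml.code_iff], Set.union_subset h5 h5',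
          fun s => (h2 s).trans (iff_congr (h6 s) (h6' s))⟩
    · obtain ⟨φ, h3, h4, h5, h6⟩ := ih (σ, i :: fv) (by simp)
      simp only at h4 h1 h6 h2
      subst h4
      rcases h2 with ⟨rfl, h2⟩ | ⟨rfl, h2⟩
      · refine ⟨.all i φ, h3, by rw [h1, Fml.code_all], Fml.free_subset_cons.2 h5,
          fun s => (h2 s).trans (forall_congr' fun a => ?_)⟩
        rw [h6, asg_upd]
      · refine ⟨.ex i φ, h3, by rw [h1, Fml.code_ex], Fml.free_subset_cons.2 h5,
          fun s => (h2 s).trans (exists_congr fun a => ?_)⟩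
        rw [h6, asg_upd]

/-- The list of the subformulas of a formula. -/
def Fml.subs : Fml → List Fml
  | .atom n hn A ts => [.atom n hn A ts]
  | .neg φ => .neg φ :: φ.subs
  | .and φ ψ => .and φ ψ :: (φ.subs ++ ψ.subs)
  | .or φ ψ => .or φ ψ :: (φ.subs ++ ψ.subs)
  | .imp φ ψ => .imp φ ψ :: (φ.subs ++ ψ.subs)
  | .iff φ ψ => .iff φ ψ :: (φ.subs ++ ψ.subs)
  | .all i φ => .all i φ :: φ.subs
  | .ex i φ => .ex i φ :: φ.subs

theorem Fml.self_mem_subs (φ : Fml) : φ ∈ φ.subs := by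
  cases φ <;> simp [Fml.subs]

theorem Fml.in_of_mem_subs {φ ψ : Fml} (hφ : φ.In S) (h : ψ ∈ φ.subs) : ψ.In S := by
  induction φ with
  | atom n hn A ts =>
    rw [Fml.subs, List.mem_singleton] at h
    exact h ▸ hφ
  | neg φ ih | all i φ ih | ex i φ ih =>
    rcases List.mem_cons.1 h with rfl | h
    · exact hφ
    · exact ih hφ h
  | and φ χ ih ih' | or φ χ ih ih' | imp φ χ ih ih' | iff φ χ ih ih' =>
    rcases List.mem_cons.1 h with rfl | h
    · exact hφ
    · rcases List.mem_append.1 h with h | h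
      · exact ih hφ.1 h
      · exact ih' hφ.2 h

theorem derivable_tarskiStep_complete (hc : S.InjOn c) {V : List ℕ → List ℕ → Prop} {φ : Fml}
    (hφ : φ.In S) (hV : ∀ ψ ∈ φ.subs, ∀ s, V (ψ.code c) s ↔ ψ.Sat (asg s)) {l : List ℕ}
    (hl : φ.free ⊆ {i | i ∈ l}) :
    Derivable (TarskiStep (PredCode c S) (PredTrue c S) (Val (FunTrue c S)) V) (φ.code c, l) := by
  have h0 := hV φ φ.self_mem_subs
  induction φ generalizing l with
  | atom n hn A ts =>
    refine .mk _ [] (by simp) (.inl ⟨_, List.ofFn fun k => (ts k).code c, Fml.code_atom .., ?_, ?_,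
      fun i hi => hl (Fml.var_mem_code_atom.1 hi), fun s => (h0 s).trans (atom_sat_iff hc hφ).symm⟩)
    · rw [List.length_ofFn]
      exact ⟨hn, A, hφ.1, rfl⟩
    · intro t ht
      obtain ⟨k, rfl⟩ := (List.mem_ofFn' _ _).1 ht
      exact ⟨_, val_iff.2 ⟨ts k, hφ.2 k, rfl, rfl⟩⟩
  | neg φ ih =>
    have h1 : ∀ ψ ∈ φ.subs, ∀ s, V (ψ.code c) s ↔ ψ.Sat (asg s) := fun ψ hψ =>
      hV ψ (List.mem_cons_of_mem _ hψ)
    have h2 := h1 φ φ.self_mem_subs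
    refine .mk _ [(φ.code c, l)] ?_ (.inr (.inl ⟨_, rfl, Fml.code_neg .., fun s => ?_⟩))
    · simpa using ih hφ h1 hl h2
    · rw [h0, h2, Fml.Sat]
  | and φ ψ ih ih' | or φ ψ ih ih' | imp φ ψ ih ih' | iff φ ψ ih ih' =>
    have h1 : ∀ χ ∈ φ.subs, ∀ s, V (χ.code c) s ↔ χ.Sat (asg s) := fun χ hχ =>
      hV χ (List.mem_cons_of_mem _ (List.mem_append_left _ hχ))
    have h1' : ∀ χ ∈ ψ.subs, ∀ s, V (χ.code c) s ↔ χ.Sat (asg s) := fun χ hχ =>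
      hV χ (List.mem_cons_of_mem _ (List.mem_append_right _ hχ))
    have h2 := h1 φ φ.self_mem_subs
    have h2' := h1' ψ ψ.self_mem_subs
    have h3 := ih hφ.1 h1 (Set.subset_union_left.trans hl) h2
    have h3' := ih' hφ.2 h1' (Set.subset_union_right.trans hl) h2'
    refine .mk _ [(φ.code c, l), (ψ.code c, l)] (by simpa using ⟨h3, h3'⟩)
      (.inr (.inr (.inl ?_)))
    first
    | exact ⟨1, _, _, rfl, Fml.code_and .., by simp [h0, h2, h2', Fml.Sat]⟩
    | exact ⟨3, _, _, rfl, Fml.code_or .., by simp [h0, h2, h2', Fml.Sat]⟩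
    | exact ⟨7, _, _, rfl, Fml.code_imp .., by simp [h0, h2, h2', Fml.Sat]⟩
    | exact ⟨9, _, _, rfl, Fml.code_iff .., by simp [h0, h2, h2', Fml.Sat]⟩
  | all i φ ih | ex i φ ih =>
    have h1 : ∀ ψ ∈ φ.subs, ∀ s, V (ψ.code c) s ↔ ψ.Sat (asg s) := fun ψ hψ =>
      hV ψ (List.mem_cons_of_mem _ hψ)
    have h2 := h1 φ φ.self_mem_subs
    have h3 := ih hφ h1 (Fml.free_subset_cons.1 hl) h2
    refine .mk _ [(φ.code c, i :: l)] (by simpa using h3) (.inr (.inr (.inr ?_)))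
    first
    | exact ⟨11, i, _, rfl, Fml.code_all .., by simp [h0, h2, Fml.Sat, asg_upd]⟩
    | exact ⟨13, i, _, rfl, Fml.code_ex .., by simp [h0, h2, Fml.Sat, asg_upd]⟩

theorem IsUniversal.exists_index {S' : Set Symb} {G : ℕ → ℕ → Prop} (hG : IsUniversal S' G)
    {α : Type*} [Primcodable α] [Fact (arith ⊆ S')] {P : α → Prop} (hP : Dfn S' P) :
    ∃ e, ∀ a, G e (encode a) ↔ P a := by
  have h1 : Definable₁ S' {n | ∃ a ∈ (decode n : Option α), P a} := definable₁_iff_defS.2 hP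
  obtain ⟨e, he⟩ := hG _ h1
  refine ⟨e, fun a => ?_⟩
  have : encode a ∈ {x | G e x} ↔ ∃ b ∈ (decode (encode a) : Option α), P b := by
    rw [← he]; rfl
  simpa using this

/-- Universality serves only to find the index: satisfaction on the subformulas of one sentence is a
finite disjunction, hence definable in `S'`. Since `S'` may be richer than `S`, one `G` can be used
for all earlier stages. -/
theorem truthFrom_iff (hc : S.InjOn c) {S' : Set Symb} [Fact (arith ⊆ S')]
    (hSS' : Interp S S') {G : ℕ → ℕ → Prop} (hG : IsUniversal S' G) {σ : List ℕ} :
    TruthFrom (PredCode c S) (PredTrue c S) (Val (FunTrue c S)) G σ ↔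
      encode σ ∈ truthSet S c := by
  constructor
  · rintro ⟨e, h1, h2⟩
    obtain ⟨φ, h3, h4, h5, h6⟩ := derivable_tarskiStep_sound hc h1
    have h7 : φ.free = ∅ := by simpa using h5
    refine ⟨φ, h3, h7, fun s => ?_, by simp only at h4; rw [h4, Fml.godel_eq]⟩
    exact (Fml.sat_congr (by simp [h7])).1 ((h6 []).1 h2)
  · rintro ⟨φ, h1, h2, h3, h4⟩
    rw [Fml.godel_eq, encode_inj] at h4
    subst h4
    have hD : Dfn S' fun q : List ℕ × List ℕ =>
        ∃ i : Fin φ.subs.length, q.1 = (φ.subs[i]).code c ∧ (φ.subs[i]).Sat (asg q.2) := by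
      refine Dfn.exists_fintype fun i => Dfn.and (by fun_prop) ?_
      exact (Fml.dfn_sat hSS' φ.subs[i] (Fml.in_of_mem_subs h1 (List.getElem_mem _))).comp
        (f := fun q : List ℕ × List ℕ => q.2) (by fun_prop)
    obtain ⟨e, he⟩ := hG.exists_index hD
    have he' : ∀ ψ ∈ φ.subs, ∀ s, G e (encode (ψ.code c, s)) ↔ ψ.Sat (asg s) := by
      intro ψ hψ s
      rw [he]
      constructor
      · rintro ⟨i, h5, h6⟩
        rwa [Fml.code_inj hc (Fml.in_of_mem_subs h1 hψ)
          (Fml.in_of_mem_subs h1 (List.getElem_mem _)) h5]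
      · intro h
        obtain ⟨i, hi, rfl⟩ := List.getElem_of_mem hψ
        exact ⟨⟨i, hi⟩, rfl, h⟩
    exact ⟨e, derivable_tarskiStep_complete hc h1 he' (by simp [h2]),
      (he' φ φ.self_mem_subs []).2 (h3 _)⟩

end

/-! ### Definability of truth -/

section
variable {α β γ : Type*} [Primcodable α] [Primcodable β] [Primcodable γ]

@[fun_prop]
theorem Primrec.map_fst_comp {f : α → List (β × γ)} (hf : Primrec f) :
    Primrec fun a => (f a).map Prod.fst :=
  Primrec.list_map hf (Primrec.fst.comp Primrec.snd)

@[fun_prop]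
theorem Primrec.map_snd_comp {f : α → List (β × γ)} (hf : Primrec f) :
    Primrec fun a => (f a).map Prod.snd :=
  Primrec.list_map hf (Primrec.snd.comp Primrec.snd)

@[fun_prop]
theorem Primrec.predLetter_comp {f g : α → ℕ} (hf : Primrec f) (hg : Primrec g) :
    Primrec fun a => predLetter (f a) (g a) := by
  unfold predLetter
  fun_prop

end

section
variable {M : Set Symb} [hM : Fact (arith ⊆ M)] {γ : Type} [Primcodable γ]

theorem Dfn.val {F : ℕ → List ℕ → ℕ → Prop}
    (hF : Dfn M fun q : ℕ × List ℕ × ℕ => F q.1 q.2.1 q.2.2) :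
    Dfn M fun q : List ℕ × (List ℕ × ℕ) => Val F q.1 q.2 := by
  unfold Val
  refine Dfn.derivable ?_
  unfold ValStep
  fun_prop

theorem Dfn.tarskiStep {pc : γ → ℕ → ℕ → Prop} {pt : γ → ℕ → List ℕ → Prop}
    {val : List ℕ → List ℕ × ℕ → Prop} {V : γ → List ℕ → List ℕ → Prop}
    (hpc : Dfn M fun q : γ × ℕ × ℕ => pc q.1 q.2.1 q.2.2)
    (hpt : Dfn M fun q : γ × ℕ × List ℕ => pt q.1 q.2.1 q.2.2)
    (hval : Dfn M fun q : List ℕ × (List ℕ × ℕ) => val q.1 q.2)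
    (hV : Dfn M fun q : γ × List ℕ × List ℕ => V q.1 q.2.1 q.2.2) :
    Dfn M fun q : γ × (List ℕ × List ℕ) × List (List ℕ × List ℕ) =>
      TarskiStep (pc q.1) (pt q.1) val (V q.1) q.2.1 q.2.2 := by
  have hpc' : ∀ {δ : Type} [Primcodable δ] {f : δ → γ} {g h : δ → ℕ}, Primrec f → Primrec g →
      Primrec h → Dfn M fun d => pc (f d) (g d) (h d) :=
    fun hf hg hh => hpc.comp (hf.pair (hg.pair hh))
  have hpt' : ∀ {δ : Type} [Primcodable δ] {f : δ → γ} {g : δ → ℕ} {h : δ → List ℕ}, Primrec f →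
      Primrec g → Primrec h → Dfn M fun d => pt (f d) (g d) (h d) :=
    fun hf hg hh => hpt.comp (hf.pair (hg.pair hh))
  have hV' : ∀ {δ : Type} [Primcodable δ] {f : δ → γ} {g h : δ → List ℕ}, Primrec f →
      Primrec g → Primrec h → Dfn M fun d => V (f d) (g d) (h d) :=
    fun hf hg hh => hV.comp (hf.pair (hg.pair hh))
  clear hpc hpt hV
  unfold TarskiStep
  refine .or ?_ (.or ?_ (.or ?_ ?_))
  · refine .ex (.ex (.and ?_ (.and (hpc' ?_ ?_ ?_) (.and ?_ (.and ?_ (.all (.iff (hV' ?_ ?_ ?_)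
      (.ex (.and (.eq (.map_fst_comp ?_) ?_) (.and ?_ (hpt' ?_ ?_ ?_)))))))))))
    all_goals fun_prop
  · refine .ex (.and ?_ (.and ?_ (.all (.iff (hV' ?_ ?_ ?_) (.not (hV' ?_ ?_ ?_))))))
    all_goals fun_prop
  · refine .ex (.ex (.ex (.and ?_ (.and ?_ (.or (.and ?_ (.all (.iff (hV' ?_ ?_ ?_)
      (.and (hV' ?_ ?_ ?_) (hV' ?_ ?_ ?_))))) (.or (.and ?_ (.all (.iff (hV' ?_ ?_ ?_)
      (.or (hV' ?_ ?_ ?_) (hV' ?_ ?_ ?_))))) (.or (.and ?_ (.all (.iff (hV' ?_ ?_ ?_)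
      (.imp (hV' ?_ ?_ ?_) (hV' ?_ ?_ ?_))))) (.and ?_ (.all (.iff (hV' ?_ ?_ ?_)
      (.iff (hV' ?_ ?_ ?_) (hV' ?_ ?_ ?_))))))))))))
    all_goals fun_prop
  · refine .ex (.ex (.ex (.and ?_ (.and ?_ (.or (.and ?_ (.all (.iff (hV' ?_ ?_ ?_)
      (.all (hV' ?_ ?_ ?_))))) (.and ?_ (.all (.iff (hV' ?_ ?_ ?_)
      (.ex (hV' ?_ ?_ ?_))))))))))
    all_goals fun_prop

theorem Dfn.truthFrom {pc : γ → ℕ → ℕ → Prop} {pt : γ → ℕ → List ℕ → Prop}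
    {val : List ℕ → List ℕ × ℕ → Prop} {G : ℕ → ℕ → Prop}
    (hpc : Dfn M fun q : γ × ℕ × ℕ => pc q.1 q.2.1 q.2.2)
    (hpt : Dfn M fun q : γ × ℕ × List ℕ => pt q.1 q.2.1 q.2.2)
    (hval : Dfn M fun q : List ℕ × (List ℕ × ℕ) => val q.1 q.2)
    (hG : Dfn M fun q : ℕ × ℕ => G q.1 q.2) :
    Dfn M fun q : γ × List ℕ => TruthFrom (pc q.1) (pt q.1) val G q.2 := by
  have h := Dfn.derivable (β := γ × ℕ) (α := List ℕ × List ℕ)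
    (Step := fun g => TarskiStep (pc g.1) (pt g.1) val fun τ s => G g.2 (encode (τ, s)))
    (Dfn.tarskiStep (γ := γ × ℕ) (pc := fun g => pc g.1)
    (pt := fun g => pt g.1) (V := fun g τ s => G g.2 (encode (τ, s)))
    (hpc.comp (f := fun q : (γ × ℕ) × ℕ × ℕ => (q.1.1, q.2)) (by fun_prop))
    (hpt.comp (f := fun q : (γ × ℕ) × ℕ × List ℕ => (q.1.1, q.2)) (by fun_prop)) hval
    (hG.comp (f := fun q : (γ × ℕ) × List ℕ × List ℕ => (q.1.2, encode q.2)) (by fun_prop)))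
  have h' := h.comp (f := fun q : (γ × List ℕ) × ℕ => ((q.1.1, q.2), (q.1.2, ([] : List ℕ))))
    (by fun_prop)
  exact Dfn.ex (h'.and (hG.comp
    (f := fun q : (γ × List ℕ) × ℕ => (q.2, encode (q.1.2, ([] : List ℕ)))) (by fun_prop)))

end

section
variable {N : Set Symb} [hN : Fact (arith ⊆ N)] {c : Symb → ℕ}

/-- Finiteness of the structure enters here and in the next two lemmas: the condition is a finite
disjunction over its symbols, each of which is definable in `N`. -/
theorem Dfn.funTrue (hfin : N.Finite) :
    Dfn N fun q : ℕ × List ℕ × ℕ => FunTrue c N q.1 q.2.1 q.2.2 := by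
  have := hfin.to_subtype
  have h : ∀ s : N, Dfn N fun q : ℕ × List ℕ × ℕ => ∃ n f, s.1 = Symb.func n f ∧
      q.1 = funcLetter (c (.func n f)) n ∧ q.2.1.length = n ∧
      q.2.2 = f fun k => asg q.2.1 k := by
    rintro ⟨s | ⟨n, f⟩, hs⟩
    · simpa using Dfn.const False
    · have hf : Dfn N fun q : ℕ × List ℕ × ℕ =>
          asg (q.2.2 :: q.2.1) 0 = f fun k : Fin n => asg (q.2.2 :: q.2.1) (k + 1) :=
        Dfn.comp (P := fun l => asg l 0 = f fun k : Fin n => asg l (k + 1))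
          (SymbDfn.of_mem hN.out hs) (f := fun q : ℕ × List ℕ × ℕ => q.2.2 :: q.2.1) (by fun_prop)
      have : Dfn N fun q : ℕ × List ℕ × ℕ => q.1 = funcLetter (c (.func n f)) n ∧
          q.2.1.length = n := by fun_prop
      refine (this.and hf).congr fun q => ?_
      simp only [Symb.func.injEq]
      constructor
      · rintro ⟨⟨h1, h2⟩, h3⟩
        exact ⟨n, f, ⟨rfl, HEq.rfl⟩, h1, h2, h3⟩
      · rintro ⟨_, _, ⟨rfl, ⟨⟩⟩, h1, h2, h3⟩
        exact ⟨⟨h1, h2⟩, h3⟩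
  refine (Dfn.exists_fintype h).congr fun q => ?_
  constructor
  · rintro ⟨⟨s, hs⟩, n, f, rfl, h⟩
    exact ⟨n, f, hs, h⟩
  · rintro ⟨n, f, hs, h⟩
    exact ⟨⟨_, hs⟩, n, f, rfl, h⟩

theorem Dfn.predTrue (hfin : N.Finite) :
    Dfn N fun q : ℕ × List ℕ => PredTrue c N q.1 q.2 := by
  have := hfin.to_subtype
  have h : ∀ s : N, Dfn N fun q : ℕ × List ℕ => ∃ n hn A, s.1 = Symb.pred n hn A ∧
      q.1 = predLetter (c (.pred n hn A)) n ∧ q.2.length = n ∧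
      (fun k : Fin n => asg q.2 k) ∈ A := by
    rintro ⟨⟨n, hn, A⟩ | s, hs⟩
    · have hf : Dfn N fun q : ℕ × List ℕ => (fun k : Fin n => asg q.2 k) ∈ A :=
        Dfn.comp (P := fun l => (fun k : Fin n => asg l k) ∈ A)
          (SymbDfn.of_mem hN.out hs) (f := fun q : ℕ × List ℕ => q.2) (by fun_prop)
      have : Dfn N fun q : ℕ × List ℕ => q.1 = predLetter (c (.pred n hn A)) n ∧
          q.2.length = n := by fun_prop
      refine (this.and hf).congr fun q => ?_
      simp only [Symb.pred.injEq]
      constructor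
      · rintro ⟨⟨h1, h2⟩, h3⟩
        exact ⟨n, hn, A, ⟨rfl, HEq.rfl⟩, h1, h2, h3⟩
      · rintro ⟨_, _, _, ⟨rfl, ⟨⟩⟩, h1, h2, h3⟩
        exact ⟨⟨h1, h2⟩, h3⟩
    · simpa using Dfn.const False
  refine (Dfn.exists_fintype h).congr fun q => ?_
  constructor
  · rintro ⟨⟨s, hs⟩, n, hn, A, rfl, h⟩
    exact ⟨n, hn, A, hs, h⟩
  · rintro ⟨n, hn, A, hs, h⟩
    exact ⟨⟨_, hs⟩, n, hn, A, rfl, h⟩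

theorem Dfn.predCode (hfin : N.Finite) :
    Dfn N fun q : ℕ × ℕ => PredCode c N q.1 q.2 := by
  have := hfin.to_subtype
  have h : ∀ s : N, Dfn N fun q : ℕ × ℕ => ∃ n hn A, s.1 = Symb.pred n hn A ∧
      q.1 = predLetter (c (.pred n hn A)) n ∧ q.2 = n := by
    rintro ⟨⟨n, hn, A⟩ | s, hs⟩
    · have : Dfn N fun q : ℕ × ℕ => q.1 = predLetter (c (.pred n hn A)) n ∧ q.2 = n := by fun_prop
      refine this.congr fun q => ?_
      simp only [Symb.pred.injEq]
      constructor
      · rintro ⟨h1, h2⟩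
        exact ⟨n, hn, A, ⟨rfl, HEq.rfl⟩, h1, h2⟩
      · rintro ⟨_, _, _, ⟨rfl, ⟨⟩⟩, h1, h2⟩
        exact ⟨h1, h2⟩
    · simpa using Dfn.const False
  refine (Dfn.exists_fintype h).congr fun q => ?_
  rcases q with ⟨a, k⟩
  constructor
  · rintro ⟨⟨s, hs⟩, n, hn, A, rfl, h, rfl⟩
    exact ⟨hn, A, hs, h⟩
  · rintro ⟨hn, A, hs, h⟩
    exact ⟨⟨_, hs⟩, k, hn, A, rfl, h, rfl⟩

end

/-! ### Numerals and the substitution of numerals -/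

/-- The term `S ( … S ( x_1 ) … )` with `a` letters `S`. -/
def numTm : ℕ → Tm
  | 0 => .var 1
  | a + 1 => .app 1 (fun v => v 0 + 1) fun _ => numTm a

/-- A formula that says that `x_0 = a`. -/
def numFml (a : ℕ) : Fml :=
  .ex 1 (.and (.neg (.ex 2 (.atom 2 Nat.two_pos {v | v 0 < v 1} ![.var 2, .var 1])))
    (.atom 2 Nat.two_pos {v | v 0 = v 1} ![.var 0, numTm a]))

/-- A formula that says that `φ` is true of the numeral `a`. -/
def subFml (φ : Fml) (a : ℕ) : Fml := .ex 0 (.and (numFml a) φ)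

theorem numTm_val (a : ℕ) (s : ℕ → ℕ) : (numTm a).val s = s 1 + a := by
  induction a with
  | zero => rfl
  | succ a ih => simp [numTm, Tm.val, ih, add_assoc]

theorem numTm_vars (a : ℕ) : (numTm a).vars = {1} := by
  induction a with
  | zero => rfl
  | succ a ih => simp [numTm, Tm.vars, ih]

/-- Arithmetic has no constant for zero, so `x_1` is bound to the number with nothing below it and
the successors are counted from there. -/
theorem numFml_sat (a : ℕ) (s : ℕ → ℕ) : (numFml a).Sat s ↔ s 0 = a := by
  simp only [numFml, Fml.Sat]
  simp only [Set.mem_ofPred_eq, Matrix.cons_val_zero, Matrix.cons_val_one, Tm.val, numTm_val]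
  simp only [Function.update_self, ne_eq, zero_ne_one, not_false_eq_true, Function.update_of_ne,
    OfNat.one_ne_ofNat]
  constructor
  · rintro ⟨b, h1, h2⟩
    have : b = 0 := by
      by_contra h
      exact h1 ⟨0, Nat.pos_of_ne_zero h⟩
    omega
  · intro h
    exact ⟨0, by simp, by omega⟩

theorem numFml_free (a : ℕ) : (numFml a).free = {0} := by
  ext i
  simp only [numFml, Fml.free, Set.mem_sdiff, Set.mem_union, Set.mem_iUnion, Set.mem_singleton_iff]
  constructor
  · rintro ⟨⟨⟨k, hk⟩, h2⟩ | ⟨k, hk⟩, h1⟩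
    · fin_cases k <;> simp_all [Tm.vars]
    · fin_cases k <;> simp_all [Tm.vars, numTm_vars]
  · rintro rfl
    exact ⟨Or.inr ⟨0, by simp [Tm.vars]⟩, by simp⟩

theorem subFml_sat (φ : Fml) (a : ℕ) (s : ℕ → ℕ) :
    (subFml φ a).Sat s ↔ φ.Sat (Function.update s 0 a) := by
  simp [subFml, Fml.Sat, numFml_sat]

theorem subFml_free {φ : Fml} {a : ℕ} : (subFml φ a).free = ∅ ↔ φ.free ⊆ {0} := by
  simp [subFml, Fml.free, numFml_free, Set.sdiff_eq_empty]

theorem numTm_in {S : Set Symb} (hS : arith ⊆ S) (a : ℕ) : (numTm a).In S := by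
  induction a with
  | zero => trivial
  | succ a ih => exact ⟨hS (by simp [arith]), fun _ => ih⟩

theorem numFml_in {S : Set Symb} (hS : arith ⊆ S) (a : ℕ) : (numFml a).In S := by
  refine ⟨⟨hS (by simp [arith, pred₂]), fun k => ?_⟩, hS (by simp [arith, pred₂]), fun k => ?_⟩
  · fin_cases k <;> trivial
  · fin_cases k
    · trivial
    · exact numTm_in hS a

/-- The string of `subFml φ a`, computed from the string `σ` of `φ`. -/
def subStr (c : Symb → ℕ) (σ : List ℕ) (a : ℕ) : List ℕ :=
  13 :: 19 :: 15 :: (15 :: ((numFml a).code c ++ 17 :: 1 :: 15 :: (σ ++ [17])) ++ [17])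

theorem subFml_code (c : Symb → ℕ) (φ : Fml) (a : ℕ) :
    (subFml φ a).code c = subStr c (φ.code c) a := by
  simp [subFml, Fml.code_ex, Fml.code_and, subStr]

theorem Primrec.numTm_code (c : Symb → ℕ) : Primrec fun a => (numTm a).code c := by
  let f : ℕ → List ℕ → List ℕ := fun _ l =>
    funcLetter (c (.func 1 fun v => v 0 + 1)) 1 :: 15 :: (l ++ [17])
  have hf : Primrec₂ f := by
    unfold Primrec₂
    fun_prop
  -- `21 = 2 * 1 + 19` is the letter of the variable `x_1`.
  refine (Primrec.nat_rec₁ (f := f) [21] hf).of_eq fun a => ?_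
  induction a with
  | zero => rfl
  | succ a ih => simp [numTm, Tm.code_app, ← ih, f]

@[fun_prop]
theorem Primrec.subStr_comp {α : Type*} [Primcodable α] {c : Symb → ℕ} {f : α → List ℕ}
    {g : α → ℕ} (hf : Primrec f) (hg : Primrec g) : Primrec fun a => subStr c (f a) (g a) := by
  have h1 : Primrec fun a => (numFml a).code c := by
    have := Primrec.numTm_code c
    simp only [numFml, Fml.code_ex, Fml.code_and, Fml.code_neg, Fml.code_atom, List.ofFn_succ,
      List.ofFn_zero, Matrix.cons_val_zero, Matrix.cons_val_succ, List.flatten_cons,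
      List.flatten_nil, Tm.code_var, Fin.isValue]
    fun_prop
  have h2 : Primrec fun a => (numFml (g a)).code c := h1.comp hg
  unfold subStr
  fun_prop

/-- The binary predicate that is enumerated by a truth predicate `X`. -/
def truthEnum (c : Symb → ℕ) (X : ℕ → Prop) (e x : ℕ) : Prop :=
  ∃ σ : List ℕ, encode σ = e ∧ X (encode (subStr c σ x))

theorem Dfn.truthEnum {M : Set Symb} [Fact (arith ⊆ M)] {c : Symb → ℕ} {X : ℕ → Prop}
    (hX : Dfn M X) : Dfn M fun p : ℕ × ℕ => truthEnum c X p.1 p.2 := by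
  unfold UniversalPredicates.truthEnum
  fun_prop

/-- Cantor's diagonal argument. -/
theorem IsUniversal.not_dfn {M : Set Symb} [Fact (arith ⊆ M)] {G : ℕ → ℕ → Prop}
    (hG : IsUniversal M G) : ¬ Dfn M fun p : ℕ × ℕ => G p.1 p.2 := by
  intro h
  have : Dfn M fun x : ℕ => ¬ G x x := (h.comp (f := fun x : ℕ => (x, x)) (by fun_prop)).not
  obtain ⟨n, hn⟩ := hG {x | ¬ G x x} (definable₁_iff_dfn.2 this)
  have := Set.ext_iff.1 hn n
  simp at this

section
variable {S : Set Symb} {d c : Symb → ℕ}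

theorem truthSet_godel_iff (hd : S.InjOn d) {φ : Fml} (hφ : φ.In S) (hf : φ.free = ∅) :
    encode (φ.code d) ∈ truthSet S d ↔ ∀ s, φ.Sat s := by
  constructor
  · rintro ⟨ψ, h1, h2, h3, h4⟩
    rw [Fml.godel_eq, encode_inj] at h4
    rwa [Fml.code_inj hd hφ h1 h4]
  · exact fun h => ⟨φ, hφ, hf, h, rfl⟩

theorem numFml_code_congr (h : ∀ s ∈ arith, d s = c s) (a : ℕ) :
    (numFml a).code d = (numFml a).code c := by
  have h1 : ∀ a, (numTm a).code d = (numTm a).code c := by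
    intro a
    induction a with
    | zero => rfl
    | succ a ih => simp [numTm, Tm.code_app, ih,
      h (.func 1 fun v => v 0 + 1) (by simp [arith])]
  have h2 : ∀ A, Symb.pred 2 Nat.two_pos A ∈ arith →
      d (.pred 2 Nat.two_pos A) = c (.pred 2 Nat.two_pos A) := fun A hA => h _ hA
  simp [numFml, Fml.code_ex, Fml.code_and, Fml.code_neg, Fml.code_atom, h1, Tm.code_var,
    h2 {v | v 0 < v 1} (by simp [arith, pred₂]), h2 {v | v 0 = v 1} (by simp [arith, pred₂])]

theorem Fml.eq_ex_of_code {θ : Fml} {i : ℕ} {w : List ℕ}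
    (h : θ.code d = 13 :: (2 * i + 19) :: 15 :: (w ++ [17])) : ∃ ψ, θ = .ex i ψ ∧ ψ.code d = w := by
  rcases θ with ⟨n, hn, A, ts⟩ | ψ | ⟨ψ, χ⟩ | ⟨ψ, χ⟩ | ⟨ψ, χ⟩ | ⟨ψ, χ⟩ | ⟨j, ψ⟩ | ⟨j, ψ⟩
  case ex =>
    rw [Fml.code_ex] at h
    simp only [List.cons.injEq, true_and, List.append_cancel_right_eq] at h
    exact ⟨ψ, by rw [show j = i by omega], h.2⟩
  case atom =>
    have h0 := even_predLetter (d (.pred n hn A)) n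
    rw [Fml.code_atom, List.cons.injEq] at h
    rw [h.1] at h0
    exact absurd h0 (by decide)
  all_goals
    simp [Fml.code_neg, Fml.code_and, Fml.code_or, Fml.code_imp, Fml.code_iff, Fml.code_all] at h

theorem Fml.eq_and_of_code (hd : S.InjOn d) {θ φ : Fml} (hθ : θ.In S) (hφ : φ.In S) {w : List ℕ}
    (h : θ.code d = 15 :: (φ.code d ++ 17 :: 1 :: 15 :: (w ++ [17]))) :
    ∃ ψ, θ = .and φ ψ ∧ ψ.code d = w := by
  rcases θ with ⟨n, hn, A, ts⟩ | ψ | ⟨ψ, χ⟩ | ⟨ψ, χ⟩ | ⟨ψ, χ⟩ | ⟨ψ, χ⟩ | ⟨j, ψ⟩ | ⟨j, ψ⟩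
  case atom =>
    have h0 := even_predLetter (d (.pred n hn A)) n
    rw [Fml.code_atom, List.cons.injEq] at h
    rw [h.1] at h0
    exact absurd h0 (by decide)
  case neg | all | ex => simp [Fml.code_neg, Fml.code_all, Fml.code_ex] at h
  all_goals
    simp only [Fml.code_and, Fml.code_or, Fml.code_imp, Fml.code_iff, List.cons.injEq,
      true_and] at h
    obtain ⟨rfl, h1⟩ := Fml.code_append_inj hd hθ.1 hφ h
    simp at h1
  exact ⟨χ, rfl, h1⟩

variable [hS : Fact (arith ⊆ S)]

/-- Numerals contain only arithmetical symbols, on which `d` agrees with `c`. Hence one substitution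
function, computed with `c`, serves all stages. -/
theorem truthEnum_code_iff (hd : S.InjOn d) (h : ∀ s ∈ arith, d s = c s) {φ : Fml} (hφ : φ.In S)
    (hf : φ.free ⊆ {0}) (x : ℕ) :
    truthEnum c (· ∈ truthSet S d) (encode (φ.code d)) x ↔ φ.Sat (asg [x]) := by
  have h1 : subStr c (φ.code d) x = (subFml φ x).code d := by
    rw [subFml_code, subStr, subStr, numFml_code_congr h]
  have h2 : truthEnum c (· ∈ truthSet S d) (encode (φ.code d)) x ↔
      encode ((subFml φ x).code d) ∈ truthSet S d := by
    rw [← h1]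
    constructor
    · rintro ⟨σ, h3, h4⟩
      rw [encode_inj] at h3
      rwa [← h3]
    · exact fun h => ⟨_, rfl, h⟩
  have h4 : (subFml φ x).In S := ⟨numFml_in hS.out x, hφ⟩
  rw [h2, truthSet_godel_iff hd h4 (subFml_free.2 hf)]
  have h3 : ∀ s, (subFml φ x).Sat s ↔ φ.Sat (asg [x]) := fun s => by
    rw [subFml_sat]
    refine Fml.sat_congr fun i hi => ?_
    rw [hf hi]
    simp [asg]
  simp [h3]

theorem isUniversal_truthEnum (hd : S.InjOn d) (h : ∀ s ∈ arith, d s = c s) :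
    IsUniversal S (truthEnum c (· ∈ truthSet S d)) := by
  rintro X ⟨φ, hφ, hf, hX⟩
  have hf' : φ.free ⊆ {0} := fun i hi => by
    have h1 : i < 1 := hf hi
    rw [Set.mem_singleton_iff]
    omega
  refine ⟨encode (φ.code d), Set.ext fun x => ?_⟩
  have h1 : x ∈ {x | truthEnum c (· ∈ truthSet S d) (encode (φ.code d)) x} ↔ φ.Sat (asg [x]) :=
    truthEnum_code_iff hd h hφ hf' x
  rw [h1, hX]
  simp [asg]

/-- If row `e` is nonempty, some substitution instance is a true sentence; parsing its string shows
that `e` codes a formula with at most `x_0` free, and this formula defines the row. All other rows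
are empty. -/
theorem isProperUniversal_truthEnum (hd : S.InjOn d) (h : ∀ s ∈ arith, d s = c s) :
    IsProperUniversal S (truthEnum c (· ∈ truthSet S d)) := by
  refine ⟨isUniversal_truthEnum hd h, fun e => definable₁_iff_dfn.2 ?_⟩
  by_cases he : ∃ x, truthEnum c (· ∈ truthSet S d) e x
  · obtain ⟨x, σ, rfl, θ, h1, h2, h3, h4⟩ := he
    rw [Fml.godel_eq, encode_inj] at h4
    rw [subStr, ← numFml_code_congr h] at h4
    obtain ⟨ψ, rfl, h5⟩ := Fml.eq_ex_of_code (i := 0) h4.symm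
    obtain ⟨φ, rfl, rfl⟩ := Fml.eq_and_of_code (θ := ψ) hd h1 (numFml_in hS.out x) h5
    have hφ : φ.In S := h1.2
    have hf : φ.free ⊆ {0} := subFml_free.1 h2
    refine Dfn.congr ?_ fun y => (truthEnum_code_iff hd h hφ hf y).symm
    exact (φ.dfn_sat (.of_subset hS.out subset_rfl) hφ).comp (f := fun y : ℕ => [y]) (by fun_prop)
  · push Not at he
    exact (Dfn.const False).congr fun x => by simpa using he x

end

/-! ### The stages of the iterated truth predicate -/

theorem pred₁_injective : Function.Injective pred₁ := by
  intro X Y h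
  simp only [pred₁, Symb.pred.injEq, heq_eq_eq, true_and] at h
  ext x
  simpa using Set.ext_iff.1 h fun _ => x

theorem IsLinearOrdering.below_trans {R : ℕ → ℕ → Prop} (hR : IsLinearOrdering R) {x y z : ℕ}
    (h : Below R x y) (h' : Below R y z) : Below R x z := by
  refine ⟨hR.trans _ _ _ h.1 h'.1, ?_⟩
  rintro rfl
  exact h.2 (hR.antisymm _ _ h.1 h'.1)

theorem IsLinearOrdering.below_of_le {R : ℕ → ℕ → Prop} (hR : IsLinearOrdering R) {x y z : ℕ}
    (h : R x y) (h' : Below R y z) : Below R x z := by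
  by_cases hxy : x = y
  · rwa [hxy]
  · exact hR.below_trans ⟨h, hxy⟩ h'

theorem IsLinearOrdering.below_total {R : ℕ → ℕ → Prop} (hR : IsLinearOrdering R) {x y : ℕ}
    (hx : x ∈ rng R) (hy : y ∈ rng R) (h : x ≠ y) : Below R x y ∨ Below R y x :=
  (hR.total x hx y hy).imp (fun h' => ⟨h', h⟩) fun h' => ⟨h', h.symm⟩

theorem Dfn.below {M : Set Symb} [Fact (arith ⊆ M)] {R : ℕ → ℕ → Prop}
    (h : Dfn M fun p : ℕ × ℕ => R p.1 p.2) : Dfn M fun p : ℕ × ℕ => Below R p.1 p.2 := by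
  unfold Below
  fun_prop

/-- Letters of predicate symbols of the stage at `n`. -/
def stageCode (N : Set Symb) (c : Symb → ℕ) (R : ℕ → ℕ → Prop) (n a k : ℕ) : Prop :=
  PredCode c N a k ∨ (k = 1 ∧ ∃ m, Below R m n ∧ a = predLetter m 1)

/-- Truth of predicates of the stage at `n`. -/
def stageTrue (N : Set Symb) (c : Symb → ℕ) (R X : ℕ → ℕ → Prop) (n a : ℕ) (vs : List ℕ) : Prop :=
  PredTrue c N a vs ∨ ∃ m x, Below R m n ∧ a = predLetter m 1 ∧ vs = [x] ∧ X m x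

/-- The truth predicate of the stage at `n` that is computed from `X` with the help of `G`. -/
def stageTruth (N : Set Symb) (c : Symb → ℕ) (R X G : ℕ → ℕ → Prop) (n : ℕ) (σ : List ℕ) : Prop :=
  TruthFrom (stageCode N c R n) (stageTrue N c R X n) (Val (FunTrue c N)) G σ

/-- The situation in which the truth predicate is iterated. -/
structure Iteration (N : Set Symb) (c : Symb → ℕ) (R U : ℕ → ℕ → Prop) : Prop where
  arith_subset : arith ⊆ N
  finite : N.Finite
  coding : IsCoding N c
  compatible : Compatible N c R
  linear : IsLinearOrdering R
  wf : WellFounded (Below R)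
  definable : Definable₂ N R
  iterated : U ∈ iteratedTruth N c R

section
variable {N : Set Symb} {c : Symb → ℕ} {R U : ℕ → ℕ → Prop}

theorem subset_stage (n : ℕ) : N ⊆ stage N R U n := Set.subset_union_left

theorem pred₁_mem_stage {m n : ℕ} (h : Below R m n) : pred₁ {x | U m x} ∈ stage N R U n :=
  Or.inr ⟨m, h, rfl⟩

theorem stage_mono (hR : IsLinearOrdering R) {m n : ℕ} (h : Below R m n) :
    stage N R U m ⊆ stage N R U n := by
  rintro s (hs | ⟨k, hk, rfl⟩)
  · exact Or.inl hs
  · exact pred₁_mem_stage (hR.below_trans hk h)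

theorem inducedCoding_of_mem {n : ℕ} {s : Symb} (hs : s ∈ N) : inducedCoding N c R U n s = c s :=
  if_pos hs

/-- In the stage at `n` the predicates `U m`, `m ≺ n`, are new symbols with the code `m`. -/
def GoodCoding (N : Set Symb) (c : Symb → ℕ) (R U : ℕ → ℕ → Prop) (n : ℕ) : Prop :=
  ∀ m, Below R m n → inducedCoding N c R U n (pred₁ {x | U m x}) = m

variable {n : ℕ}

/-- Compatibility keeps the codes of the symbols of `N` apart from the members of `rng R`, which
code the added predicates. -/
theorem GoodCoding.injOn (h : GoodCoding N c R U n) (hc : IsCoding N c)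
    (hcomp : Compatible N c R) (hR : IsLinearOrdering R) :
    (stage N R U n).InjOn (inducedCoding N c R U n) := by
  have key : ∀ s ∈ N, ∀ m, Below R m n → c s ≠ m := fun s hs m hm h =>
    Set.disjoint_left.1 hcomp ⟨s, hs, h⟩ (hR.dom _ _ hm.1)
  rintro s (hs | ⟨m, hm, rfl⟩) t (ht | ⟨k, hk, rfl⟩) hst
  · rw [inducedCoding_of_mem hs, inducedCoding_of_mem ht] at hst
    exact hc hs ht hst
  · rw [inducedCoding_of_mem hs, h k hk] at hst
    exact absurd hst (key s hs k hk)
  · rw [inducedCoding_of_mem ht, h m hm] at hst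
    exact absurd hst.symm (key t ht m hm)
  · rw [h k hk, h m hm] at hst
    rw [hst]

theorem GoodCoding.predCode_eq (h : GoodCoding N c R U n) :
    PredCode (inducedCoding N c R U n) (stage N R U n) = stageCode N c R n := by
  ext a k
  constructor
  · rintro ⟨hk, A, hs | ⟨m, hm, hs⟩, rfl⟩
    · rw [inducedCoding_of_mem hs]
      exact Or.inl ⟨hk, A, hs, rfl⟩
    · rw [hs, h m hm]
      cases hs
      exact Or.inr ⟨rfl, m, hm, rfl⟩
  · rintro (⟨hk, A, hs, rfl⟩ | ⟨rfl, m, hm, rfl⟩)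
    · exact ⟨hk, A, Or.inl hs, by rw [inducedCoding_of_mem hs]⟩
    · exact ⟨Nat.one_pos, {v | v 0 ∈ {x | U m x}}, pred₁_mem_stage hm,
        congrArg (predLetter · 1) (h m hm).symm⟩

theorem GoodCoding.predTrue_eq (h : GoodCoding N c R U n) :
    PredTrue (inducedCoding N c R U n) (stage N R U n) = stageTrue N c R U n := by
  ext a vs
  constructor
  · rintro ⟨k, hk, A, hs | ⟨m, hm, hs⟩, rfl, h1, h2⟩
    · rw [inducedCoding_of_mem hs]
      exact Or.inl ⟨k, hk, A, hs, rfl, h1, h2⟩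
    · rw [hs, h m hm]
      cases hs
      obtain ⟨x, rfl⟩ := List.length_eq_one_iff.1 h1
      exact Or.inr ⟨m, x, hm, rfl, rfl, by simpa [asg] using h2⟩
  · rintro (⟨k, hk, A, hs, rfl, h1⟩ | ⟨m, x, hm, rfl, rfl, hx⟩)
    · exact ⟨k, hk, A, Or.inl hs, by rw [inducedCoding_of_mem hs], h1⟩
    · exact ⟨1, Nat.one_pos, {v | v 0 ∈ {x | U m x}}, pred₁_mem_stage hm,
        congrArg (predLetter · 1) (h m hm).symm, rfl, by simpa [asg] using hx⟩

theorem funTrue_stage_eq :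
    FunTrue (inducedCoding N c R U n) (stage N R U n) = FunTrue c N := by
  ext a vs v
  constructor
  · rintro ⟨k, f, hs | ⟨m, hm, hs⟩, rfl, h⟩
    · rw [inducedCoding_of_mem hs]
      exact ⟨k, f, hs, rfl, h⟩
    · simp [pred₁] at hs
  · rintro ⟨k, f, hs, rfl, h⟩
    exact ⟨k, f, Or.inl hs, by rw [inducedCoding_of_mem hs], h⟩

theorem stageTrue_congr {X Y : ℕ → ℕ → Prop} (h : ∀ m, Below R m n → ∀ x, X m x ↔ Y m x) :
    stageTrue N c R X n = stageTrue N c R Y n := by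
  ext a vs
  refine or_congr_right (exists_congr fun m => exists_congr fun x => and_congr_right fun hm => ?_)
  rw [h m hm]

theorem Iteration.truth (I : Iteration N c R U) (hn : n ∈ rng R) :
    {x | U n x} = truthSet (stage N R U n) (inducedCoding N c R U n) := I.iterated.2 n hn

theorem Iteration.truthEnum_eq (I : Iteration N c R U) (hn : n ∈ rng R) :
    truthEnum c (U n) = truthEnum c (· ∈ truthSet (stage N R U n) (inducedCoding N c R U n)) := by
  rw [← I.truth hn]
  rfl

/-- Truth at the stage consults only the columns below `n`, so `U` may be replaced by any `X` that
agrees with it there. A candidate for `U` can therefore be tested column by column. -/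
theorem stageTruth_iff (I : Iteration N c R U) (hn : n ∈ rng R) (h : GoodCoding N c R U n)
    {S' : Set Symb} [Fact (arith ⊆ S')] (hS' : Interp (stage N R U n) S') {G X : ℕ → ℕ → Prop}
    (hG : IsUniversal S' G) (hX : ∀ m, Below R m n → ∀ x, X m x ↔ U m x) {σ : List ℕ} :
    stageTruth N c R X G n σ ↔ U n (encode σ) := by
  have h1 := truthFrom_iff (h.injOn I.coding I.compatible I.linear) hS' hG (σ := σ)
  rw [h.predCode_eq, h.predTrue_eq, funTrue_stage_eq, ← I.truth hn] at h1
  unfold stageTruth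
  rw [stageTrue_congr hX, h1]
  rfl

theorem Iteration.isProperUniversal (I : Iteration N c R U) (hn : n ∈ rng R)
    (h : GoodCoding N c R U n) : IsProperUniversal (stage N R U n) (truthEnum c (U n)) := by
  have := Fact.mk (I.arith_subset.trans (subset_stage (U := U) (R := R) n))
  rw [I.truthEnum_eq hn]
  exact isProperUniversal_truthEnum (h.injOn I.coding I.compatible I.linear) fun s hs =>
    inducedCoding_of_mem (I.arith_subset hs)

theorem Dfn.stageTruth {γ : Type} [Primcodable γ] (I : Iteration N c R U) {M : Set Symb}
    [hM : Fact (arith ⊆ M)] (hNM : N ⊆ M) {X : γ → ℕ → ℕ → Prop} {G : ℕ → ℕ → Prop}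
    (hX : Dfn M fun q : γ × ℕ × ℕ => X q.1 q.2.1 q.2.2) (hG : Dfn M fun q : ℕ × ℕ => G q.1 q.2) :
    Dfn M fun q : (γ × ℕ) × List ℕ => stageTruth N c R (X q.1.1) G q.1.2 q.2 := by
  have := Fact.mk I.arith_subset
  have hi : Interp N M := .of_subset hM.out hNM
  have hR : Dfn M fun p : ℕ × ℕ => Below R p.1 p.2 :=
    Dfn.below ((definable₂_iff_dfn.1 I.definable).trans hi)
  have h1 : Dfn M fun q : ℕ × ℕ => PredCode c N q.1 q.2 := (Dfn.predCode I.finite).trans hi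
  have h2 : Dfn M fun q : ℕ × List ℕ => PredTrue c N q.1 q.2 := (Dfn.predTrue I.finite).trans hi
  have h3 : Dfn M fun q : ℕ × List ℕ × ℕ => FunTrue c N q.1 q.2.1 q.2.2 :=
    (Dfn.funTrue I.finite).trans hi
  unfold UniversalPredicates.stageTruth
  refine Dfn.truthFrom (γ := γ × ℕ) (pc := fun g => stageCode N c R g.2)
    (pt := fun g => stageTrue N c R (X g.1) g.2) ?_ ?_ (Dfn.val h3) hG
  · unfold stageCode
    fun_prop
  · unfold stageTrue
    refine .or (h2.comp (f := fun q : (γ × ℕ) × ℕ × List ℕ => q.2) (by fun_prop))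
      (.ex (.ex (.and ?_ (.and ?_ (.and ?_ ?_)))))
    · exact hR.comp (f := fun q : (((γ × ℕ) × ℕ × List ℕ) × ℕ) × ℕ => (q.1.2, q.1.1.1.2))
        (by fun_prop)
    · fun_prop
    · fun_prop
    · exact hX.comp (f := fun q : (((γ × ℕ) × ℕ × List ℕ) × ℕ) × ℕ => (q.1.1.1.1, q.1.2, q.2))
        (by fun_prop)

/-- A column undefinable in its own stage is neither a symbol of `N` nor equal to an earlier column.
So the set whose infimum gives the induced code of `U(m,·)` is `{m}`. -/
theorem goodCoding_of_not_definable (hR : IsLinearOrdering R)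
    (h : ∀ m, Below R m n → ¬ Definable₁ (stage N R U m) {x | U m x}) (hN : arith ⊆ N) :
    GoodCoding N c R U n := by
  have hmem : ∀ {S : Set Symb}, arith ⊆ S → ∀ X, pred₁ X ∈ S → Definable₁ S X := by
    intro S hS X hX
    have := Fact.mk hS
    exact definable₁_iff_dfn.2 (symbDfn_pred₁.1 (SymbDfn.of_mem hS hX))
  have hst : ∀ m, arith ⊆ stage N R U m := fun m => hN.trans (subset_stage m)
  have hne : ∀ m k, Below R m k → Below R k n → {x | U m x} ≠ {x | U k x} := by
    intro m k hmk hk heq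
    refine h k hk (hmem (hst k) _ ?_)
    rw [← heq]
    exact pred₁_mem_stage hmk
  intro m hm
  have h1 : pred₁ {x | U m x} ∉ N := fun h1 => h m hm (hmem (hst m) _ (Or.inl h1))
  have h2 : {k | Below R k n ∧ pred₁ {x | U m x} = pred₁ {x | U k x}} = {m} := by
    ext k
    constructor
    · rintro ⟨hk, hmk⟩
      have hmk := pred₁_injective hmk
      by_contra hne'
      rcases hR.below_total (hR.dom _ _ hm.1) (hR.dom _ _ hk.1) (Ne.symm hne') with h3 | h3
      · exact hne m k h3 hk hmk
      · exact hne k m h3 hm hmk.symm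
    · rintro rfl
      exact ⟨hm, rfl⟩
  rw [inducedCoding, if_neg h1, h2]
  exact csInf_singleton m

/-- The three claims need a joint induction: undefinability at earlier stages gives injective
codings, injective codings make truth universal and hence undefinable, and recovering `U` from `G`
uses the definability of its initial parts in the current stage. -/
theorem Iteration.main (I : Iteration N c R U) : ∀ n ∈ rng R, GoodCoding N c R U n ∧
    ¬ Definable₁ (stage N R U n) {x | U n x} ∧
    ∀ G, IsUniversal (stage N R U n) G →
      Dfn (stage N R U n ∪ {pred₂ G}) (fun p : ℕ × ℕ => Below R p.1 n ∧ U p.1 p.2) ∧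
      Dfn (stage N R U n ∪ {pred₂ G}) (fun x => U n x) := by
  intro n
  induction n using I.wf.induction with
  | _ n ih =>
  intro hn
  have hst : ∀ m, arith ⊆ stage N R U m := fun m => I.arith_subset.trans (subset_stage m)
  have hfst : ∀ m, Fact (arith ⊆ stage N R U m) := fun m => ⟨hst m⟩
  have ih' : ∀ m, Below R m n → _ := fun m hm => ih m hm (I.linear.dom _ _ hm.1)
  have h1 : GoodCoding N c R U n :=
    goodCoding_of_not_definable I.linear (fun m hm => (ih' m hm).2.1) I.arith_subset
  refine ⟨h1, fun h2 => ?_, fun G hG => ?_⟩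
  -- If `U(n,·)` were definable in its stage, so would be the universal predicate enumerated from
  -- it.
  · exact (I.isProperUniversal hn h1).1.not_dfn (Dfn.truthEnum (definable₁_iff_dfn.1 h2))
  have hU : ∀ m, Below R m n →
      Dfn (stage N R U n) fun p : ℕ × ℕ => R p.1 m ∧ U p.1 p.2 := by
    intro m hm
    have hm' := I.linear.dom _ _ hm.1
    have hUm : Dfn (stage N R U n) fun x => U m x :=
      symbDfn_pred₁.1 (SymbDfn.of_mem (hst n) (pred₁_mem_stage hm))
    -- The induction hypothesis at `m` is used with the universal predicate enumerated from
    -- `U(m,·)`, which is a symbol of the stage at `n`; this bounds the definability of `U` below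
    -- `m` inside that stage.
    have h2 : Interp (stage N R U m ∪ {pred₂ (truthEnum c (U m))}) (stage N R U n) :=
      (Interp.of_subset (hst n) (stage_mono I.linear hm)).union
        (interp_singleton (symbDfn_pred₂.2 (Dfn.truthEnum hUm)))
    have h3 := ((ih' m hm).2.2 _ (I.isProperUniversal hm' (ih' m hm).1).1).1.trans h2
    have h4 : Dfn (stage N R U n) fun p : ℕ × ℕ => p.1 = m ∧ U m p.2 := by fun_prop
    refine (h3.or h4).congr fun p => ?_
    constructor
    · rintro (⟨h5, h6⟩ | ⟨h5, h6⟩)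
      · exact ⟨h5.1, h6⟩
      · rw [h5]
        exact ⟨I.linear.refl m hm', h6⟩
    · rintro ⟨h5, h6⟩
      by_cases h7 : p.1 = m
      · exact Or.inr ⟨h7, h7 ▸ h6⟩
      · exact Or.inl ⟨⟨h5, h7⟩, h6⟩
  set M := stage N R U n ∪ {pred₂ G} with hMdef
  have hSM : stage N R U n ⊆ M := Set.subset_union_left
  have hM : arith ⊆ M := (hst n).trans hSM
  have hfM := Fact.mk hM
  have hi : Interp (stage N R U n) M := .of_subset hM hSM
  have hGM : Dfn M fun q : ℕ × ℕ => G q.1 q.2 :=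
    symbDfn_pred₂.1 (SymbDfn.of_mem hM (Or.inr rfl))
  have hfN := Fact.mk I.arith_subset
  have hRM : Dfn M fun p : ℕ × ℕ => R p.1 p.2 :=
    (definable₂_iff_dfn.1 I.definable).trans (.of_subset hM ((subset_stage n).trans hSM))
  have hBM := Dfn.below hRM
  -- `G(e,·)`, read as a binary relation through pairing, obeys the recursion equations of `U` at
  -- every index up to `m`. The same `G` is both the source of the candidate and the universal
  -- predicate by which truth is computed.
  let Cond : ℕ → ℕ → Prop := fun e m => ∀ m' x, R m' m → (G e (encode (m', x)) ↔
    ∃ σ : List ℕ, encode σ = x ∧ stageTruth N c R (fun k y => G e (encode (k, y))) G m' σ)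
  have hCond : Dfn M fun q : ℕ × ℕ => Cond q.1 q.2 := by
    have h2 := Dfn.stageTruth (γ := ℕ) I ((subset_stage n).trans hSM)
      (X := fun e k y => G e (encode (k, y))) (hGM.comp
        (f := fun q : ℕ × ℕ × ℕ => (q.1, encode (q.2.1, q.2.2))) (by fun_prop)) hGM
    have h3 := h2.comp (f := fun q : (((ℕ × ℕ) × ℕ) × ℕ) × List ℕ =>
      ((q.1.1.1.1, q.1.1.2), q.2)) (by fun_prop)
    refine .all (.all (.imp ?_ (.iff ?_ (.ex (.and ?_ h3)))))
    · exact hRM.comp (f := fun q : ((ℕ × ℕ) × ℕ) × ℕ => (q.1.2, q.1.1.2)) (by fun_prop)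
    · exact hGM.comp (f := fun q : ((ℕ × ℕ) × ℕ) × ℕ => (q.1.1.1, encode (q.1.2, q.2)))
        (by fun_prop)
    · fun_prop
  have hUenc : ∀ m ∈ rng R, ∀ x, U m x → ∃ σ : List ℕ, encode σ = x := by
    intro m hm x hx
    have : x ∈ truthSet _ _ := I.truth hm ▸ (show x ∈ {x | U m x} from hx)
    obtain ⟨φ, -, -, -, rfl⟩ := this
    exact ⟨_, rfl⟩
  have hcore : ∀ m, Below R m n → ∀ X : ℕ → ℕ → Prop,
      (∀ k, Below R k m → ∀ x, X k x ↔ U k x) → ∀ x,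
      ((∃ σ : List ℕ, encode σ = x ∧ stageTruth N c R X G m σ) ↔ U m x) := by
    intro m hm X hX x
    have hm' := I.linear.dom _ _ hm.1
    have key : ∀ σ : List ℕ, stageTruth N c R X G m σ ↔ U m (encode σ) := fun σ =>
      stageTruth_iff I hm' (ih' m hm).1 (.of_subset (hst n) (stage_mono I.linear hm)) hG hX
    constructor
    · rintro ⟨σ, rfl, h⟩
      exact (key σ).1 h
    · intro h
      obtain ⟨σ, rfl⟩ := hUenc m hm' x h
      exact ⟨σ, rfl, (key σ).2 h⟩
  -- By induction along `R` the recursion equations have only the intended solution, even if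
  -- `G(e,·)` is not a definable set.
  have hsound : ∀ e m, Below R m n → Cond e m → ∀ k, R k m → ∀ x, G e (encode (k, x)) ↔ U k x := by
    intro e m hm he k
    induction k using I.wf.induction with
    | _ k ihk =>
    intro hk x
    rw [he k x hk]
    exact hcore k (I.linear.below_of_le hk hm) _
      (fun j hj y => ihk j hj (I.linear.trans _ _ _ hj.1 hk) y) x
  have hbelow : Dfn M fun p : ℕ × ℕ => Below R p.1 n ∧ U p.1 p.2 := by
    have h2 : Dfn M fun p : ℕ × ℕ =>
        Below R p.1 n ∧ ∃ e, Cond e p.1 ∧ G e (encode (p.1, p.2)) := by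
      refine .and ?_ (.ex (.and ?_ ?_))
      · exact hBM.comp (f := fun p : ℕ × ℕ => (p.1, n)) (by fun_prop)
      · exact hCond.comp (f := fun p : (ℕ × ℕ) × ℕ => (p.2, p.1.1)) (by fun_prop)
      · exact hGM.comp (f := fun p : (ℕ × ℕ) × ℕ => (p.2, encode (p.1.1, p.1.2))) (by fun_prop)
    refine h2.congr fun p => and_congr_right fun hp => ?_
    have hp' := I.linear.refl _ (I.linear.dom _ _ hp.1)
    constructor
    · rintro ⟨e, h3, h4⟩
      exact (hsound e p.1 hp h3 p.1 hp' p.2).1 h4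
    · intro h3
      -- Conversely, the part of `U` up to the given index is definable in the stage, so
      -- universality supplies a correct candidate.
      obtain ⟨e, he⟩ := hG.exists_index (hU p.1 hp)
      have he' : ∀ k, R k p.1 → ∀ x, G e (encode (k, x)) ↔ U k x := fun k hk x => by
        rw [he]
        exact and_iff_right hk
      refine ⟨e, fun k x hk => ?_, (he' _ hp' _).2 h3⟩
      rw [he' k hk]
      refine (hcore k (I.linear.below_of_le hk hp) _ (fun j hj y => ?_) x).symm
      exact he' j (I.linear.trans _ _ _ hj.1 hk) y
  refine ⟨hbelow, ?_⟩
  -- With `U` below `n` now uniformly definable, truth at `n` itself follows; the parameter in `ℕ`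
  -- is a dummy.
  have h2 := Dfn.stageTruth (γ := ℕ) I ((subset_stage n).trans hSM)
    (X := fun _ k y => Below R k n ∧ U k y)
    (hbelow.comp (f := fun q : ℕ × ℕ × ℕ => q.2) (by fun_prop)) hGM
  have h3 := h2.comp (f := fun q : ℕ × List ℕ => ((0, n), q.2)) (by fun_prop)
  refine (Dfn.ex (P := fun x σ => encode σ = x ∧
    stageTruth N c R (fun k y => Below R k n ∧ U k y) G n σ) (.and (by fun_prop) h3)).congr
    fun x => ?_
  have key : ∀ σ : List ℕ, stageTruth N c R (fun k y => Below R k n ∧ U k y) G n σ ↔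
      U n (encode σ) := fun σ =>
    stageTruth_iff I hn h1 (.of_subset (hst n) subset_rfl) hG fun m hm x => and_iff_right hm
  constructor
  · rintro ⟨σ, rfl, h⟩
    exact (key σ).1 h
  · intro h
    obtain ⟨σ, rfl⟩ := hUenc n hn x h
    exact ⟨σ, rfl, (key σ).2 h⟩

end

/-! ### Canonic universal predicates and Tarski hierarchies -/

/-- The properties that the two notions of a universal predicate have in common. -/
structure Admissible (univ : Set Symb → (ℕ → ℕ → Prop) → Prop) : Prop where
  isUniversal : ∀ S G, univ S G → IsUniversal S G
  of_isProperUniversal : ∀ S G, IsProperUniversal S G → univ S G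
  congr : ∀ S S' G, DefEquiv S S' → univ S G → univ S' G

theorem admissible_isUniversal : Admissible IsUniversal where
  isUniversal _ _ h := h
  of_isProperUniversal _ _ h := h.1
  congr _ _ _ hS h X hX := h X ((hS X).2 hX)

theorem admissible_isProperUniversal : Admissible IsProperUniversal where
  isUniversal _ _ h := h.1
  of_isProperUniversal _ _ h := h
  congr _ _ _ hS h := ⟨fun X hX => h.1 X ((hS X).2 hX), fun n => (hS _).1 (h.2 n)⟩

section
variable {univ : Set Symb → (ℕ → ℕ → Prop) → Prop}

/-- Admissible universality depends only on the definable sets of numbers, so canonicity can be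
tested against universal predicates for any equivalent structure. -/
theorem IsCanonic.dfn {S S' : Set Symb} (hu : Admissible univ) (hS : arith ⊆ S) (hS' : arith ⊆ S')
    (h : Interp S S') (h' : Interp S' S) {P P' : ℕ → ℕ → Prop} (hP : IsCanonic univ S P)
    (hP' : univ S' P') : Dfn (S' ∪ {pred₂ P'}) fun p : ℕ × ℕ => P p.1 p.2 := by
  have h1 : univ S P' := hu.congr _ _ _ ((defEquiv_iff_interp hS' hS).2 ⟨h', h⟩) hP'
  have hSP : arith ⊆ S ∪ {pred₂ P'} := hS.trans Set.subset_union_left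
  have hSP' : arith ⊆ S' ∪ {pred₂ P'} := hS'.trans Set.subset_union_left
  have := Fact.mk hSP
  have := Fact.mk hSP'
  refine (definable₂_iff_dfn.1 (hP.2 P' h1)).trans (Interp.union ?_ ?_)
  · exact h.trans (.of_subset hSP' Set.subset_union_left)
  · exact .of_subset hSP' Set.subset_union_right

variable {N : Set Symb} {c : Symb → ℕ} {R U : ℕ → ℕ → Prop} {β : Ordinal.{0}}
  {f : Ordinal.{0} → ℕ}

/-- The numbers `f α`, `α ≤ β`, are the first members of `rng R`, in increasing order. -/
def Enumerates (R : ℕ → ℕ → Prop) (β : Ordinal.{0}) (f : Ordinal.{0} → ℕ) : Prop :=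
  ∀ α ≤ β, f α ∈ rng R ∧ ∀ m, Below R m (f α) ↔ ∃ γ < α, m = f γ

theorem Iteration.arith_subset_stage (I : Iteration N c R U) (n : ℕ) :
    arith ⊆ stage N R U n := I.arith_subset.trans (subset_stage n)

theorem Iteration.dfn_of_mem_stage (I : Iteration N c R U) {m n : ℕ} (h : Below R m n) :
    Dfn (stage N R U n) fun x => U m x := by
  have := Fact.mk (I.arith_subset_stage n)
  exact symbDfn_pred₁.1 (SymbDfn.of_mem (I.arith_subset_stage n) (pred₁_mem_stage h))

theorem Iteration.univ_truthEnum (hu : Admissible univ) (I : Iteration N c R U) {n : ℕ}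
    (hn : n ∈ rng R) : univ (stage N R U n) (truthEnum c (U n)) :=
  hu.of_isProperUniversal _ _ (I.isProperUniversal hn (I.main n hn).1)

theorem Iteration.dfn_of_univ (hu : Admissible univ) (I : Iteration N c R U) {n : ℕ}
    (hn : n ∈ rng R) {S : Set Symb} (hS : arith ⊆ S) (h : Interp (stage N R U n) S)
    (h' : Interp S (stage N R U n)) {P : ℕ → ℕ → Prop} (hP : univ S P) :
    Dfn (S ∪ {pred₂ P}) fun x => U n x := by
  have h1 : univ (stage N R U n) P := hu.congr _ _ _
    ((defEquiv_iff_interp hS (I.arith_subset_stage n)).2 ⟨h', h⟩) hP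
  have hSP : arith ⊆ S ∪ {pred₂ P} := hS.trans Set.subset_union_left
  have := Fact.mk hSP
  refine ((I.main n hn).2.2 P (hu.isUniversal _ _ h1)).2.trans (Interp.union ?_ ?_)
  · exact h.trans (.of_subset hSP Set.subset_union_left)
  · exact .of_subset hSP Set.subset_union_right

theorem interp_stage_succ (hf : Enumerates R β f) {α : Ordinal.{0}}
    (hα : Order.succ α ≤ β) {S : Set Symb} (hS : arith ⊆ S) (h : Interp (stage N R U (f α)) S)
    (hU : Dfn S fun x => U (f α) x) : Interp (stage N R U (f (Order.succ α))) S := by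
  have := Fact.mk hS
  rintro s (hs | ⟨m, hm, rfl⟩)
  · exact h s (Or.inl hs)
  · obtain ⟨γ, hγ, rfl⟩ := ((hf _ hα).2 m).1 hm
    rcases (Order.lt_succ_iff.1 hγ).lt_or_eq with h1 | rfl
    · exact h _ (pred₁_mem_stage (((hf _ ((Order.le_succ α).trans hα)).2 _).2 ⟨γ, h1, rfl⟩))
    · exact symbDfn_pred₁.2 hU

/-- At a successor, canonicity defines the added predicate from the enumeration of `U(f α,·)`, and
conversely `Iteration.main` defines `U(f α,·)` from the added predicate. The choice of canonic
predicates in the sequence is therefore immaterial. -/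
theorem IsTarskiSeq.interp_stage (hu : Admissible univ) (I : Iteration N c R U)
    (hf : Enumerates R β f) {ξ : Ordinal.{0}} {M : Ordinal.{0} → Set Symb} (hβ : β ≤ ξ)
    (hM : IsTarskiSeq univ N ξ M) (α : Ordinal.{0}) : α ≤ β → arith ⊆ M α ∧
      Interp (M α) (stage N R U (f α)) ∧ Interp (stage N R U (f α)) (M α) := by
  induction α using WellFoundedLT.induction with
  | _ α ih =>
  intro hα
  have hst := fun n => I.arith_subset_stage n
  have hfst := fun n => Fact.mk (hst n)
  have hmono : ∀ γ < α, stage N R U (f γ) ⊆ stage N R U (f α) := fun γ hγ =>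
    stage_mono I.linear (((hf α hα).2 _).2 ⟨γ, hγ, rfl⟩)
  rcases Ordinal.zero_or_succ_or_isSuccLimit α with rfl | ⟨α, rfl⟩ | hlim
  · have h1 : stage N R U (f 0) = N := by
      refine Set.Subset.antisymm ?_ (subset_stage _)
      rintro s (hs | ⟨m, hm, rfl⟩)
      · exact hs
      · obtain ⟨γ, hγ, -⟩ := ((hf 0 hα).2 m).1 hm
        exact absurd hγ (not_lt_bot (a := γ))
    rw [h1, hM.1]
    exact ⟨I.arith_subset, .of_subset I.arith_subset subset_rfl,
      .of_subset I.arith_subset subset_rfl⟩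
  · have hlt : α < Order.succ α := Order.lt_succ α
    obtain ⟨h1, h2, h3⟩ := ih α hlt (hlt.le.trans hα)
    obtain ⟨P, hP, hMα⟩ := hM.2.1 α (hlt.trans_le (hα.trans hβ))
    have hn := (hf α (hlt.le.trans hα)).1
    have hb : Below R (f α) (f (Order.succ α)) := ((hf _ hα).2 _).2 ⟨α, hlt, rfl⟩
    have h4 : arith ⊆ M (Order.succ α) := by
      rw [hMα]
      exact h1.trans Set.subset_union_left
    have := Fact.mk h4
    refine ⟨h4, ?_, interp_stage_succ hf hα h4 ?_ ?_⟩
    · rw [hMα]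
      refine Interp.union (h2.trans (.of_subset (hst _) (hmono _ hlt)))
        (interp_singleton (symbDfn_pred₂.2 ?_))
      have h5 := hP.dfn hu h1 (hst _) h2 h3 (I.univ_truthEnum hu hn)
      refine h5.trans (Interp.union (.of_subset (hst _) (hmono _ hlt))
        (interp_singleton (symbDfn_pred₂.2 ?_)))
      exact Dfn.truthEnum (I.dfn_of_mem_stage hb)
    · refine h3.trans (.of_subset h4 ?_)
      rw [hMα]
      exact Set.subset_union_left
    · rw [hMα]
      exact I.dfn_of_univ hu hn h1 h3 h2 hP.1
  · have h1 : M α = ⋃ γ ∈ Set.Iio α, M γ := hM.2.2 α hlim (hα.trans hβ)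
    have h2 : ∀ γ < α, M γ ⊆ M α := fun γ hγ => by
      rw [h1]
      exact Set.subset_biUnion_of_mem (u := M) (show γ ∈ Set.Iio α from hγ)
    have h0 : (0 : Ordinal) < α := bot_lt_iff_ne_bot.2 hlim.ne_bot
    have h3 : arith ⊆ M α := by
      have := h2 0 h0
      rw [hM.1] at this
      exact I.arith_subset.trans this
    have := Fact.mk h3
    refine ⟨h3, fun s hs => ?_, ?_⟩
    · rw [h1] at hs
      simp only [Set.mem_iUnion] at hs
      obtain ⟨γ, hγ, hs⟩ := hs
      exact ((ih γ hγ ((le_of_lt hγ).trans hα)).2.1 s hs).trans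
        (.of_subset (hst _) (hmono γ hγ))
    · rintro s (hs | ⟨m, hm, rfl⟩)
      · refine SymbDfn.of_mem h3 (h2 0 h0 ?_)
        rwa [hM.1]
      · obtain ⟨γ, hγ, rfl⟩ := ((hf α hα).2 m).1 hm
        have hγ' := hlim.succ_lt hγ
        have hb : Below R (f γ) (f (Order.succ γ)) :=
          ((hf _ (hγ'.le.trans hα)).2 _).2 ⟨γ, Order.lt_succ γ, rfl⟩
        exact ((ih _ hγ' (hγ'.le.trans hα)).2.2 _ (pred₁_mem_stage hb)).trans
          (.of_subset h3 (h2 _ hγ'))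

/-- Each set definable in `S` is a row of `G`, and a row is definable from `G` and a numeral. So
arithmetic with `G` recovers all of `S`, although the symbols of `S` are absent. -/
theorem dfn_of_interp_arith {S : Set Symb} (hS : arith ⊆ S) {G : ℕ → ℕ → Prop}
    (hG : IsUniversal S G) {T : Set Symb} (hT : arith ⊆ T)
    (hGT : Dfn T fun p : ℕ × ℕ => G p.1 p.2) : Interp S T := by
  have := Fact.mk hT
  refine interp_of_definable₁ hS fun X hX => ?_
  obtain ⟨e, rfl⟩ := hG X hX
  exact definable₁_iff_dfn.2 (hGT.comp (f := fun x : ℕ => (e, x)) (by fun_prop))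

/-- Canonicity defines `P` from `S` and the enumeration of `U(n,·)`; `Iteration.main` defines
`U(n,·)` from `S` and `P`. In both cases `dfn_of_interp_arith` eliminates the underlying structure.
-/
theorem defEquiv_of_isCanonic (hu : Admissible univ) (I : Iteration N c R U) {n : ℕ}
    (hn : n ∈ rng R) {S : Set Symb} (hS : arith ⊆ S) (h : Interp S (stage N R U n))
    (h' : Interp (stage N R U n) S) {P : ℕ → ℕ → Prop} (hP : IsCanonic univ S P) :
    DefEquiv (arith ∪ {pred₂ P}) (arith ∪ {pred₁ {x | U n x}}) := by
  have h1 : arith ⊆ arith ∪ {pred₂ P} := Set.subset_union_left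
  have h2 : arith ⊆ arith ∪ {pred₁ {x | U n x}} := Set.subset_union_left
  have := Fact.mk h1
  have := Fact.mk h2
  have hst := I.arith_subset_stage n
  have hPP : Dfn (arith ∪ {pred₂ P}) fun p : ℕ × ℕ => P p.1 p.2 :=
    symbDfn_pred₂.1 (SymbDfn.of_mem h1 (Or.inr rfl))
  have hUU : Dfn (arith ∪ {pred₁ {x | U n x}}) fun x => U n x :=
    symbDfn_pred₁.1 (SymbDfn.of_mem h2 (Or.inr rfl))
  refine (defEquiv_iff_interp h1 h2).2 ⟨Interp.union (.of_subset h2 h2) (interp_singleton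
    (symbDfn_pred₂.2 ?_)), Interp.union (.of_subset h1 h1) (interp_singleton
    (symbDfn_pred₁.2 ?_))⟩
  · have hT := I.univ_truthEnum hu hn
    have hTT : Dfn (arith ∪ {pred₁ {x | U n x}}) fun p : ℕ × ℕ => truthEnum c (U n) p.1 p.2 :=
      Dfn.truthEnum hUU
    exact (hP.dfn hu hS hst h h' hT).trans (Interp.union
      (dfn_of_interp_arith hst (hu.isUniversal _ _ hT) h2 hTT)
      (interp_singleton (symbDfn_pred₂.2 hTT)))
  · exact (I.dfn_of_univ hu hn hS h' h hP.1).trans (Interp.union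
      (dfn_of_interp_arith hS (hu.isUniversal _ _ hP.1) h1 hPP)
      (interp_singleton (symbDfn_pred₂.2 hPP)))

/-! ### Existence and length of hierarchies -/

/-- The enumerations of the columns of `U` are added successively. Each is canonic, since every
universal predicate for an equivalent of the stage defines the column from which it is enumerated.
-/
theorem exists_isTarskiSeq (hu : Admissible univ) (I : Iteration N c R U)
    (hf : Enumerates R β f) : ∃ M, IsTarskiSeq univ N (Order.succ β) M := by
  let T : Ordinal.{0} → Symb := fun γ => pred₂ (truthEnum c (U (f γ)))
  let M : Ordinal.{0} → Set Symb := fun α => N ∪ {s | ∃ γ < α, s = T γ}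
  have hM : ∀ α, arith ⊆ M α := fun α => I.arith_subset.trans Set.subset_union_left
  have hfM := fun α => Fact.mk (hM α)
  have hst := fun n => I.arith_subset_stage n
  have hfst := fun n => Fact.mk (hst n)
  have h1 : ∀ α ≤ β, Interp (M α) (stage N R U (f α)) := by
    rintro α hα s (hs | ⟨γ, hγ, rfl⟩)
    · exact SymbDfn.of_mem (hst _) (Or.inl hs)
    · exact symbDfn_pred₂.2 (Dfn.truthEnum
        (I.dfn_of_mem_stage (((hf α hα).2 _).2 ⟨γ, hγ, rfl⟩)))
  have h2 : ∀ α, α ≤ β → Interp (stage N R U (f α)) (M α) := by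
    intro α
    induction α using WellFoundedLT.induction with
    | _ α ih =>
    rintro hα s (hs | ⟨m, hm, rfl⟩)
    · exact SymbDfn.of_mem (hM α) (Or.inl hs)
    · obtain ⟨γ, hγ, rfl⟩ := ((hf α hα).2 m).1 hm
      have hγβ := hγ.le.trans hα
      have hn := (hf γ hγβ).1
      refine symbDfn_pred₁.2 ?_
      refine (I.dfn_of_univ hu hn (hst _) (.of_subset (hst _) subset_rfl)
        (.of_subset (hst _) subset_rfl) (I.univ_truthEnum hu hn)).trans (Interp.union ?_ ?_)
      · refine (ih γ hγ hγβ).trans (.of_subset (hM α) (Set.union_subset_union_right _ ?_))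
        rintro s ⟨δ, hδ, rfl⟩
        exact ⟨δ, hδ.trans hγ, rfl⟩
      · refine .of_subset (hM α) (Set.singleton_subset_iff.2 (Or.inr ⟨γ, hγ, rfl⟩))
  refine ⟨M, ?_, fun α hα => ?_, fun δ hδ _ => ?_⟩
  · have : {s | ∃ γ < (0 : Ordinal.{0}), s = T γ} = ∅ := by
      ext s
      simp
    simp only [M, this, Set.union_empty]
  · have hα' := Order.lt_succ_iff.1 hα
    have hn := (hf α hα').1
    refine ⟨truthEnum c (U (f α)), ⟨?_, fun P hP => ?_⟩, ?_⟩
    · exact hu.congr _ _ _ ((defEquiv_iff_interp (hst _) (hM α)).2 ⟨h2 α hα', h1 α hα'⟩)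
        (I.univ_truthEnum hu hn)
    · have := Fact.mk ((hM α).trans (Set.subset_union_left (t := {pred₂ P})))
      exact definable₂_iff_dfn.2 (Dfn.truthEnum
        (I.dfn_of_univ hu hn (hM α) (h2 α hα') (h1 α hα') hP))
    · ext s
      simp only [M, T, Set.mem_union, Set.mem_ofPred_eq, Set.mem_singleton_iff,
        Order.lt_succ_iff, or_assoc]
      refine or_congr_right ⟨?_, ?_⟩
      · rintro ⟨γ, hγ, rfl⟩
        rcases hγ.lt_or_eq with h | rfl
        · exact Or.inl ⟨γ, h, rfl⟩
        · exact Or.inr rfl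
      · rintro (⟨γ, hγ, rfl⟩ | rfl)
        · exact ⟨γ, hγ.le, rfl⟩
        · exact ⟨α, le_rfl, rfl⟩
  · ext s
    simp only [M, Set.mem_union, Set.mem_iUnion, Set.mem_ofPred_eq, Set.mem_Iio]
    constructor
    · rintro (hs | ⟨γ, hγ, rfl⟩)
      · exact ⟨0, bot_lt_iff_ne_bot.2 hδ.ne_bot, Or.inl hs⟩
      · exact ⟨_, hδ.succ_lt hγ, Or.inr ⟨γ, Order.lt_succ γ, rfl⟩⟩
    · rintro ⟨α, hα, hs | ⟨γ, hγ, rfl⟩⟩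
      · exact Or.inl hs
      · exact Or.inr ⟨γ, hγ.trans hα, rfl⟩

theorem IsTarskiSeq.mono {ξ : Ordinal.{0}} {M : Ordinal.{0} → Set Symb}
    (hM : IsTarskiSeq univ N ξ M) (γ : Ordinal.{0}) : γ ≤ ξ → ∀ α ≤ γ, M α ⊆ M γ := by
  induction γ using WellFoundedLT.induction with
  | _ γ ih =>
  intro hγ α hα
  rcases hα.lt_or_eq with hα | rfl
  swap
  · exact subset_rfl
  rcases Ordinal.zero_or_succ_or_isSuccLimit γ with rfl | ⟨γ, rfl⟩ | hlim
  · exact absurd hα (not_lt_bot (a := α))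
  · have hlt := Order.lt_succ γ
    obtain ⟨P, -, h⟩ := hM.2.1 γ (hlt.trans_le hγ)
    rw [h]
    exact (ih γ hlt (hlt.le.trans hγ) α (Order.lt_succ_iff.1 hα)).trans Set.subset_union_left
  · rw [hM.2.2 γ hlim hγ]
    exact Set.subset_biUnion_of_mem (u := M) (show α ∈ Set.Iio γ from hα)

/-- Step `α` makes the diagonal set of its universal predicate definable, which it was not before.
These sets are distinct for distinct `α`, so `ξ` injects into the power set of `ω`. Without a bound
the supremum defining the length would carry no information. -/
theorem bddAbove_isTarskiSeq (hu : Admissible univ) (hN : arith ⊆ N) :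
    BddAbove {ξ | ∃ M, IsTarskiSeq univ N ξ M} := by
  refine ⟨(Order.succ (Cardinal.mk (Set ℕ))).ord, fun ξ ⟨M, hM⟩ => ?_⟩
  refine (Cardinal.lt_ord.2 (Order.lt_succ_iff.2 ?_)).le
  have hA : ∀ α ≤ ξ, arith ⊆ M α := fun α hα => by
    have := hM.mono α hα 0 zero_le
    rw [hM.1] at this
    exact hN.trans this
  have key : ∀ α : Set.Iio ξ, ∃ X : Set ℕ,
      Definable₁ (M (Order.succ α.1)) X ∧ ¬ Definable₁ (M α.1) X := by
    rintro ⟨α, hα⟩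
    have hα' : α < ξ := hα
    obtain ⟨P, hP, h⟩ := hM.2.1 α hα'
    have hs := hA _ (Order.succ_le_of_lt hα')
    have := Fact.mk hs
    have hPP : Dfn (M (Order.succ α)) fun p : ℕ × ℕ => P p.1 p.2 :=
      symbDfn_pred₂.1 (SymbDfn.of_mem hs (by rw [h]; exact Or.inr rfl))
    refine ⟨{x | ¬ P x x}, definable₁_iff_dfn.2 (hPP.comp (f := fun x : ℕ => (x, x))
      (by fun_prop)).not, fun hX => ?_⟩
    obtain ⟨n, hn⟩ := hu.isUniversal _ _ hP.1 _ hX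
    have := Set.ext_iff.1 hn n
    simp at this
  choose X hX hX' using key
  have hlt : ∀ α γ : Set.Iio ξ, α.1 < γ.1 → X α ≠ X γ := by
    intro α γ hαγ h
    refine hX' γ (h ▸ ?_)
    have hγ : γ.1 ≤ ξ := le_of_lt γ.2
    have := Fact.mk (hA _ hγ)
    exact (Interp.of_subset (hA _ hγ) (hM.mono _ hγ _ (Order.succ_le_of_lt hαγ))).definable₁ (hX α)
  have hinj : Function.Injective X := by
    intro α γ h
    by_contra hne
    rcases lt_or_gt_of_ne (fun h' => hne (Subtype.ext h') : α.1 ≠ γ.1) with h' | h'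
    · exact hlt _ _ h' h
    · exact hlt _ _ h' h.symm
  have := Cardinal.lift_mk_le_lift_mk_of_injective hinj
  rw [Cardinal.mk_Iio_ordinal, Cardinal.lift_lift, Cardinal.lift_le] at this
  exact this

theorem lt_tarskiLength (hu : Admissible univ) (I : Iteration N c R U)
    (hf : Enumerates R β f) : β < tarskiLength univ N :=
  (Order.lt_succ β).trans_le
    (le_csSup (bddAbove_isTarskiSeq hu I.arith_subset) (exists_isTarskiSeq hu I hf))

end

/-! ### Existence and uniqueness of the iterated truth predicate -/

section
variable {N : Set Symb} {c : Symb → ℕ} {R : ℕ → ℕ → Prop}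

theorem truthSet_stage_congr {U V : ℕ → ℕ → Prop} {n : ℕ} (h : ∀ m, Below R m n → U m = V m) :
    truthSet (stage N R U n) (inducedCoding N c R U n) =
      truthSet (stage N R V n) (inducedCoding N c R V n) := by
  have key : ∀ m s, (Below R m n ∧ s = pred₁ {x | U m x}) ↔
      (Below R m n ∧ s = pred₁ {x | V m x}) := fun m s =>
    and_congr_right fun hm => by rw [h m hm]
  have h1 : stage N R U n = stage N R V n := by simp only [stage, key]
  have h2 : inducedCoding N c R U n = inducedCoding N c R V n := by
    funext s
    simp only [inducedCoding, key]
  rw [h1, h2]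

theorem exists_mem_iteratedTruth (hR : WellFounded (Below R)) : ∃ U, U ∈ iteratedTruth N c R := by
  -- The columns not yet constructed are taken to be empty; by `truthSet_stage_congr` they do not
  -- influence the truth set at `n`.
  let F : (n : ℕ) → ((m : ℕ) → Below R m n → ℕ → Prop) → ℕ → Prop := fun n ih x =>
    n ∈ rng R ∧ x ∈ truthSet (stage N R (fun m y => ∃ h : Below R m n, ih m h y) n)
      (inducedCoding N c R (fun m y => ∃ h : Below R m n, ih m h y) n)
  refine ⟨hR.fix F, fun n hn => ?_, fun n hn => ?_⟩
  · ext x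
    rw [hR.fix_eq]
    exact iff_of_false (fun h => hn h.1) (Set.notMem_empty x)
  · ext x
    rw [Set.mem_ofPred_eq, hR.fix_eq]
    refine (and_iff_right hn).trans (Set.ext_iff.1 (truthSet_stage_congr fun m hm => ?_) x)
    ext y
    exact exists_prop_of_true hm

theorem iteratedTruth_subsingleton (hR : WellFounded (Below R)) :
    (iteratedTruth N c R).Subsingleton := by
  intro U hU V hV
  funext n
  induction n using hR.induction with
  | _ n ih =>
  ext x
  by_cases hn : n ∈ rng R
  · exact Set.ext_iff.1 ((hU.2 n hn).trans ((truthSet_stage_congr ih).trans (hV.2 n hn).symm)) x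
  · exact Set.ext_iff.1 ((hU.1 n hn).trans (hV.1 n hn).symm) x

end

/-! ### Representations of ordinals -/

section
variable {R : ℕ → ℕ → Prop} {α : Ordinal.{0}}

/-- Numbers outside `rng R` have no predecessors, so the well-ordering of the range makes the
relation well-founded on all of `ℕ`. -/
theorem IsRepresentation.wellFounded (hR : IsRepresentation R α) : WellFounded (Below R) := by
  obtain ⟨-, hwo, -⟩ := hR
  have key : ∀ x : rng R, Acc (Below R) x.1 := fun x => by
    induction x using (IsWellFounded.wf (r := fun x y : rng R => Below R x y)).induction with
    | _ x ih =>
    exact ⟨_, fun y hy => by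
      by_cases h : y ∈ rng R
      · exact ih ⟨y, h⟩ hy
      · exact ⟨_, fun z hz => absurd ⟨z, hz.1⟩ h⟩⟩
  refine ⟨fun x => ?_⟩
  by_cases h : x ∈ rng R
  · exact key ⟨x, h⟩
  · exact ⟨_, fun z hz => absurd ⟨z, hz.1⟩ h⟩

/-- By induction the elements removed at `γ` are those of rank below `γ`, so the element of rank `γ`
is the `R`-least of the rest. -/
theorem ordElem_eq_enum (hR : IsLinearOrdering R)
    [hwo : IsWellOrder (rng R) (fun x y => Below R x y)] (γ : Ordinal.{0}) :
    ∀ h : γ < Ordinal.type (fun x y : rng R => Below R x y),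
      ordElem R γ = (Ordinal.enum (fun x y : rng R => Below R x y) ⟨γ, h⟩ : rng R).1 := by
  induction γ using WellFoundedLT.induction with
  | _ γ ih =>
  intro hγ
  set r := fun x y : rng R => Below R x y with hr
  set e := Ordinal.enum r ⟨γ, hγ⟩ with he
  have hmem : e.1 ∈ rng R \ {x | ∃ δ, ∃ _ : δ < γ, ordElem R δ = x} := by
    refine ⟨e.2, ?_⟩
    rintro ⟨δ, hδ, h⟩
    rw [ih δ hδ (hδ.trans hγ)] at h
    have h1 := (Ordinal.enum r).injective (Subtype.ext h)
    exact hδ.ne (congrArg Subtype.val h1)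
  have hmin : ∀ b ∈ rng R \ {x | ∃ δ, ∃ _ : δ < γ, ordElem R δ = x}, R e.1 b := by
    rintro b ⟨hb, hb'⟩
    by_contra h
    have h1 : r ⟨b, hb⟩ e := by
      refine ⟨(hR.total _ e.2 _ hb).resolve_left h, ?_⟩
      rintro rfl
      exact h (hR.refl _ hb)
    have h2 : Ordinal.typein r ⟨b, hb⟩ < γ := by
      have := (Ordinal.typein_lt_typein r).2 h1
      rwa [he, Ordinal.typein_enum] at this
    refine hb' ⟨_, h2, ?_⟩
    rw [ih _ h2 (h2.trans hγ), Ordinal.enum_typein]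
  rw [ordElem, smallest]
  have : {a | a ∈ rng R \ {x | ∃ δ, ∃ _ : δ < γ, ordElem R δ = x} ∧
      ∀ b ∈ rng R \ {x | ∃ δ, ∃ _ : δ < γ, ordElem R δ = x}, R a b} = {e.1} := by
    ext a
    refine ⟨fun h => hR.antisymm _ _ (h.2 _ hmem) (hmin _ h.1), ?_⟩
    rintro rfl
    exact ⟨hmem, hmin⟩
  rw [this, csInf_singleton]

theorem IsRepresentation.ordElem_mem (hR : IsRepresentation R α) {γ : Ordinal.{0}} (hγ : γ < α) :
    ordElem R γ ∈ rng R := by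
  obtain ⟨h, hwo, rfl⟩ := hR
  rw [ordElem_eq_enum h γ hγ]
  exact Subtype.property _

theorem IsRepresentation.below_ordElem (hR : IsRepresentation R α) {γ δ : Ordinal.{0}}
    (h : γ < δ) (hδ : δ < α) : Below R (ordElem R γ) (ordElem R δ) := by
  obtain ⟨h', hwo, rfl⟩ := hR
  rw [ordElem_eq_enum h' γ (h.trans hδ), ordElem_eq_enum h' δ hδ]
  exact (Ordinal.enum_lt_enum (r := fun x y : rng R => Below R x y)).2 h

theorem IsRepresentation.exists_ordElem_eq (hR : IsRepresentation R α) {x : ℕ} (hx : x ∈ rng R) :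
    ∃ γ < α, ordElem R γ = x := by
  obtain ⟨h, hwo, rfl⟩ := hR
  refine ⟨_, Ordinal.typein_lt_type _ ⟨x, hx⟩, ?_⟩
  rw [ordElem_eq_enum h _ (Ordinal.typein_lt_type _ _), Ordinal.enum_typein]

theorem IsRepresentation.below_ordElem_iff (hR : IsRepresentation R α) {γ : Ordinal.{0}}
    (hγ : γ < α) {m : ℕ} : Below R m (ordElem R γ) ↔ ∃ δ < γ, m = ordElem R δ := by
  constructor
  · intro h
    obtain ⟨δ, hδ, rfl⟩ := hR.exists_ordElem_eq (hR.1.dom _ _ h.1)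
    refine ⟨δ, ?_, rfl⟩
    by_contra hle
    rcases (not_lt.1 hle).lt_or_eq with h1 | rfl
    · exact h.2 (hR.1.antisymm _ _ h.1 (hR.below_ordElem h1 hδ).1)
    · exact h.2 rfl
  · rintro ⟨δ, hδ, rfl⟩
    exact hR.below_ordElem hδ hγ

theorem IsRepresentation.enumerates {β : Ordinal.{0}} (hR : IsRepresentation R (Order.succ β)) :
    Enumerates R β (ordElem R) := fun _ h =>
  ⟨hR.ordElem_mem (Order.lt_succ_iff.2 h), fun _ => hR.below_ordElem_iff (Order.lt_succ_iff.2 h)⟩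

/-! ### Adding a greatest element to a representation -/

/-- A copy of `R` on odd numbers, with the additional greatest element `0`. -/
def withTop (R : ℕ → ℕ → Prop) (x y : ℕ) : Prop :=
  (∃ a b, x = 2 * a + 1 ∧ y = 2 * b + 1 ∧ R a b) ∨
    (y = 0 ∧ (x = 0 ∨ ∃ a, x = 2 * a + 1 ∧ R a a))

theorem withTop_odd {a b : ℕ} : withTop R (2 * a + 1) (2 * b + 1) ↔ R a b := by
  constructor
  · rintro (⟨a', b', h1, h2, h⟩ | ⟨h, -⟩)
    · obtain rfl : a = a' := by omega
      obtain rfl : b = b' := by omega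
      exact h
    · omega
  · exact fun h => Or.inl ⟨a, b, rfl, rfl, h⟩

theorem withTop_odd_zero {a : ℕ} : withTop R (2 * a + 1) 0 ↔ R a a := by
  constructor
  · rintro (⟨a', b', h1, h2, h⟩ | ⟨-, h | ⟨a', h, h'⟩⟩)
    · omega
    · omega
    · obtain rfl : a = a' := by omega
      exact h'
  · exact fun h => Or.inr ⟨rfl, Or.inr ⟨a, rfl, h⟩⟩

theorem withTop_zero_zero : withTop R 0 0 := Or.inr ⟨rfl, Or.inl rfl⟩

theorem not_withTop_zero_odd {b : ℕ} : ¬ withTop R 0 (2 * b + 1) := by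
  rintro (⟨a', b', h1, h2, h⟩ | ⟨h, -⟩) <;> omega

theorem withTop_cases {x y : ℕ} (h : withTop R x y) :
    (x = 0 ∧ y = 0) ∨ (∃ a, x = 2 * a + 1 ∧ y = 0) ∨ ∃ a b, x = 2 * a + 1 ∧ y = 2 * b + 1 := by
  rcases h with ⟨a, b, rfl, rfl, -⟩ | ⟨rfl, rfl | ⟨a, rfl, -⟩⟩
  · exact Or.inr (Or.inr ⟨a, b, rfl, rfl⟩)
  · exact Or.inl ⟨rfl, rfl⟩
  · exact Or.inr (Or.inl ⟨a, rfl, rfl⟩)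

theorem mem_rng_withTop (hR : IsLinearOrdering R) {x : ℕ} :
    x ∈ rng (withTop R) ↔ x = 0 ∨ ∃ a ∈ rng R, x = 2 * a + 1 := by
  constructor
  · rintro ⟨y, ⟨a, b, rfl, rfl, h⟩ | ⟨rfl, -⟩⟩
    · exact Or.inr ⟨b, ⟨a, h⟩, rfl⟩
    · exact Or.inl rfl
  · rintro (rfl | ⟨a, ha, rfl⟩)
    · exact ⟨0, withTop_zero_zero⟩
    · exact ⟨_, withTop_odd.2 (hR.refl a ha)⟩

theorem isLinearOrdering_withTop (hR : IsLinearOrdering R) : IsLinearOrdering (withTop R) where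
  dom x y h := by
    rw [mem_rng_withTop hR]
    rcases h with ⟨a, b, rfl, rfl, h⟩ | ⟨rfl, rfl | ⟨a, rfl, h⟩⟩
    · exact Or.inr ⟨a, hR.dom _ _ h, rfl⟩
    · exact Or.inl rfl
    · exact Or.inr ⟨a, ⟨a, h⟩, rfl⟩
  refl x h := by
    rcases (mem_rng_withTop hR).1 h with rfl | ⟨a, ha, rfl⟩
    · exact withTop_zero_zero
    · exact withTop_odd.2 (hR.refl a ha)
  trans x y z h h' := by
    rcases withTop_cases h' with ⟨rfl, rfl⟩ | ⟨b, rfl, rfl⟩ | ⟨b, d, rfl, rfl⟩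
    · exact h
    · rcases withTop_cases h with ⟨-, h0⟩ | ⟨a, -, h0⟩ | ⟨a, -, rfl, -⟩
      · omega
      · omega
      · exact withTop_odd_zero.2 (hR.refl _ (hR.dom _ _ (withTop_odd.1 h)))
    · rcases withTop_cases h with ⟨-, h0⟩ | ⟨a, -, h0⟩ | ⟨a, -, rfl, -⟩
      · omega
      · omega
      · exact withTop_odd.2 (hR.trans _ _ _ (withTop_odd.1 h) (withTop_odd.1 h'))
  antisymm x y h h' := by
    rcases withTop_cases h with ⟨rfl, rfl⟩ | ⟨a, rfl, rfl⟩ | ⟨a, b, rfl, rfl⟩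
    · rfl
    · exact absurd h' not_withTop_zero_odd
    · rw [hR.antisymm _ _ (withTop_odd.1 h) (withTop_odd.1 h')]
  total x hx y hy := by
    rcases (mem_rng_withTop hR).1 hx with rfl | ⟨a, ha, rfl⟩ <;>
      rcases (mem_rng_withTop hR).1 hy with rfl | ⟨b, hb, rfl⟩
    · exact Or.inl withTop_zero_zero
    · exact Or.inr (withTop_odd_zero.2 (hR.refl b hb))
    · exact Or.inl (withTop_odd_zero.2 (hR.refl a ha))
    · exact (hR.total a ha b hb).imp withTop_odd.2 withTop_odd.2

theorem below_withTop_odd {x b : ℕ} :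
    Below (withTop R) x (2 * b + 1) ↔ ∃ a, x = 2 * a + 1 ∧ Below R a b := by
  constructor
  · rintro ⟨h, hne⟩
    rcases withTop_cases h with ⟨-, h0⟩ | ⟨a, -, h0⟩ | ⟨a, -, rfl, -⟩
    · omega
    · omega
    · exact ⟨a, rfl, withTop_odd.1 h, fun h' => hne (by rw [h'])⟩
  · rintro ⟨a, rfl, h, hne⟩
    exact ⟨withTop_odd.2 h, by omega⟩

theorem below_withTop_zero (hR : IsLinearOrdering R) {x : ℕ} :
    Below (withTop R) x 0 ↔ ∃ a ∈ rng R, x = 2 * a + 1 := by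
  constructor
  · rintro ⟨h, hne⟩
    exact ((mem_rng_withTop hR).1 ((isLinearOrdering_withTop hR).dom _ _ h)).resolve_left hne
  · rintro ⟨a, ha, rfl⟩
    exact ⟨withTop_odd_zero.2 (hR.refl a ha), by omega⟩

theorem wellFounded_below_withTop (h : WellFounded (Below R)) :
    WellFounded (Below (withTop R)) := by
  have key : ∀ a, Acc (Below (withTop R)) (2 * a + 1) := fun a => by
    induction a using h.induction with
    | _ a ih =>
    refine ⟨_, fun y hy => ?_⟩
    obtain ⟨b, rfl, hb⟩ := below_withTop_odd.1 hy
    exact ih b hb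
  have key' : ∀ x y, Below (withTop R) y x → Acc (Below (withTop R)) y := by
    intro x y hy
    rcases withTop_cases hy.1 with ⟨rfl, rfl⟩ | ⟨a, rfl, -⟩ | ⟨a, b, rfl, -⟩
    · exact absurd rfl hy.2
    · exact key a
    · exact key a
  exact ⟨fun x => ⟨_, key' x⟩⟩

-- A representation of `β` has no element of index `β`; the added top supplies it, and with it a
-- truth predicate that continues the hierarchy past `M_β`.
open Classical in
theorem IsRepresentation.enumerates_withTop {β : Ordinal.{0}} (hR : IsRepresentation R β) :
    Enumerates (withTop R) β fun γ => if γ < β then 2 * ordElem R γ + 1 else 0 := by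
  intro γ hγ
  beta_reduce
  rw [mem_rng_withTop hR.1]
  rcases hγ.lt_or_eq with h | rfl
  · rw [if_pos h]
    refine ⟨Or.inr ⟨_, hR.ordElem_mem h, rfl⟩, fun m => ?_⟩
    rw [below_withTop_odd]
    constructor
    · rintro ⟨a, rfl, ha⟩
      obtain ⟨δ, hδ, rfl⟩ := (hR.below_ordElem_iff h).1 ha
      exact ⟨δ, hδ, (if_pos (hδ.trans h)).symm⟩
    · rintro ⟨δ, hδ, rfl⟩
      exact ⟨_, if_pos (hδ.trans h), hR.below_ordElem hδ h⟩
  · rw [if_neg (lt_irrefl γ)]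
    refine ⟨Or.inl rfl, fun m => ?_⟩
    rw [below_withTop_zero hR.1]
    constructor
    · rintro ⟨a, ha, rfl⟩
      obtain ⟨δ, hδ, rfl⟩ := hR.exists_ordElem_eq ha
      exact ⟨δ, hδ, (if_pos hδ).symm⟩
    · rintro ⟨δ, hδ, rfl⟩
      exact ⟨_, hR.ordElem_mem hδ, if_pos hδ⟩

theorem Dfn.withTop {M : Set Symb} [Fact (arith ⊆ M)]
    (h : Dfn M fun p : ℕ × ℕ => R p.1 p.2) : Dfn M fun p : ℕ × ℕ => withTop R p.1 p.2 := by
  unfold UniversalPredicates.withTop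
  refine .or (.ex (.ex (.and (by fun_prop) (.and (by fun_prop) ?_))))
    (.and (by fun_prop) (.or (by fun_prop) (.ex (.and (by fun_prop) ?_))))
  · exact h.comp (f := fun p : ((ℕ × ℕ) × ℕ) × ℕ => (p.1.2, p.2)) (by fun_prop)
  · exact h.comp (f := fun p : (ℕ × ℕ) × ℕ => (p.2, p.2)) (by fun_prop)

end

/-! ### The theorem for both notions of a universal predicate -/

section
variable {univ : Set Symb → (ℕ → ℕ → Prop) → Prop} {N : Set Symb} {β : Ordinal.{0}}

theorem OrdinalDefinable.lt_tarskiLength (hu : Admissible univ) (hN : IsStructure N)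
    (hfin : N.Finite) (hβ : OrdinalDefinable N β) : β < tarskiLength univ N := by
  obtain ⟨R, hR, hdef⟩ := hβ
  have : Fact (arith ⊆ N) := ⟨hN⟩
  obtain ⟨g, hg⟩ := Set.countable_iff_exists_injOn.1 hfin.countable
  have hwf := wellFounded_below_withTop hR.wellFounded
  -- The codes `2 * g s + 2` are even and positive, hence avoid the odd numbers and the `0` that
  -- form the range of `withTop R`.
  obtain ⟨U, hU⟩ := exists_mem_iteratedTruth (N := N) (c := fun s => 2 * g s + 2) hwf
  have I : Iteration N (fun s => 2 * g s + 2) (withTop R) U :=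
    { arith_subset := hN
      finite := hfin
      coding := fun s hs t ht h => hg hs ht (by simpa using h)
      compatible := by
        rw [Compatible, Set.disjoint_left]
        rintro _ ⟨s, -, rfl⟩ h
        rcases (mem_rng_withTop hR.1).1 h with h | ⟨a, -, h⟩ <;> simp only at h <;> omega
      linear := isLinearOrdering_withTop hR.1
      wf := hwf
      definable := definable₂_iff_dfn.2 (definable₂_iff_dfn.1 hdef).withTop
      iterated := hU }
  exact UniversalPredicates.lt_tarskiLength hu I hR.enumerates_withTop

theorem IsTarskiSeq.defEquiv_iteratedTruth (hu : Admissible univ) (hN : IsStructure N)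
    (hfin : N.Finite) {ξ : Ordinal.{0}} {M : Ordinal.{0} → Set Symb} (hβ : β ≤ ξ)
    (hM : IsTarskiSeq univ N ξ M) {c : Symb → ℕ} {R P : ℕ → ℕ → Prop} (hc : IsCoding N c)
    (hR : IsRepresentation R (Order.succ β)) (hcR : Compatible N c R) (hdef : Definable₂ N R)
    (hP : IsCanonic univ (M β) P) :
    ∃ U, iteratedTruth N c R = {U} ∧
      DefEquiv (arith ∪ {pred₂ P}) (arith ∪ {pred₁ {x | U (ordElem R β) x}}) := by
  obtain ⟨U, hU⟩ := exists_mem_iteratedTruth (N := N) (c := c) hR.wellFounded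
  have I : Iteration N c R U := ⟨hN, hfin, hc, hcR, hR.1, hR.wellFounded, hdef, hU⟩
  obtain ⟨h1, h2, h3⟩ := hM.interp_stage hu I hR.enumerates hβ β le_rfl
  exact ⟨U, (iteratedTruth_subsingleton hR.wellFounded).eq_singleton_of_mem hU,
    defEquiv_of_isCanonic hu I (hR.enumerates β le_rfl).1 h1 h2 h3 hP⟩

end

end UniversalPredicates

theorem mainTheorem6 (N : Set Symb) (hN : IsStructure N) (hfin : N.Finite)
    (β : Ordinal.{0}) (hβ : OrdinalDefinable N β) :
    -- the Tarski hierarchy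
    (β < tarskiLength IsUniversal N ∧
      ∀ (ξ : Ordinal.{0}) (M : Ordinal.{0} → Set Symb),
        β ≤ ξ → IsTarskiSeq IsUniversal N ξ M →
        ∀ (c : Symb → ℕ) (R P : ℕ → ℕ → Prop), IsCoding N c →
          IsRepresentation R (Order.succ β) → Compatible N c R → Definable₂ N R →
          IsCanonic IsUniversal (M β) P →
          ∃ U, iteratedTruth N c R = {U} ∧
            DefEquiv (arith ∪ {pred₂ P}) (arith ∪ {pred₁ {x | U (ordElem R β) x}})) ∧
    -- the proper Tarski hierarchy
    (β < tarskiLength IsProperUniversal N ∧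
      ∀ (ξ : Ordinal.{0}) (M : Ordinal.{0} → Set Symb),
        β ≤ ξ → IsTarskiSeq IsProperUniversal N ξ M →
        ∀ (c : Symb → ℕ) (R P : ℕ → ℕ → Prop), IsCoding N c →
          IsRepresentation R (Order.succ β) → Compatible N c R → Definable₂ N R →
          IsCanonic IsProperUniversal (M β) P →
          ∃ U, iteratedTruth N c R = {U} ∧
            DefEquiv (arith ∪ {pred₂ P}) (arith ∪ {pred₁ {x | U (ordElem R β) x}})) := by
  refine ⟨⟨hβ.lt_tarskiLength admissible_isUniversal hN hfin, ?_⟩,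
    ⟨hβ.lt_tarskiLength admissible_isProperUniversal hN hfin, ?_⟩⟩
  · intro ξ M hξ hM c R P hc hR hcR hdef hP
    exact hM.defEquiv_iteratedTruth admissible_isUniversal hN hfin hξ hc hR hcR hdef hP
  · intro ξ M hξ hM c R P hc hR hcR hdef hP
    exact hM.defEquiv_iteratedTruth admissible_isProperUniversal hN hfin hξ hc hR hcR hdef hP
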